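/- Notation. All spaces are real. Let $(\Omega,\Sigma,\mu)$, $(\Omega',\Sigma',\nu)$ be $\sigma$-finite measure spaces. A Banach function space over $\mu$ is a linear space $X$ of (classes of a.e. equal) measurable functions with a complete norm such that $|f|\le|g|$ a.e., $f$ measurable, $g\in X$ imply $f\in X$ and $\|f\|_X\le\|g\|_X$, and such that every measurable set of positive measure contains a measurable set of positive measure whose indicator lies in $X$. It is order continuous if $\inf_{f\in D}\|f\|=0$ for every nonempty downward directed $D\subset X$ with $\inf D=0$. It is $r$-convex (resp. $r$-concave) if for some $M$ one has $\|(\sum_i|x_i|^r)^{1/r}\|\le M(\sum_i\|x_i\|^r)^{1/r}$ (resp. $(\sum_i\|x_i\|^r)^{1/r}\le M\|(\sum_i|x_i|^r)^{1/r}\|$) for all finite families in $X$. The Köthe dual of $Y$ is $Y'=\{y' \text{ measurable}: \|y'\|_{Y'}=\sup_{\|y\|_Y\le1}\int|yy'|\,d\nu<\infty\}$, with pairing $\langle y,y'\rangle=\int yy'\,d\nu$. For $0<p,q\le\infty$ a linear map $S$ between Banach function spaces is $(p,q)$-regular if there is $K>0$ with $\|(\sum_i|Sx_i|^p)^{1/p}\|\le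 K\|(\sum_i|x_i|^q)^{1/q}\|$ for all finite families $(x_i)$. Here and below sums with an infinite exponent are replaced by suprema. $M_f$ denotes multiplication by $f$. Theorem. Let $1\le r<\infty$, $1\le p\le\infty$, $0<q\le\infty$, and let $r',p'$ be the conjugate exponents of $r,p$. Let $X$ be an $r$-convex Banach function space over $(\Omega,\Sigma,\mu)$ and $Y$ an $r$-concave Banach function space over $(\Omega',\Sigma',\nu)$ such that $X$ and $Y'$ are order continuous, and let $T:X\to Y$ be a bounded linear operator. The following are equivalent. (i) There is a constant $K>0$ such that for all $n,m$ and all matrices $(x_{i,j})_{i=1,j=1}^{n,m}$ in $X$ and $(y'_{i,j})_{i=1,j=1}^{n,m}$ in $Y'$, $$\sum_{i=1}^n\sum_{j=1}^m|\langle Tx_{i,j},y'_{i,j}\rangle|\le K\,\Big\|\Big(\sum_{i=1}^n\Big(\sum_{j=1}^m|x_{i,j}|^q\Big)^{\frac rq}\Big)^{\frac1r}\Big\|_X\,\Big\|\Big(\sum_{i=1}^n\Big(\sum_{j=1}^m|y'_{i,j}|^{p'}\Big)^{\frac{r'}{p'}}\Big)^{\frac1{r'}}\Big\|_{Y'}.$$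 (ii) There is a constant $K>0$ such that for all $n,m$ and every matrix $(x_{i,j})_{i=1,j=1}^{n,m}$ in $X$, $$\Big\|\Big(\sum_{i=1}^n\Big(\sum_{j=1}^m|Tx_{i,j}|^p\Big)^{\frac rp}\Big)^{\frac1r}\Big\|_Y\le K\,\Big\|\Big(\sum_{i=1}^n\Big(\sum_{j=1}^m|x_{i,j}|^q\Big)^{\frac rq}\Big)^{\frac1r}\Big\|_X.$$ (iii) There are measurable functions $f$ on $\Omega$ and $g$ on $\Omega'$ such that $M_f$ maps $X$ into $L_r(\mu)$ and $M_g$ maps $L_r(\nu)$ into $Y$, and a bounded linear $(p,q)$-regular operator $\hat T:L_r(\mu)\to L_r(\nu)$ such that $T=M_g\circ\hat T\circ M_f$. -/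

import Mathlib

open MeasureTheory Filter Topology
open scoped ENNReal NNReal

noncomputable section

namespace RegularOperators

/-- The `ℓ_p` norm (quasi-norm for `p < 1`) of a finite family of real numbers, `0 < p ≤ ∞`. -/
def ellNorm (p : ℝ≥0∞) {n : ℕ} (a : Fin n → ℝ) : ℝ :=
  if p = ∞ then ⨆ i, |a i| else (∑ i, |a i| ^ p.toReal) ^ (1 / p.toReal)

variable {Ω : Type*} [MeasurableSpace Ω] {μ : Measure Ω}

theorem aestronglyMeasurable_ellNorm (p : ℝ≥0∞) {n : ℕ} (x : Fin n → (Ω →ₘ[μ] ℝ)) :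
    AEStronglyMeasurable (fun ω => ellNorm p (fun i => x i ω)) μ := by
  have hx : ∀ i, Measurable (fun ω => |x i ω|) := fun i =>
    (x i).stronglyMeasurable.measurable.abs
  apply Measurable.aestronglyMeasurable
  unfold ellNorm
  split_ifs with h
  · exact Measurable.iSup hx
  · exact (Finset.measurable_sum _ fun i _ => (hx i).pow_const _).pow_const _

/-- The function `(∑ i, |x i|^p)^(1/p)` (resp. `⋁ i, |x i|` if `p = ∞`), defined pointwise a.e. -/
def lpSum (p : ℝ≥0∞) {n : ℕ} (x : Fin n → (Ω →ₘ[μ] ℝ)) : Ω →ₘ[μ] ℝ :=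
  AEEqFun.mk (fun ω => ellNorm p (fun i => x i ω)) (aestronglyMeasurable_ellNorm p x)

/-- The function `(∑ i, (∑ j, |x i j|^q)^(r/q))^(1/r)`, with the usual changes for infinite
exponents. -/
def mixedSum (r q : ℝ≥0∞) {n m : ℕ} (x : Fin n → Fin m → (Ω →ₘ[μ] ℝ)) : Ω →ₘ[μ] ℝ :=
  lpSum r (fun i => lpSum q (x i))

/-- The indicator function of a measurable set, as a class of measurable functions. -/
def chi (μ : Measure Ω) (A : Set Ω) (hA : MeasurableSet A) : Ω →ₘ[μ] ℝ :=
  AEEqFun.mk (A.indicator fun _ => (1 : ℝ))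
    (stronglyMeasurable_const.indicator hA).aestronglyMeasurable

variable (μ) in
/-- A (real) Banach function space over `(Ω, Σ, μ)`: an order ideal of the space of (classes of)
measurable functions, complete for a lattice norm, and saturated (every set of positive measure
contains a set of positive measure whose indicator belongs to the space; in particular this
covers the definition in which the indicators of all sets of finite measure belong to the space).
It is given by its norm, extended by the value `∞` outside the space. -/
structure BanachFunctionSpace where
  norm : (Ω →ₘ[μ] ℝ) → ℝ≥0∞
  eq_zero_of_norm : ∀ f, norm f = 0 → f = 0
  norm_add_le : ∀ f g, norm (f + g) ≤ norm f + norm g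
  norm_smul : ∀ (c : ℝ) f, norm (c • f) = ‖c‖ₑ * norm f
  norm_mono : ∀ f g, |f| ≤ |g| → norm f ≤ norm g
  complete : ∀ f : ℕ → (Ω →ₘ[μ] ℝ), (∀ n, norm (f n) < ∞) →
    (∀ ε : ℝ≥0∞, 0 < ε → ∃ N, ∀ m ≥ N, ∀ n ≥ N, norm (f m - f n) ≤ ε) →
    ∃ g, norm g < ∞ ∧ Tendsto (fun n => norm (f n - g)) atTop (𝓝 0)
  saturated : ∀ A, MeasurableSet A → μ A ≠ 0 →
    ∃ (B : Set Ω) (hB : MeasurableSet B), B ⊆ A ∧ μ B ≠ 0 ∧ norm (chi μ B hB) < ∞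

namespace BanachFunctionSpace

theorem norm_zero (X : BanachFunctionSpace μ) : X.norm 0 = 0 := by
  simpa using X.norm_smul 0 0

/-- The vector space underlying `X`. -/
def space (X : BanachFunctionSpace μ) : Submodule ℝ (Ω →ₘ[μ] ℝ) where
  carrier := {f | X.norm f < ∞}
  add_mem' := fun {f g} hf hg =>
    lt_of_le_of_lt (X.norm_add_le f g) (ENNReal.add_lt_top.2 ⟨hf, hg⟩)
  zero_mem' := by simp [X.norm_zero]
  smul_mem' := fun c f hf => by
    change X.norm (c • f) < ∞
    rw [X.norm_smul]
    exact ENNReal.mul_lt_top enorm_lt_top hf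

instance (X : BanachFunctionSpace μ) : Norm X.space := ⟨fun x => (X.norm x).toReal⟩

theorem core (X : BanachFunctionSpace μ) : NormedSpace.Core ℝ X.space where
  norm_nonneg _ := ENNReal.toReal_nonneg
  norm_smul c x := by
    change (X.norm (c • (x : Ω →ₘ[μ] ℝ))).toReal = ‖c‖ * (X.norm x).toReal
    rw [X.norm_smul, ENNReal.toReal_mul, toReal_enorm]
  norm_triangle x y := by
    change (X.norm ((x : Ω →ₘ[μ] ℝ) + y)).toReal ≤ (X.norm x).toReal + (X.norm y).toReal
    rw [← ENNReal.toReal_add x.2.ne y.2.ne]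
    exact ENNReal.toReal_mono (ENNReal.add_lt_top.2 ⟨x.2, y.2⟩).ne (X.norm_add_le _ _)
  norm_eq_zero_iff x := by
    change (X.norm x).toReal = 0 ↔ x = 0
    rw [ENNReal.toReal_eq_zero_iff]
    constructor
    · rintro (h | h)
      · exact Subtype.ext (X.eq_zero_of_norm _ h)
      · exact absurd h x.2.ne
    · rintro rfl
      exact Or.inl X.norm_zero

instance (X : BanachFunctionSpace μ) : NormedAddCommGroup X.space :=
  NormedAddCommGroup.ofCore X.core

instance (X : BanachFunctionSpace μ) : NormedSpace ℝ X.space :=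
  NormedSpace.ofCore X.core

/-- `X` is `r`-convex: `‖(∑ |x_i|^r)^(1/r)‖ ≤ M (∑ ‖x_i‖^r)^(1/r)` for all finite families. -/
def IsConvex (r : ℝ≥0∞) (X : BanachFunctionSpace μ) : Prop :=
  ∃ M : ℝ≥0, ∀ (n : ℕ) (x : Fin n → X.space),
    X.norm (lpSum r (fun i => (x i : Ω →ₘ[μ] ℝ))) ≤
      M * ENNReal.ofReal (ellNorm r (fun i => ‖x i‖))

/-- `X` is `r`-concave: `(∑ ‖x_i‖^r)^(1/r) ≤ M ‖(∑ |x_i|^r)^(1/r)‖` for all finite families. -/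
def IsConcave (r : ℝ≥0∞) (X : BanachFunctionSpace μ) : Prop :=
  ∃ M : ℝ≥0, ∀ (n : ℕ) (x : Fin n → X.space),
    ENNReal.ofReal (ellNorm r (fun i => ‖x i‖)) ≤
      M * X.norm (lpSum r (fun i => (x i : Ω →ₘ[μ] ℝ)))

/-- The norm of the Köthe dual `X'`, with the value `∞` outside `X'`:
`‖g‖ = sup {∫ |x g| dμ : ‖x‖_X ≤ 1}`. -/
def dualNorm (X : BanachFunctionSpace μ) (g : Ω →ₘ[μ] ℝ) : ℝ≥0∞ :=
  ⨆ (x : Ω →ₘ[μ] ℝ) (_ : X.norm x ≤ 1), ∫⁻ ω, ‖x ω * g ω‖ₑ ∂μ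

end BanachFunctionSpace

/-- Order continuity of the lattice norm `ρ` of a space `{f | ρ f < ∞}` of measurable functions:
every downward directed set in the space with infimum `0` has norms with infimum `0`. -/
def OrderContinuous (ρ : (Ω →ₘ[μ] ℝ) → ℝ≥0∞) : Prop :=
  ∀ D : Set (Ω →ₘ[μ] ℝ), D.Nonempty → DirectedOn (· ≥ ·) D → (∀ f ∈ D, ρ f < ∞) →
    IsGLB D 0 → ⨅ f ∈ D, ρ f = 0

variable (μ) in
/-- The Lebesgue space `L_r(μ)`, `1 ≤ r ≤ ∞`, as a Banach function space. -/
def lebesgue [SigmaFinite μ] (r : ℝ≥0∞) (hr : 1 ≤ r) : BanachFunctionSpace μ where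
  norm f := eLpNorm f r μ
  eq_zero_of_norm f hf := by
    rw [eLpNorm_eq_zero_iff f.aestronglyMeasurable (one_pos.trans_le hr).ne'] at hf
    exact AEEqFun.ext (hf.trans AEEqFun.coeFn_zero.symm)
  norm_add_le f g := by
    rw [eLpNorm_congr_ae (AEEqFun.coeFn_add f g)]
    exact eLpNorm_add_le f.aestronglyMeasurable g.aestronglyMeasurable hr
  norm_smul c f := by
    rw [eLpNorm_congr_ae (AEEqFun.coeFn_smul c f)]
    exact eLpNorm_const_smul c f r μ
  norm_mono f g h := by
    apply eLpNorm_mono_ae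
    filter_upwards [AEEqFun.coeFn_le.2 h, AEEqFun.coeFn_abs f, AEEqFun.coeFn_abs g]
      with ω h1 h2 h3
    rw [h2, h3] at h1
    simpa using h1
  complete f hf hc := by
    have : Fact (1 ≤ r) := ⟨hr⟩
    let F : ℕ → Lp ℝ r μ := fun n => ⟨f n, Lp.mem_Lp_iff_eLpNorm_lt_top.2 (hf n)⟩
    have hF : CauchySeq F := by
      rw [EMetric.cauchySeq_iff]
      intro ε hε
      obtain ⟨N, hN⟩ := hc (min (ε / 2) 1) (lt_min (ENNReal.half_pos hε.ne') one_pos)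
      refine ⟨N, fun m hm n hn => ?_⟩
      rw [Lp.edist_def, ← eLpNorm_congr_ae (AEEqFun.coeFn_sub (f m) (f n))]
      by_cases h : ε = ∞
      · rw [h]
        exact ((hN m hm n hn).trans (min_le_right _ _)).trans_lt ENNReal.one_lt_top
      · exact ((hN m hm n hn).trans (min_le_left _ _)).trans_lt (ENNReal.half_lt_self hε.ne' h)
    obtain ⟨G, hG⟩ := cauchySeq_tendsto_of_complete hF
    refine ⟨G, Lp.eLpNorm_lt_top G, ?_⟩
    rw [tendsto_iff_edist_tendsto_0] at hG
    refine hG.congr fun n => ?_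
    rw [Lp.edist_def, ← eLpNorm_congr_ae (AEEqFun.coeFn_sub (f n) (G : Ω →ₘ[μ] ℝ))]
  saturated A hA h := by
    obtain ⟨B, hB, hBA, hpos, hfin⟩ :=
      Measure.exists_subset_measure_lt_top hA (pos_iff_ne_zero.2 h)
    refine ⟨B, hB, hBA, (pos_iff_ne_zero.1 hpos), ?_⟩
    unfold chi
    rw [eLpNorm_congr_ae (AEEqFun.coeFn_mk _ _)]
    exact (memLp_indicator_const r hB (1 : ℝ) (Or.inr hfin.ne)).2

variable {Ω' : Type*} [MeasurableSpace Ω'] {ν : Measure Ω'}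

/-- A linear map `T : X → Y` between Banach function spaces is `(p, q)`-regular:
`‖(∑ |T x_i|^p)^(1/p)‖ ≤ K ‖(∑ |x_i|^q)^(1/q)‖` for all finite families, with suprema in place of
the sums for infinite exponents. -/
def IsRegular (p q : ℝ≥0∞) {X : BanachFunctionSpace μ} {Y : BanachFunctionSpace ν}
    (T : X.space →ₗ[ℝ] Y.space) : Prop :=
  ∃ K : ℝ≥0, 0 < K ∧ ∀ (n : ℕ) (x : Fin n → X.space),
    Y.norm (lpSum p (fun i => (T (x i) : Ω' →ₘ[ν] ℝ))) ≤
      K * X.norm (lpSum q (fun i => (x i : Ω →ₘ[μ] ℝ)))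

/-- The multiplication operator `M_f : X → Z`, `x ↦ f x`. -/
def mulOp {X Z : BanachFunctionSpace μ} (f : Ω →ₘ[μ] ℝ)
    (hf : ∀ x ∈ X.space, f * x ∈ Z.space) : X.space →ₗ[ℝ] Z.space where
  toFun x := ⟨f * x, hf x x.2⟩
  map_add' x y := by
    apply Subtype.ext
    simp only [Submodule.coe_add]
    ext1
    filter_upwards [AEEqFun.coeFn_mul f ((x : Ω →ₘ[μ] ℝ) + y), AEEqFun.coeFn_mul f (x : Ω →ₘ[μ] ℝ),
      AEEqFun.coeFn_mul f (y : Ω →ₘ[μ] ℝ), AEEqFun.coeFn_add (x : Ω →ₘ[μ] ℝ) y,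
      AEEqFun.coeFn_add (f * (x : Ω →ₘ[μ] ℝ)) (f * y)] with ω h1 h2 h3 h4 h5
    simp only [h1, h5, Pi.mul_apply, Pi.add_apply, h2, h3, h4]
    ring
  map_smul' c x := by
    apply Subtype.ext
    simp only [Submodule.coe_smul, RingHom.id_apply]
    ext1
    filter_upwards [AEEqFun.coeFn_mul f (c • (x : Ω →ₘ[μ] ℝ)), AEEqFun.coeFn_mul f (x : Ω →ₘ[μ] ℝ),
      AEEqFun.coeFn_smul c (x : Ω →ₘ[μ] ℝ), AEEqFun.coeFn_smul c (f * (x : Ω →ₘ[μ] ℝ))]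
      with ω h1 h2 h3 h4
    simp only [h1, h4, Pi.mul_apply, Pi.smul_apply, h2, h3, smul_eq_mul]
    ring

end RegularOperators

end

/-! The equivalence of (i) and (ii) is the duality between the mixed norms of `Y(ℓ_r(ℓ_p))` and
`Y'(ℓ_r'(ℓ_p'))`. One direction is Hölder's inequality, first pointwise and then for the pair `Y`,
`Y'`. For the other, `r`-concavity with `r < ∞` makes `Y` order continuous, so the norm of each
nonnegative function in `Y` is reached by integration against a function in the unit ball of `Y'`;
measurable norming coefficients for `ℓ_r(ℓ_p)` distribute that function over the matrix entries
(`exists_dual_norming_mixed`).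

(iii) gives (ii) because on `L_r` the `ℓ_r` sum commutes with the norm: regularity of the middle
operator can be applied row by row, and the two multiplication operators are bounded and pass
through the pointwise sums.

(ii) gives (iii) by a Maurey–Rosenthal argument on the pairs `(u, v) = (c (∑ |x_j|^q)^(1/q), c (∑ |T
x_j|^p)^(1/p))`. For `r > 1`, Hölder, (ii) and Young show that `κ ∑ ∫ v_i y_i` is at most the sum of
the gauges of `∑ u_i^r` in the `r`-concavification of `X` and of `∑ y_i^r'` in the
`r'`-concavification of `Y'`. Convexity of `X` and of `Y'` makes both gauges subadditive up to a
constant not depending on the number of terms, so Hahn–Banach gives a dominated positive functional.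
Order continuity makes it a density `(f^r, g^r')` (`exists_weight`, `exists_density`), whence `κ ∫ v
y ≤ ∫ (f u)^r + ∫ (g y)^r'`. An optimal choice of `y` turns this into `∫ (v/g)^r ≤ C ∫ (f u)^r`
(`lintegral_rpow_div_le`). For `r = 1` the exponent `r'` is infinite, and two separate weights are
used instead (`hasFactorWeights_one`).

The last inequality says that `f x ↦ T x / g` is well defined, bounded and `(p, q)`-regular for the
`L_r` norms; it is set to zero on functions supported in `{f = 0}` and extended by density
(`HasFactorWeights.exists_factorization`). -/

namespace RegularOperators

/-! ### Finite `ℓ_p` norms with values in `[0, ∞]`. -/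

/-- The `ℓ_p` norm of a finite family in `[0, ∞]`. -/
noncomputable def ellENorm (p : ℝ≥0∞) {n : ℕ} (a : Fin n → ℝ≥0∞) : ℝ≥0∞ :=
  if p = ∞ then ⨆ i, a i else (∑ i, a i ^ p.toReal) ^ (1 / p.toReal)

section ellENorm

variable {p p' : ℝ≥0∞} {n : ℕ}

theorem ellENorm_top (a : Fin n → ℝ≥0∞) : ellENorm ∞ a = ⨆ i, a i := if_pos rfl

theorem ellENorm_of_ne_top (hp : p ≠ ∞) (a : Fin n → ℝ≥0∞) :
    ellENorm p a = (∑ i, a i ^ p.toReal) ^ (1 / p.toReal) := if_neg hp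

theorem ellENorm_one (a : Fin n → ℝ≥0∞) : ellENorm 1 a = ∑ i, a i := by
  simp [ellENorm_of_ne_top ENNReal.one_ne_top]

theorem ellENorm_rpow (hp : 0 < p) (hp' : p ≠ ∞) (a : Fin n → ℝ≥0∞) :
    ellENorm p a ^ p.toReal = ∑ i, a i ^ p.toReal := by
  have := (ENNReal.toReal_pos hp.ne' hp').ne'
  rw [ellENorm_of_ne_top hp', ← ENNReal.rpow_mul, one_div_mul_cancel this, ENNReal.rpow_one]

theorem ellENorm_mono {a b : Fin n → ℝ≥0∞} (h : ∀ i, a i ≤ b i) :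
    ellENorm p a ≤ ellENorm p b := by
  unfold ellENorm
  split_ifs
  · exact iSup_mono h
  · gcongr with i
    exact h i

theorem ellENorm_const_mul (hp : 0 < p) (c : ℝ≥0∞) (a : Fin n → ℝ≥0∞) :
    ellENorm p (fun i => c * a i) = c * ellENorm p a := by
  unfold ellENorm
  split_ifs with h
  · rw [ENNReal.mul_iSup]
  · have := ENNReal.toReal_pos hp.ne' h
    simp_rw [ENNReal.mul_rpow_of_nonneg _ _ this.le]
    rw [← Finset.mul_sum, ENNReal.mul_rpow_of_nonneg _ _ (one_div_pos.2 this).le,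
      ← ENNReal.rpow_mul, mul_one_div_cancel this.ne', ENNReal.rpow_one]

theorem le_ellENorm (hp : 0 < p) (a : Fin n → ℝ≥0∞) (i : Fin n) : a i ≤ ellENorm p a := by
  unfold ellENorm
  split_ifs with h
  · exact le_iSup a i
  · have := ENNReal.toReal_pos hp.ne' h
    rw [one_div, ENNReal.le_rpow_inv_iff this]
    exact Finset.single_le_sum (f := fun i => a i ^ p.toReal) (fun _ _ => zero_le) (Finset.mem_univ i)

theorem ellENorm_le_const_mul_sum (hp : 0 < p) (n : ℕ) :
    ∃ C : ℝ≥0, ∀ a : Fin n → ℝ≥0∞, ellENorm p a ≤ C * ∑ i, a i := by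
  have hfin : ellENorm p (fun _ : Fin n => (1 : ℝ≥0∞)) ≠ ∞ := by
    unfold ellENorm
    split_ifs with h
    · exact ne_top_of_le_ne_top ENNReal.one_ne_top (iSup_le fun _ => le_rfl)
    · simp
  refine ⟨(ellENorm p (fun _ : Fin n => (1 : ℝ≥0∞))).toNNReal, fun a => ?_⟩
  rw [ENNReal.coe_toNNReal hfin, mul_comm, ← ellENorm_const_mul hp]
  refine ellENorm_mono fun i => ?_
  rw [mul_one]
  exact Finset.single_le_sum (f := a) (fun _ _ => zero_le) (Finset.mem_univ i)

theorem sum_rpow_le_rpow_sum {ι : Type*} (s : Finset ι) (a : ι → ℝ≥0∞) {t : ℝ} (ht : 1 ≤ t) :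
    ∑ i ∈ s, a i ^ t ≤ (∑ i ∈ s, a i) ^ t := by
  classical
  induction s using Finset.induction_on with
  | empty => simp
  | insert i s hi ih =>
    rw [Finset.sum_insert hi, Finset.sum_insert hi]
    exact (add_le_add le_rfl ih).trans (ENNReal.add_rpow_le_rpow_add _ _ ht)

theorem ellENorm_le_sum (hp : 1 ≤ p) (a : Fin n → ℝ≥0∞) : ellENorm p a ≤ ∑ i, a i := by
  unfold ellENorm
  split_ifs with h
  · exact iSup_le fun i => Finset.single_le_sum (f := a) (fun _ _ => zero_le) (Finset.mem_univ i)
  · have h1 : 1 ≤ p.toReal := by simpa using ENNReal.toReal_mono h hp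
    rw [one_div, ENNReal.rpow_inv_le_iff (by linarith)]
    exact sum_rpow_le_rpow_sum _ _ h1

theorem ellENorm_add_le (hp : 1 ≤ p) (a b : Fin n → ℝ≥0∞) :
    ellENorm p (fun i => a i + b i) ≤ ellENorm p a + ellENorm p b := by
  unfold ellENorm
  split_ifs with h
  · exact iSup_le fun i => add_le_add (le_iSup a i) (le_iSup b i)
  · exact ENNReal.Lp_add_le _ _ _ (by simpa using ENNReal.toReal_mono h hp)

theorem ellENorm_fin_one (hp : 0 < p) (a : Fin 1 → ℝ≥0∞) : ellENorm p a = a 0 := by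
  refine le_antisymm ?_ (le_ellENorm hp a 0)
  unfold ellENorm
  split_ifs with h
  · exact iSup_le fun i => by rw [Fin.eq_zero i]
  · have := (ENNReal.toReal_pos hp.ne' h).ne'
    simp [← ENNReal.rpow_mul, mul_inv_cancel₀ this]

theorem measurable_ellENorm {Ω : Type*} [MeasurableSpace Ω] {F : Fin n → Ω → ℝ≥0∞}
    (hF : ∀ i, Measurable (F i)) : Measurable (fun ω => ellENorm p (fun i => F i ω)) := by
  unfold ellENorm
  split_ifs
  · exact Measurable.iSup hF
  · exact (Finset.measurable_fun_sum _ fun i _ => (hF i).pow_const _).pow_const _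

theorem enorm_ellNorm (hp : 0 < p) (a : Fin n → ℝ) :
    ‖ellNorm p a‖ₑ = ellENorm p (fun i => ‖a i‖ₑ) := by
  unfold ellNorm ellENorm
  split_ifs with h
  · rw [Real.enorm_eq_ofReal (Real.iSup_nonneg fun i => abs_nonneg _)]
    rcases isEmpty_or_nonempty (Fin n) with he | he
    · simp
    · simp_rw [Real.enorm_eq_ofReal_abs]
      obtain ⟨k, hk⟩ := Finite.exists_max fun i => |a i|
      rw [le_antisymm (ciSup_le hk) (le_ciSup (f := fun i => |a i|) (Finite.bddAbove_range _) k)]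
      exact le_antisymm (le_iSup (fun i => ENNReal.ofReal |a i|) k)
        (iSup_le fun i => ENNReal.ofReal_le_ofReal (hk i))
  · have := ENNReal.toReal_pos hp.ne' h
    have h1 : ∀ i, 0 ≤ |a i| ^ p.toReal := fun i => Real.rpow_nonneg (abs_nonneg _) _
    rw [Real.enorm_eq_ofReal (Real.rpow_nonneg (Finset.sum_nonneg fun i _ => h1 i) _),
      ← ENNReal.ofReal_rpow_of_nonneg (Finset.sum_nonneg fun i _ => h1 i) (one_div_pos.2 this).le,
      ENNReal.ofReal_sum_of_nonneg fun i _ => h1 i]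
    congr 1
    refine Finset.sum_congr rfl fun i _ => ?_
    rw [← ENNReal.ofReal_rpow_of_nonneg (abs_nonneg _) this.le, ← Real.enorm_eq_ofReal_abs]

theorem holderConjugate_cases (h : p.HolderConjugate p') :
    (p = 1 ∧ p' = ∞) ∨ (p = ∞ ∧ p' = 1) ∨
      (p ≠ ∞ ∧ p' ≠ ∞ ∧ p.toReal.HolderConjugate p'.toReal) := by
  have h0 : p⁻¹ + p'⁻¹ = 1 := by simpa using h.inv_add_inv_eq_inv
  by_cases hp : p = ∞
  · subst hp
    exact Or.inr (Or.inl ⟨rfl, by simpa using h0⟩)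
  by_cases hp' : p' = ∞
  · subst hp'
    exact Or.inl ⟨by simpa using h0, rfl⟩
  exact Or.inr (Or.inr ⟨hp, hp', ENNReal.HolderConjugate.toReal_of_ne_top hp hp'⟩)

theorem one_le_of_holderConjugate (h : p.HolderConjugate p') : 1 ≤ p := by
  have h0 : p⁻¹ + p'⁻¹ = 1 := by simpa using h.inv_add_inv_eq_inv
  rw [← ENNReal.inv_le_one]
  exact le_self_add.trans h0.le

/-- Hölder's inequality. -/
theorem sum_mul_le_ellENorm_mul (h : p.HolderConjugate p') (a b : Fin n → ℝ≥0∞) :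
    ∑ i, a i * b i ≤ ellENorm p a * ellENorm p' b := by
  rcases holderConjugate_cases h with ⟨rfl, rfl⟩ | ⟨rfl, rfl⟩ | ⟨hp, hp', h'⟩
  · rw [ellENorm_one, ellENorm_top, Finset.sum_mul]
    exact Finset.sum_le_sum fun i _ => mul_le_mul_right (le_iSup b i) _
  · rw [ellENorm_one, ellENorm_top, Finset.mul_sum]
    exact Finset.sum_le_sum fun i _ => mul_le_mul_left (le_iSup a i) _
  · rw [ellENorm_of_ne_top hp, ellENorm_of_ne_top hp']
    exact ENNReal.inner_le_Lp_mul_Lq _ _ _ h'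

/-- A measurable choice of norming functionals for `ℓ_p`. -/
theorem exists_measurable_norming (h : p.HolderConjugate p') (n : ℕ) :
    ∃ b : (Fin n → ℝ≥0∞) → Fin n → ℝ≥0∞, (∀ i, Measurable fun a => b a i) ∧
      (∀ a, ellENorm p' (b a) ≤ 1) ∧
      ∀ a, ellENorm p a ≠ ∞ → ∑ i, a i * b a i = ellENorm p a := by
  rcases holderConjugate_cases h with ⟨rfl, rfl⟩ | ⟨rfl, rfl⟩ | ⟨hp, hp', h'⟩
  · refine ⟨fun _ _ => 1, fun i => measurable_const, fun a => ?_, fun a _ => ?_⟩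
    · rw [ellENorm_top]
      exact iSup_le fun _ => le_rfl
    · simp [ellENorm_one]
  · classical
    -- `S i` consists of the vectors whose maximum is attained first at `i`. Taking the first index
    -- makes these sets disjoint and measurable, so their indicators norm `ℓ_∞`.
    let S : Fin n → Set (Fin n → ℝ≥0∞) := fun i =>
      {a | (∀ j, a j ≤ a i) ∧ ∀ j, j < i → a j < a i}
    have hS : ∀ i, MeasurableSet (S i) := by
      intro i
      have : S i = (⋂ j, {a | a j ≤ a i}) ∩ ⋂ j, ⋂ (_ : j < i), {a | a j < a i} := by
        ext a; simp [S]
      rw [this]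
      refine (MeasurableSet.iInter fun j =>
        measurableSet_le (measurable_pi_apply j) (measurable_pi_apply i)).inter ?_
      exact MeasurableSet.iInter fun j => MeasurableSet.iInter fun _ =>
        measurableSet_lt (measurable_pi_apply j) (measurable_pi_apply i)
    have huniq : ∀ a i j, a ∈ S i → a ∈ S j → i = j := by
      intro a i j hi hj
      rcases lt_trichotomy i j with hij | hij | hij
      · exact absurd (hj.2 i hij) (not_lt.2 (hi.1 j))
      · exact hij
      · exact absurd (hi.2 j hij) (not_lt.2 (hj.1 i))
    refine ⟨fun a i => (S i).indicator 1 a, fun i => measurable_one.indicator (hS i),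
      fun a => ?_, fun a _ => ?_⟩
    · rw [ellENorm_one]
      by_cases ha : ∃ i, a ∈ S i
      · obtain ⟨i, hi⟩ := ha
        rw [Finset.sum_eq_single i]
        · simp [hi]
        · intro j _ hj
          exact Set.indicator_of_notMem (fun hj' => hj (huniq a j i hj' hi)) _
        · simp
      · push Not at ha
        rw [Finset.sum_eq_zero fun i _ => Set.indicator_of_notMem (ha i) _]
        exact zero_le
    · rw [ellENorm_top]
      rcases isEmpty_or_nonempty (Fin n) with he | he
      · simp
      · obtain ⟨k, hk⟩ := Finite.exists_max a
        let P : Finset (Fin n) := Finset.univ.filter fun i => ∀ j, a j ≤ a i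
        have hP : P.Nonempty := ⟨k, by simpa [P] using hk⟩
        have hi := P.min'_mem hP
        set i := P.min' hP with hidef
        have hi' : ∀ j, a j ≤ a i := by simpa [P] using hi
        have hiS : a ∈ S i := by
          refine ⟨hi', fun j hj => lt_of_not_ge fun hle => ?_⟩
          have : j ∈ P := by
            simp only [P, Finset.mem_filter, Finset.mem_univ, true_and]
            exact fun l => (hi' l).trans hle
          exact absurd (P.min'_le j this) (not_le.2 hj)
        rw [Finset.sum_eq_single i]
        · simp only [Set.indicator_of_mem hiS, Pi.one_apply, mul_one]
          exact le_antisymm (le_iSup a i) (iSup_le hi')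
        · intro j _ hj
          beta_reduce
          rw [Set.indicator_of_notMem (fun hj' => hj (huniq a j i hj' hiS)), mul_zero]
        · simp
  · have hp0 : 0 < p := zero_lt_one.trans_le (one_le_of_holderConjugate h)
    set t := p.toReal with ht
    set t' := p'.toReal with ht'
    have htt : (t - 1) * t' = t := h'.sub_one_mul_conj
    -- The equality case of Hölder: `b_i = (a_i / ‖a‖)^(p-1)`, where `(p-1) p' = p`. The conventions
    -- for division by `0` and `∞` keep the bound `‖b‖ ≤ 1` valid for every `a`.
    refine ⟨fun a i => (a i / ellENorm p a) ^ (t - 1), fun i => ?_, fun a => ?_, fun a ha => ?_⟩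
    · exact ((measurable_pi_apply i).div
        (measurable_ellENorm fun i => measurable_pi_apply i)).pow_const _
    · rw [ellENorm_of_ne_top hp']
      refine ENNReal.rpow_le_one ?_ (one_div_pos.2 h'.symm.pos).le
      rw [← ht']
      simp_rw [← ENNReal.rpow_mul, htt]
      simp_rw [ENNReal.div_rpow_of_nonneg _ _ h'.nonneg, div_eq_mul_inv]
      rw [← Finset.sum_mul, ← ellENorm_rpow hp0 hp]
      exact ENNReal.mul_inv_le_one _
    · set s := ellENorm p a with hs
      rcases eq_or_ne s 0 with h0 | h0
      · have : ∀ i, a i = 0 := fun i => le_antisymm ((le_ellENorm hp0 a i).trans h0.le) zero_le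
        simp [this, h0]
      · have h1 : ∀ i, a i * (a i / s) ^ (t - 1) = s * (a i / s) ^ t := by
          intro i
          have hdiv : s * (a i / s) = a i := ENNReal.mul_div_cancel h0 ha
          nth_rewrite 1 [← hdiv]
          rw [mul_assoc]
          congr 1
          have := ENNReal.rpow_add_of_nonneg (x := a i / s) 1 (t - 1) zero_le_one
            h'.sub_one_pos.le
          rw [ENNReal.rpow_one] at this
          rw [← this]
          congr 1
          ring
        change ∑ i, a i * (a i / s) ^ (t - 1) = s
        simp_rw [h1]
        rw [← Finset.mul_sum]
        simp_rw [ENNReal.div_rpow_of_nonneg _ _ h'.nonneg, div_eq_mul_inv]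
        rw [← Finset.sum_mul, ← ellENorm_rpow hp0 hp, ENNReal.mul_inv_cancel, mul_one]
        · rw [← ht, ← hs]; simp [h0, ha]
        · rw [← ht, ← hs]; exact ENNReal.rpow_ne_top_of_nonneg h'.nonneg ha

end ellENorm

end RegularOperators

/-! ### Gauges: one framework for a function norm, its Köthe dual, its powers and direct sums. -/

namespace RegularOperators

/-- A monotone, homogeneous functional on `[0, ∞]`-valued functions that is finite only at
functions which are finite almost everywhere. -/
structure FunctionGauge {Ω : Type*} [MeasurableSpace Ω] (μ : Measure Ω) where
  toFun : (Ω → ℝ≥0∞) → ℝ≥0∞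
  mono : ∀ {f g}, f ≤ᵐ[μ] g → toFun f ≤ toFun g
  smul_le : ∀ (c : ℝ≥0) f, toFun (fun ω => c * f ω) ≤ c * toFun f
  ae_lt_top : ∀ {f}, Measurable f → toFun f ≠ ∞ → ∀ᵐ ω ∂μ, f ω < ∞

instance {Ω : Type*} [MeasurableSpace Ω] (μ : Measure Ω) :
    CoeFun (FunctionGauge μ) fun _ => (Ω → ℝ≥0∞) → ℝ≥0∞ := ⟨FunctionGauge.toFun⟩

variable {Ω : Type*} [MeasurableSpace Ω] {μ : Measure Ω}

namespace FunctionGauge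

/-- Subadditivity up to a constant, for finite families. -/
def IsSubadditive (γ : FunctionGauge μ) (M : ℝ≥0) : Prop :=
  ∀ (n : ℕ) (F : Fin n → Ω → ℝ≥0∞), (∀ i, Measurable (F i)) →
    γ (fun ω => ∑ i, F i ω) ≤ M * ∑ i, γ (F i)

/-- Sequential order continuity. -/
def IsOrderContinuous (γ : FunctionGauge μ) : Prop :=
  ∀ f : ℕ → Ω → ℝ≥0∞, (∀ n, Measurable (f n)) → Antitone f →
    (∀ᵐ ω ∂μ, ⨅ n, f n ω = 0) → γ (f 0) ≠ ∞ → ⨅ n, γ (f n) = 0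

/-- The space is exhausted by an increasing sequence of sets with finite gauge. -/
def Exhausts (γ : FunctionGauge μ) : Prop :=
  ∃ B : ℕ → Set Ω, (∀ n, MeasurableSet (B n)) ∧ Monotone B ∧ (∀ᵐ ω ∂μ, ∃ n, ω ∈ B n) ∧
    ∀ n, γ ((B n).indicator 1) ≠ ∞

variable (γ : FunctionGauge μ)

theorem mono_of_le {f g : Ω → ℝ≥0∞} (h : ∀ ω, f ω ≤ g ω) : γ f ≤ γ g :=
  γ.mono (Eventually.of_forall h)

theorem congr_ae {f g : Ω → ℝ≥0∞} (h : f =ᵐ[μ] g) : γ f = γ g :=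
  le_antisymm (γ.mono h.le) (γ.mono h.symm.le)

theorem zero : γ (fun _ => 0) = 0 := by
  simpa using γ.smul_le 0 fun _ => 0

theorem const_mul_le (c : ℝ≥0∞) (hc : c ≠ ∞) (f : Ω → ℝ≥0∞) : γ (fun ω => c * f ω) ≤ c * γ f := by
  lift c to ℝ≥0 using hc
  exact γ.smul_le c f

theorem const_mul_ne_top {c : ℝ≥0∞} (hc : c ≠ ∞) {f : Ω → ℝ≥0∞} (hf : γ f ≠ ∞) :
    γ (fun ω => c * f ω) ≠ ∞ :=
  ne_top_of_le_ne_top (ENNReal.mul_ne_top hc hf) (γ.const_mul_le c hc f)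

theorem IsSubadditive.add_le {γ : FunctionGauge μ} {M : ℝ≥0} (h : γ.IsSubadditive M)
    {f g : Ω → ℝ≥0∞} (hf : Measurable f) (hg : Measurable g) :
    γ (fun ω => f ω + g ω) ≤ M * (γ f + γ g) := by
  have := h 2 ![f, g] (by intro i; fin_cases i <;> assumption)
  simpa using this

end FunctionGauge

/-- The real function class attached to a `[0, ∞]`-valued function. -/
noncomputable def ofENN (μ : Measure Ω) (F : Ω → ℝ≥0∞) (hF : Measurable F) : Ω →ₘ[μ] ℝ :=
  AEEqFun.mk (fun ω => (F ω).toReal) hF.ennreal_toReal.aestronglyMeasurable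

theorem coeFn_ofENN {F : Ω → ℝ≥0∞} (hF : Measurable F) :
    ofENN μ F hF =ᵐ[μ] fun ω => (F ω).toReal := AEEqFun.coeFn_mk _ _

theorem enorm_ofENN {F : Ω → ℝ≥0∞} (hF : Measurable F) (h : ∀ᵐ ω ∂μ, F ω < ∞) :
    (fun ω => ‖ofENN μ F hF ω‖ₑ) =ᵐ[μ] F := by
  filter_upwards [coeFn_ofENN (μ := μ) hF, h] with ω h1 h2
  rw [h1, Real.enorm_eq_ofReal ENNReal.toReal_nonneg, ENNReal.ofReal_toReal h2.ne]

theorem measurable_enorm_coeFn (x : Ω →ₘ[μ] ℝ) : Measurable fun ω => ‖x ω‖ₑ :=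
  x.stronglyMeasurable.measurable.enorm

theorem abs_le_abs_of_enorm_le {f g : Ω →ₘ[μ] ℝ} (h : ∀ᵐ ω ∂μ, ‖f ω‖ₑ ≤ ‖g ω‖ₑ) : |f| ≤ |g| := by
  rw [← AEEqFun.coeFn_le]
  filter_upwards [h, AEEqFun.coeFn_abs f, AEEqFun.coeFn_abs g] with ω h1 h2 h3
  rw [h2, h3]
  rwa [enorm_le_iff_norm_le] at h1

/-- Maximise an equivalent finite measure over the sets with `P`. The accumulated unions of a
maximising sequence cover almost everything, since otherwise saturation would supply one more set
with `P`, disjoint from them and of positive measure, and push the mass beyond the supremum. -/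
theorem exists_exhaustion [SigmaFinite μ] (P : Set Ω → Prop) (h_empty : P ∅)
    (h_union : ∀ A B, P A → P B → P (A ∪ B))
    (h_sat : ∀ A, MeasurableSet A → μ A ≠ 0 → ∃ B ⊆ A, MeasurableSet B ∧ μ B ≠ 0 ∧ P B) :
    ∃ B : ℕ → Set Ω, (∀ n, MeasurableSet (B n)) ∧ Monotone B ∧ (∀ᵐ ω ∂μ, ∃ n, ω ∈ B n) ∧
      ∀ n, P (B n) := by
  set ν := μ.toFinite
  let S : Set ℝ≥0∞ := {t | ∃ B, MeasurableSet B ∧ P B ∧ ν B = t}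
  have hS : S.Nonempty := ⟨_, ∅, MeasurableSet.empty, h_empty, rfl⟩
  obtain ⟨u, -, hu, huS⟩ := exists_seq_tendsto_sSup hS (OrderTop.bddAbove S)
  choose C hCm hCP hCν using huS
  have hP : ∀ n, P (Set.accumulate C n) := by
    intro n
    induction n with
    | zero => simpa [Set.accumulate_zero_nat] using hCP 0
    | succ n ih => rw [Set.accumulate_succ]; exact h_union _ _ ih (hCP _)
  have hm : ∀ n, MeasurableSet (Set.accumulate C n) := fun n =>
    MeasurableSet.biUnion (Set.to_countable _) fun k _ => hCm k
  refine ⟨Set.accumulate C, hm, Set.monotone_accumulate, ?_, hP⟩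
  by_contra hne
  have hA : MeasurableSet (⋃ n, Set.accumulate C n)ᶜ := (MeasurableSet.iUnion hm).compl
  have hμA : μ (⋃ n, Set.accumulate C n)ᶜ ≠ 0 := by
    intro h0
    apply hne
    rw [ae_iff]
    convert h0 using 2
    ext ω
    simp only [Set.mem_compl_iff, Set.mem_iUnion, Set.mem_ofPred_eq]
  obtain ⟨B, hBA, hBm, hB0, hBP⟩ := h_sat _ hA hμA
  have hνB : ν B ≠ 0 := fun h => hB0 (absolutelyContinuous_toFinite μ h)
  have hle : ∀ n, u n + ν B ≤ sSup S := by
    intro n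
    have hd : Disjoint (Set.accumulate C n) B := by
      rw [Set.disjoint_left]
      exact fun ω h1 h2 => hBA h2 (Set.mem_iUnion.2 ⟨n, h1⟩)
    calc u n + ν B ≤ ν (Set.accumulate C n) + ν B := by
          rw [← hCν n]
          gcongr
          exact Set.subset_accumulate
      _ = ν (Set.accumulate C n ∪ B) := (measure_union hd hBm).symm
      _ ≤ sSup S := le_sSup ⟨_, (hm n).union hBm, h_union _ _ (hP n) hBP, rfl⟩
  have hlim := le_of_tendsto' (hu.add_const (ν B)) hle
  have hfin : sSup S ≠ ∞ := by
    refine ne_top_of_le_ne_top (measure_ne_top ν Set.univ) (sSup_le ?_)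
    rintro _ ⟨B, -, -, rfl⟩
    exact measure_mono (Set.subset_univ _)
  exact (ENNReal.lt_add_right hfin hνB).not_ge hlim

/-! ### The gauge of a Banach function space. -/

namespace BanachFunctionSpace

variable (X : BanachFunctionSpace μ)

theorem norm_le_of_enorm_le {f g : Ω →ₘ[μ] ℝ} (h : ∀ᵐ ω ∂μ, ‖f ω‖ₑ ≤ ‖g ω‖ₑ) :
    X.norm f ≤ X.norm g := X.norm_mono _ _ (abs_le_abs_of_enorm_le h)

/-- The norm of a Banach function space, as a functional on `[0, ∞]`-valued functions. -/
noncomputable def gauge : FunctionGauge μ where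
  -- An infimum over majorants makes sense for every `[0, ∞]`-valued function, and is `∞` when `F`
  -- has no majorant in the space.
  toFun F := ⨅ (x : Ω →ₘ[μ] ℝ) (_ : F ≤ᵐ[μ] fun ω => ‖x ω‖ₑ), X.norm x
  mono {f g} h := le_iInf₂ fun x hx => iInf₂_le x (h.trans hx)
  smul_le c f := by
    rcases eq_or_ne c 0 with rfl | hc
    · refine (iInf₂_le 0 ?_).trans (X.norm_zero.trans_le zero_le)
      exact Eventually.of_forall fun ω => by simp
    · have hc' : (c : ℝ≥0∞) ≠ 0 := by simpa using hc
      simp_rw [ENNReal.mul_iInf_of_ne hc' ENNReal.coe_ne_top]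
      refine le_iInf₂ fun x hx => (iInf₂_le ((c : ℝ) • x) ?_).trans ?_
      · filter_upwards [hx, AEEqFun.coeFn_smul (c : ℝ) x] with ω h1 h2
        rw [h2, Pi.smul_apply, enorm_smul]
        simpa using mul_le_mul_right h1 _
      · rw [X.norm_smul]
        simp
  ae_lt_top {f} hf h := by
    rw [← lt_top_iff_ne_top] at h
    simp only [iInf_lt_iff] at h
    obtain ⟨x, hx, -⟩ := h
    filter_upwards [hx] with ω h1
    exact h1.trans_lt enorm_lt_top

theorem gauge_le {F : Ω → ℝ≥0∞} {x : Ω →ₘ[μ] ℝ} (h : F ≤ᵐ[μ] fun ω => ‖x ω‖ₑ) :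
    X.gauge F ≤ X.norm x := iInf₂_le x h

theorem gauge_enorm (x : Ω →ₘ[μ] ℝ) : X.gauge (fun ω => ‖x ω‖ₑ) = X.norm x :=
  le_antisymm (X.gauge_le (EventuallyLE.refl _ _))
    (le_iInf₂ fun _ hy => X.norm_le_of_enorm_le hy)

theorem gauge_eq_norm {F : Ω → ℝ≥0∞} {x : Ω →ₘ[μ] ℝ} (h : (fun ω => ‖x ω‖ₑ) =ᵐ[μ] F) :
    X.gauge F = X.norm x := by rw [← X.gauge_enorm, X.gauge.congr_ae h]

theorem norm_ofENN {F : Ω → ℝ≥0∞} (hF : Measurable F) (h : X.gauge F ≠ ∞) :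
    X.norm (ofENN μ F hF) = X.gauge F :=
  (X.gauge_eq_norm (enorm_ofENN hF (X.gauge.ae_lt_top hF h))).symm

theorem gauge_add_le (F G : Ω → ℝ≥0∞) : X.gauge (fun ω => F ω + G ω) ≤ X.gauge F + X.gauge G := by
  change _ ≤ (⨅ (x : Ω →ₘ[μ] ℝ) (_ : F ≤ᵐ[μ] fun ω => ‖x ω‖ₑ), X.norm x) +
    (⨅ (x : Ω →ₘ[μ] ℝ) (_ : G ≤ᵐ[μ] fun ω => ‖x ω‖ₑ), X.norm x)
  simp_rw [ENNReal.iInf_add, ENNReal.add_iInf]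
  refine le_iInf₂ fun x hx => le_iInf₂ fun y hy => ?_
  have habs : ∀ z : Ω →ₘ[μ] ℝ, X.norm |z| = X.norm z := fun z =>
    (X.gauge_eq_norm (by
      filter_upwards [AEEqFun.coeFn_abs z] with ω h
      rw [h, Real.enorm_abs])).symm.trans (X.gauge_enorm z)
  rw [← habs x, ← habs y]
  refine (X.gauge_le ?_).trans (X.norm_add_le _ _)
  filter_upwards [hx, hy, AEEqFun.coeFn_add |x| |y|, AEEqFun.coeFn_abs x, AEEqFun.coeFn_abs y]
    with ω h1 h2 h3 h4 h5
  rw [h3, Pi.add_apply, h4, h5, Real.enorm_eq_ofReal (by positivity),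
    ENNReal.ofReal_add (abs_nonneg _) (abs_nonneg _), ← Real.enorm_eq_ofReal_abs,
    ← Real.enorm_eq_ofReal_abs]
  exact add_le_add h1 h2

theorem gauge_sum_le {ι : Type*} (s : Finset ι) (F : ι → Ω → ℝ≥0∞) :
    X.gauge (fun ω => ∑ i ∈ s, F i ω) ≤ ∑ i ∈ s, X.gauge (F i) := by
  classical
  induction s using Finset.induction_on with
  | empty => simpa using X.gauge.zero.le
  | insert i s hi ih =>
    simp_rw [Finset.sum_insert hi]
    exact (X.gauge_add_le _ _).trans (add_le_add le_rfl ih)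

theorem isSubadditive_gauge : X.gauge.IsSubadditive 1 := fun n F _ => by
  simpa using X.gauge_sum_le Finset.univ F

theorem ae_eq_zero_of_gauge {F : Ω → ℝ≥0∞} (hF : Measurable F) (h : X.gauge F = 0) :
    F =ᵐ[μ] 0 := by
  have hn : X.gauge F ≠ ∞ := by simp [h]
  have h0 := X.eq_zero_of_norm _ ((X.norm_ofENN hF hn).trans h)
  filter_upwards [enorm_ofENN hF (X.gauge.ae_lt_top hF hn),
    (AEEqFun.coeFn_zero : ((0 : Ω →ₘ[μ] ℝ) : Ω → ℝ) =ᵐ[μ] 0)] with ω h1 h2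
  rw [← h1, h0, h2]
  simp

/-- This is where completeness enters (Riesz–Fischer). If the right side is finite, the partial sums
are Cauchy; their norm limit dominates each of them almost everywhere, hence dominates the whole
sum, and its norm is at most the sum of the gauges. -/
theorem gauge_tsum_le (F : ℕ → Ω → ℝ≥0∞) (hF : ∀ n, Measurable (F n)) :
    X.gauge (fun ω => ∑' n, F n ω) ≤ ∑' n, X.gauge (F n) := by
  by_cases htop : ∑' n, X.gauge (F n) = ∞
  · rw [htop]; exact le_top
  let G : ℕ → Ω → ℝ≥0∞ := fun n ω => ∑ k ∈ Finset.range n, F k ω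
  have hG : ∀ n, Measurable (G n) := fun n => Finset.measurable_fun_sum _ fun k _ => hF k
  have hGle : ∀ n, X.gauge (G n) ≤ ∑' n, X.gauge (F n) := fun n =>
    (X.gauge_sum_le _ _).trans (ENNReal.sum_le_tsum _)
  have hGfin : ∀ n, X.gauge (G n) ≠ ∞ := fun n => ne_top_of_le_ne_top htop (hGle n)
  have hGae : ∀ᵐ ω ∂μ, ∀ n, G n ω < ∞ := ae_all_iff.2 fun n => X.gauge.ae_lt_top (hG n) (hGfin n)
  let s : ℕ → Ω →ₘ[μ] ℝ := fun n => ofENN μ (G n) (hG n)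
  have hsae : ∀ᵐ ω ∂μ, ∀ n, s n ω = (G n ω).toReal := ae_all_iff.2 fun n => coeFn_ofENN (hG n)
  have hcauchy : ∀ n k, X.norm (s (n + k) - s n) ≤ ∑' j, X.gauge (F (j + n)) := by
    intro n k
    have : (fun ω => ‖(s (n + k) - s n) ω‖ₑ) =ᵐ[μ]
        fun ω => ∑ j ∈ Finset.range k, F (j + n) ω := by
      filter_upwards [hGae, hsae, AEEqFun.coeFn_sub (s (n + k)) (s n)] with ω h1 h2 h3
      have hadd : G (n + k) ω = G n ω + ∑ j ∈ Finset.range k, F (j + n) ω := by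
        simp only [G, Finset.sum_range_add]
        congr 1
        exact Finset.sum_congr rfl fun j _ => by rw [add_comm]
      have hfin : ∑ j ∈ Finset.range k, F (j + n) ω ≠ ∞ :=
        ne_top_of_le_ne_top (h1 (n + k)).ne (hadd ▸ le_add_self)
      rw [h3, Pi.sub_apply, h2, h2, hadd, ENNReal.toReal_add (h1 n).ne hfin, add_sub_cancel_left,
        Real.enorm_eq_ofReal ENNReal.toReal_nonneg, ENNReal.ofReal_toReal hfin]
    rw [← X.gauge_enorm, X.gauge.congr_ae this]
    exact (X.gauge_sum_le _ _).trans
      (ENNReal.sum_le_tsum (f := fun j => X.gauge (F (j + n))) _)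
  have hsymm : ∀ x y : Ω →ₘ[μ] ℝ, X.norm (x - y) = X.norm (y - x) := by
    intro x y
    have h := X.norm_smul (-1) (y - x)
    simpa using h
  obtain ⟨g, -, hglim⟩ := X.complete s
    (fun n => by rw [X.norm_ofENN (hG n) (hGfin n)]; exact (hGfin n).lt_top) (by
      intro ε hε
      have ht := ENNReal.tendsto_sum_nat_add (fun j => X.gauge (F j)) htop
      obtain ⟨N, hN⟩ := (ht.eventually (ge_mem_nhds hε)).exists_forall_of_atTop
      have key : ∀ m ≥ N, ∀ n ≥ m, X.norm (s n - s m) ≤ ε := by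
        intro m hm n hn
        obtain ⟨k, rfl⟩ := Nat.exists_eq_add_of_le hn
        exact (hcauchy m k).trans (hN m hm)
      refine ⟨N, fun m hm n hn => ?_⟩
      rcases le_total m n with h | h
      · rw [hsymm]; exact key m hm n h
      · exact key n hn m h)
  have hle : ∀ᵐ ω ∂μ, ∀ n, s n ω ≤ g ω := by
    refine ae_all_iff.2 fun n => ?_
    have hZm : Measurable fun ω => ENNReal.ofReal (s n ω - g ω) :=
      ((s n).stronglyMeasurable.measurable.sub g.stronglyMeasurable.measurable).ennreal_ofReal
    -- The positive part of `s n - g` lies below `|s m - g|` for every `m ≥ n`, and the norms of the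
    -- latter tend to zero.
    have hZ : X.gauge (fun ω => ENNReal.ofReal (s n ω - g ω)) = 0 := by
      refine le_antisymm (ge_of_tendsto hglim ?_) zero_le
      filter_upwards [eventually_ge_atTop n] with m hm
      refine X.gauge_le ?_
      filter_upwards [hGae, hsae, AEEqFun.coeFn_sub (s m) g] with ω h1 h2 h3
      rw [h3, Pi.sub_apply, Real.enorm_eq_ofReal_abs]
      refine ENNReal.ofReal_le_ofReal ((sub_le_sub_right ?_ _).trans (le_abs_self _))
      rw [h2, h2]
      exact ENNReal.toReal_mono (h1 m).ne
        (Finset.sum_le_sum_of_subset (Finset.range_mono hm))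
    filter_upwards [X.ae_eq_zero_of_gauge hZm hZ] with ω h
    simpa using h
  have hsum : (fun ω => ∑' n, F n ω) ≤ᵐ[μ] fun ω => ‖g ω‖ₑ := by
    filter_upwards [hle, hGae, hsae] with ω h1 h2 h3
    rw [ENNReal.tsum_eq_iSup_nat]
    refine iSup_le fun n => ?_
    change G n ω ≤ _
    rw [← ENNReal.ofReal_toReal (h2 n).ne, ← h3 n, Real.enorm_eq_ofReal_abs]
    exact ENNReal.ofReal_le_ofReal ((h1 n).trans (le_abs_self _))
  refine (X.gauge_le hsum).trans ?_
  have hlim2 : Tendsto (fun n => X.norm (s n - g) + ∑' n, X.gauge (F n)) atTop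
      (𝓝 (0 + ∑' n, X.gauge (F n))) := hglim.add_const _
  rw [zero_add] at hlim2
  refine ge_of_tendsto' hlim2 fun n => ?_
  calc X.norm g = X.norm ((g - s n) + s n) := by rw [sub_add_cancel]
    _ ≤ X.norm (g - s n) + X.norm (s n) := X.norm_add_le _ _
    _ ≤ _ := by
      rw [hsymm, X.norm_ofENN (hG n) (hGfin n)]
      exact add_le_add le_rfl (hGle n)

theorem gauge_indicator {B : Set Ω} (hB : MeasurableSet B) :
    X.gauge (B.indicator 1) = X.norm (chi μ B hB) := by
  refine X.gauge_eq_norm ?_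
  filter_upwards [AEEqFun.coeFn_mk (μ := μ) (B.indicator fun _ => (1 : ℝ))
    (stronglyMeasurable_const.indicator hB).aestronglyMeasurable] with ω h
  rw [chi, h]
  by_cases hω : ω ∈ B <;> simp [hω]

theorem exhausts_gauge [SigmaFinite μ] : X.gauge.Exhausts := by
  refine exists_exhaustion (fun B => X.gauge (B.indicator 1) ≠ ∞) ?_ ?_ ?_
  · rw [Set.indicator_empty, X.gauge.zero]
    exact ENNReal.zero_ne_top
  · intro A B hA hB
    refine ne_top_of_le_ne_top (ENNReal.add_ne_top.2 ⟨hA, hB⟩)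
      ((X.gauge.mono_of_le fun ω => ?_).trans (X.gauge_add_le _ _))
    by_cases h1 : ω ∈ A <;> by_cases h2 : ω ∈ B <;> simp [h1, h2]
  · intro A hA h
    obtain ⟨B, hB, hBA, h0, hfin⟩ := X.saturated A hA h
    exact ⟨B, hBA, hB, h0, by rw [X.gauge_indicator hB]; exact hfin.ne⟩

end BanachFunctionSpace

/-- Only decreasing sequences are needed later, and their ranges are downward directed. Allowing any
`ρ` lets the same argument serve the norm of `X` and the Köthe dual norm of `Y`. -/
theorem isOrderContinuous_of_orderContinuous {ρ : (Ω →ₘ[μ] ℝ) → ℝ≥0∞} (hρ : OrderContinuous ρ)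
    (γ : FunctionGauge μ) (h : ∀ x : Ω →ₘ[μ] ℝ, γ (fun ω => ‖x ω‖ₑ) = ρ x) :
    γ.IsOrderContinuous := by
  intro f hf hanti hinf h0
  have hfin : ∀ n, γ (f n) ≠ ∞ := fun n =>
    ne_top_of_le_ne_top h0 (γ.mono_of_le (hanti (Nat.zero_le n)))
  have hae : ∀ᵐ ω ∂μ, ∀ n, f n ω < ∞ := ae_all_iff.2 fun n => γ.ae_lt_top (hf n) (hfin n)
  let x : ℕ → Ω →ₘ[μ] ℝ := fun n => ofENN μ (f n) (hf n)
  have hx : ∀ n, ρ (x n) = γ (f n) := fun n => by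
    rw [← h, γ.congr_ae (enorm_ofENN (hf n) (γ.ae_lt_top (hf n) (hfin n)))]
  have hxae : ∀ᵐ ω ∂μ, ∀ n, x n ω = (f n ω).toReal := ae_all_iff.2 fun n => coeFn_ofENN (hf n)
  have hxanti : Antitone x := by
    intro m n hmn
    rw [← AEEqFun.coeFn_le]
    filter_upwards [hae, hxae] with ω h1 h2
    rw [h2, h2]
    exact ENNReal.toReal_mono (h1 m).ne (hanti hmn ω)
  have := hρ (Set.range x) (Set.range_nonempty x) hxanti.directed_ge.directedOn_range
    (by rintro _ ⟨n, rfl⟩; rw [hx]; exact (hfin n).lt_top) (by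
      constructor
      · rintro _ ⟨n, rfl⟩
        rw [← AEEqFun.coeFn_le]
        filter_upwards [hxae, (AEEqFun.coeFn_zero : ((0 : Ω →ₘ[μ] ℝ) : Ω → ℝ) =ᵐ[μ] 0)]
          with ω h2 h3
        rw [h2, h3]
        exact ENNReal.toReal_nonneg
      · intro g hg
        have hg' : ∀ᵐ ω ∂μ, ∀ n, g ω ≤ x n ω := ae_all_iff.2 fun n =>
          AEEqFun.coeFn_le.2 (hg ⟨n, rfl⟩)
        rw [← AEEqFun.coeFn_le]
        filter_upwards [hg', hxae, hae, hinf,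
          (AEEqFun.coeFn_zero : ((0 : Ω →ₘ[μ] ℝ) : Ω → ℝ) =ᵐ[μ] 0)] with ω h1 h2 h3 h4 h5
        rw [h5]
        have : ENNReal.ofReal (g ω) ≤ ⨅ n, f n ω := le_iInf fun n => by
          rw [← ENNReal.ofReal_toReal (h3 n).ne, ← h2]
          exact ENNReal.ofReal_le_ofReal (h1 n)
        rw [h4] at this
        simpa using this)
  rw [iInf_range] at this
  simpa [hx] using this

/-! ### The Köthe dual of a gauge. -/

namespace FunctionGauge

/-- The associate (Köthe dual) gauge. -/
noncomputable def dual (γ : FunctionGauge μ) (hγ : γ.Exhausts) : FunctionGauge μ where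
  toFun G := ⨆ (F : Ω → ℝ≥0∞) (_ : Measurable F ∧ γ F ≤ 1), ∫⁻ ω, F ω * G ω ∂μ
  mono {f g} h := iSup₂_mono fun F hF => lintegral_mono_ae (by
    filter_upwards [h] with ω hω
    exact mul_le_mul_right hω _)
  smul_le c f := iSup₂_le fun F hF => by
    have : ∀ ω, F ω * (c * f ω) = c * (F ω * f ω) := fun ω => by ring
    simp_rw [this]
    rw [lintegral_const_mul' _ _ ENNReal.coe_ne_top]
    exact mul_le_mul_right (le_iSup₂ (f := fun (F : Ω → ℝ≥0∞) (_ : Measurable F ∧ γ F ≤ 1) =>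
      ∫⁻ ω, F ω * f ω ∂μ) F hF) _
  ae_lt_top {f} hf h := by
    obtain ⟨B, hBm, -, hBae, hBfin⟩ := hγ
    have key : ∀ n, ∀ᵐ ω ∂μ, ω ∈ B n → f ω < ∞ := by
      intro n
      -- A positive multiple of the indicator of `B n` lies in the unit ball, so testing against it
      -- makes `f` integrable on `B n`. Adding `1` before inverting avoids division by zero.
      obtain ⟨c, hc0, hc⟩ : ∃ c : ℝ≥0, c ≠ 0 ∧ γ (fun ω => c * (B n).indicator 1 ω) ≤ 1 := by
        refine ⟨((γ ((B n).indicator 1) + 1)⁻¹).toNNReal, ?_, (γ.smul_le _ _).trans ?_⟩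
        · rw [ENNReal.toNNReal_ne_zero]
          simp [hBfin n]
        · rw [ENNReal.coe_toNNReal (by simp)]
          calc _ ≤ (γ ((B n).indicator 1) + 1)⁻¹ * (γ ((B n).indicator 1) + 1) := by
                gcongr; exact le_self_add
            _ ≤ 1 := ENNReal.inv_mul_le_one _
      have hm : Measurable fun ω => (c : ℝ≥0∞) * (B n).indicator 1 ω :=
        (measurable_one.indicator (hBm n)).const_mul _
      have hint := ne_top_of_le_ne_top h (le_iSup₂ (f := fun (F : Ω → ℝ≥0∞)
        (_ : Measurable F ∧ γ F ≤ 1) => ∫⁻ ω, F ω * f ω ∂μ) _ ⟨hm, hc⟩)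
      filter_upwards [MeasureTheory.ae_lt_top (hm.mul hf) hint] with ω h1 h2
      simp only [Pi.mul_apply, h2, Set.indicator_of_mem, Pi.one_apply, mul_one] at h1
      by_contra h3
      rw [not_lt, top_le_iff] at h3
      rw [h3, ENNReal.mul_top (by simpa using hc0)] at h1
      exact lt_irrefl _ h1
    filter_upwards [ae_all_iff.2 key, hBae] with ω h1 ⟨n, hn⟩
    exact h1 n hn

variable (γ : FunctionGauge μ) (hγ : γ.Exhausts)

theorem lintegral_le_dual {F G : Ω → ℝ≥0∞} (hF : Measurable F) (h : γ F ≤ 1) :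
    ∫⁻ ω, F ω * G ω ∂μ ≤ γ.dual hγ G :=
  le_iSup₂ (f := fun (F : Ω → ℝ≥0∞) (_ : Measurable F ∧ γ F ≤ 1) =>
    ∫⁻ ω, F ω * G ω ∂μ) F ⟨hF, h⟩

/-- Hölder's inequality for a gauge and its associate. -/
theorem lintegral_mul_le {F G : Ω → ℝ≥0∞} (hF : Measurable F) (hγF : γ F ≠ ∞)
    (hG : γ.dual hγ G ≠ ∞) : ∫⁻ ω, F ω * G ω ∂μ ≤ γ F * γ.dual hγ G := by
  -- Normalising `F` by `γ F + ε` covers the case `γ F = 0`; finiteness of the dual gauge of `G`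
  -- then permits `ε → 0`.
  have key : ∀ ε : ℝ≥0, 0 < ε → ∫⁻ ω, F ω * G ω ∂μ ≤ (γ F + ε) * γ.dual hγ G := by
    intro ε hε
    set a := γ F + ε with ha
    have ha0 : a ≠ 0 := by simp [ha, hε.ne']
    have hat : a ≠ ∞ := by simp [ha, hγF]
    have h1 : γ (fun ω => a⁻¹ * F ω) ≤ 1 := by
      refine (γ.const_mul_le _ (ENNReal.inv_ne_top.2 ha0) F).trans ?_
      calc a⁻¹ * γ F ≤ a⁻¹ * a := by gcongr; exact le_self_add
        _ ≤ 1 := ENNReal.inv_mul_le_one _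
    have h2 := γ.lintegral_le_dual hγ (G := G) (hF.const_mul a⁻¹) h1
    simp_rw [mul_assoc] at h2
    rw [lintegral_const_mul' _ _ (ENNReal.inv_ne_top.2 ha0)] at h2
    calc ∫⁻ ω, F ω * G ω ∂μ = a * (a⁻¹ * ∫⁻ ω, F ω * G ω ∂μ) := by
          rw [← mul_assoc, ENNReal.mul_inv_cancel ha0 hat, one_mul]
      _ ≤ a * γ.dual hγ G := by gcongr
  have hlim : Tendsto (fun ε : ℝ≥0 => (γ F + ε) * γ.dual hγ G) (𝓝[>] 0)
      (𝓝 ((γ F + (0 : ℝ≥0)) * γ.dual hγ G)) := by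
    refine ENNReal.Tendsto.mul_const ?_ (Or.inr hG)
    refine Tendsto.const_add _ ?_
    exact (ENNReal.continuous_coe.tendsto 0).mono_left nhdsWithin_le_nhds
  simp only [ENNReal.coe_zero, add_zero] at hlim
  refine ge_of_tendsto hlim ?_
  filter_upwards [self_mem_nhdsWithin] with ε hε using key ε hε

theorem isSubadditive_dual : (γ.dual hγ).IsSubadditive 1 := by
  intro n G hG
  rw [ENNReal.coe_one, one_mul]
  refine iSup₂_le fun F hF => ?_
  simp_rw [Finset.mul_sum]
  rw [lintegral_finsetSum (f := fun i ω => F ω * G i ω) _ fun i _ => hF.1.mul (hG i)]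
  exact Finset.sum_le_sum fun i _ => γ.lintegral_le_dual hγ hF.1 hF.2

end FunctionGauge

theorem BanachFunctionSpace.dual_gauge_enorm (Y : BanachFunctionSpace μ) (hY : Y.gauge.Exhausts)
    (y : Ω →ₘ[μ] ℝ) : Y.gauge.dual hY (fun ω => ‖y ω‖ₑ) = Y.dualNorm y := by
  refine le_antisymm (iSup₂_le fun F hF => ?_) (iSup₂_le fun x hx => ?_)
  · have hfin : Y.gauge F ≠ ∞ := ne_top_of_le_ne_top ENNReal.one_ne_top hF.2
    refine le_trans (le_of_eq ?_) (le_iSup₂ (f := fun (x : Ω →ₘ[μ] ℝ) (_ : Y.norm x ≤ 1) =>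
      ∫⁻ ω, ‖x ω * y ω‖ₑ ∂μ) (ofENN μ F hF.1) ((Y.norm_ofENN hF.1 hfin).trans_le hF.2))
    refine lintegral_congr_ae ?_
    filter_upwards [enorm_ofENN hF.1 (Y.gauge.ae_lt_top hF.1 hfin)] with ω h1
    rw [enorm_mul, h1]
  · simp_rw [enorm_mul]
    exact Y.gauge.lintegral_le_dual hY (measurable_enorm_coeFn x) ((Y.gauge_enorm x).trans_le hx)

end RegularOperators

/-! ### Hahn–Banach, and the representation of positive functionals by densities. -/

namespace RegularOperators

/-- A linear functional dominated by a cone of constraints `φ a ≤ s`. -/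
theorem exists_linearMap_le_of_cone {E : Type*} [AddCommGroup E] [Module ℝ E] (A : Set (E × ℝ))
    (h_add : ∀ x ∈ A, ∀ y ∈ A, x + y ∈ A) (h_smul : ∀ c : ℝ, 0 < c → ∀ x ∈ A, c • x ∈ A)
    (h_total : ∀ e, ∃ s, (e, s) ∈ A) (h_pos : ∀ s, (0, s) ∈ A → 0 ≤ s) :
    ∃ φ : E →ₗ[ℝ] ℝ, ∀ x ∈ A, φ x.1 ≤ x.2 := by
  let S : E → Set ℝ := fun e => {s | (e, s) ∈ A}
  have hne : ∀ e, (S e).Nonempty := h_total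
  have hbdd : ∀ e, BddBelow (S e) := by
    intro e
    obtain ⟨s', hs'⟩ := h_total (-e)
    refine ⟨-s', fun s hs => ?_⟩
    have := h_pos (s + s') (by simpa using h_add _ hs _ hs')
    linarith
  have hle : ∀ c : ℝ, 0 < c → ∀ e, sInf (S (c • e)) ≤ c * sInf (S e) := by
    intro c hc e
    rw [← div_le_iff₀' hc]
    refine le_csInf (hne e) fun s hs => ?_
    rw [div_le_iff₀' hc]
    exact csInf_le (hbdd _) (h_smul c hc _ hs)
  -- The infimum of the admissible `s` over `e` is finite, since a bound over `-e` gives a lower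
  -- bound over `e`, and it is sublinear in `e`. Hahn–Banach extends the zero functional on the
  -- trivial subspace below it.
  obtain ⟨φ, -, hφ⟩ := exists_extension_of_le_sublinear (⊥ : E →ₗ.[ℝ] ℝ) (fun e => sInf (S e))
    (fun c hc e => by
      refine le_antisymm (hle c hc e) ?_
      have := hle c⁻¹ (inv_pos.2 hc) (c • e)
      rwa [inv_smul_smul₀ hc.ne', ← div_eq_inv_mul, le_div_iff₀' hc] at this)
    (fun x y => by
      rw [← sub_le_iff_le_add]
      refine le_csInf (hne x) fun s hs => ?_
      rw [sub_le_comm]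
      refine le_csInf (hne y) fun t ht => ?_
      rw [sub_le_iff_le_add, add_comm t s]
      exact csInf_le (hbdd _) (h_add _ hs _ ht))
    (by
      rintro ⟨x, hx⟩
      obtain rfl : x = 0 := (Submodule.mem_bot ℝ).1 hx
      refine le_csInf (hne _) fun s hs => ?_
      have : (⟨0, hx⟩ : (⊥ : E →ₗ.[ℝ] ℝ).domain) = 0 := rfl
      rw [this, LinearPMap.map_zero]
      exact h_pos s hs)
  exact ⟨φ, fun x hx => (hφ x.1).trans (csInf_le (hbdd _) hx)⟩

variable {Ω : Type*} [MeasurableSpace Ω] {μ : Measure Ω}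

namespace FunctionGauge

/-- The vector space of measurable functions with finite gauge. -/
def space (γ : FunctionGauge μ) {M : ℝ≥0} (h : γ.IsSubadditive M) : Submodule ℝ (Ω → ℝ) where
  carrier := {e | Measurable e ∧ γ (fun ω => ‖e ω‖ₑ) ≠ ∞}
  add_mem' := fun {e e'} he he' => by
    refine ⟨he.1.add he'.1, ne_top_of_le_ne_top ?_ ((γ.mono_of_le fun ω => ?_).trans
      (h.add_le he.1.enorm he'.1.enorm))⟩
    · exact ENNReal.mul_ne_top ENNReal.coe_ne_top (ENNReal.add_ne_top.2 ⟨he.2, he'.2⟩)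
    · exact enorm_add_le _ _
  zero_mem' := ⟨measurable_zero, by simp [γ.zero]⟩
  smul_mem' := fun c e he => by
    refine ⟨he.1.const_smul c, ?_⟩
    simp only [Pi.smul_apply, enorm_smul]
    exact γ.const_mul_ne_top enorm_ne_top he.2

variable {γ : FunctionGauge μ} {M : ℝ≥0} {h : γ.IsSubadditive M}

theorem mem_space_of_le {e e' : Ω → ℝ} (he' : e' ∈ γ.space h) (he : Measurable e)
    (hle : ∀ ω, ‖e ω‖ₑ ≤ ‖e' ω‖ₑ) : e ∈ γ.space h :=
  ⟨he, ne_top_of_le_ne_top he'.2 (γ.mono_of_le hle)⟩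

/-- The pointwise minimum of a nonnegative function and a `[0, ∞]`-valued function. -/
noncomputable def truncate (e : γ.space h) {F : Ω → ℝ≥0∞} (hF : Measurable F) : γ.space h :=
  ⟨fun ω => (min (ENNReal.ofReal (e.1 ω)) (F ω)).toReal,
    mem_space_of_le e.2 (e.2.1.ennreal_ofReal.min hF).ennreal_toReal fun ω => by
      rw [Real.enorm_eq_ofReal ENNReal.toReal_nonneg,
        ENNReal.ofReal_toReal (ne_top_of_le_ne_top ENNReal.ofReal_ne_top (min_le_left _ _)),
        Real.enorm_eq_ofReal_abs]
      exact (min_le_left _ _).trans (ENNReal.ofReal_le_ofReal (le_abs_self _))⟩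

theorem ofReal_truncate (e : γ.space h) {F : Ω → ℝ≥0∞} (hF : Measurable F) (ω : Ω) :
    ENNReal.ofReal ((truncate e hF).1 ω) = min (ENNReal.ofReal (e.1 ω)) (F ω) :=
  ENNReal.ofReal_toReal (ne_top_of_le_ne_top ENNReal.ofReal_ne_top (min_le_left _ _))

theorem truncate_nonneg (e : γ.space h) {F : Ω → ℝ≥0∞} (hF : Measurable F) (ω : Ω) :
    0 ≤ (truncate e hF).1 ω := ENNReal.toReal_nonneg

theorem truncate_le (e : γ.space h) (he : ∀ ω, 0 ≤ e.1 ω) {F : Ω → ℝ≥0∞} (hF : Measurable F)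
    (ω : Ω) : (truncate e hF).1 ω ≤ e.1 ω := by
  rw [← ENNReal.ofReal_le_ofReal_iff (he ω), ofReal_truncate]
  exact min_le_left _ _

section Representation

variable (φ : γ.space h →ₗ[ℝ] ℝ)

/-- The extension of a positive functional to `[0, ∞]`-valued functions. -/
noncomputable def extendFunctional (F : Ω → ℝ≥0∞) : ℝ≥0∞ :=
  ⨆ (e : γ.space h) (_ : (∀ ω, 0 ≤ e.1 ω) ∧ ∀ ω, ENNReal.ofReal (e.1 ω) ≤ F ω),
    ENNReal.ofReal (φ e)

variable {φ}

theorem le_extendFunctional {F : Ω → ℝ≥0∞} (e : γ.space h) (he : ∀ ω, 0 ≤ e.1 ω)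
    (hle : ∀ ω, ENNReal.ofReal (e.1 ω) ≤ F ω) : ENNReal.ofReal (φ e) ≤ extendFunctional φ F :=
  le_iSup₂ (f := fun (e : γ.space h)
    (_ : (∀ ω, 0 ≤ e.1 ω) ∧ ∀ ω, ENNReal.ofReal (e.1 ω) ≤ F ω) => ENNReal.ofReal (φ e)) e ⟨he, hle⟩

theorem extendFunctional_mono {F G : Ω → ℝ≥0∞} (hFG : ∀ ω, F ω ≤ G ω) :
    extendFunctional φ F ≤ extendFunctional φ G :=
  iSup₂_le fun e he => le_extendFunctional e he.1 fun ω => (he.2 ω).trans (hFG ω)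

theorem extendFunctional_zero : extendFunctional φ (fun _ => 0) = 0 := by
  refine le_antisymm (iSup₂_le fun e he => ?_) zero_le
  have : e = 0 := Subtype.ext (funext fun ω => le_antisymm (by simpa using he.2 ω) (he.1 ω))
  simp [this]

theorem extendFunctional_le {C : ℝ≥0} (hC : ∀ e, φ e ≤ (C * γ (fun ω => ‖e.1 ω‖ₑ)).toReal)
    {F : Ω → ℝ≥0∞} {G : Ω → ℝ≥0∞} (hFG : F ≤ᵐ[μ] G) : extendFunctional φ F ≤ C * γ G := by
  refine iSup₂_le fun e he => (ENNReal.ofReal_le_ofReal (hC e)).trans ?_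
  rw [ENNReal.ofReal_toReal (ENNReal.mul_ne_top ENNReal.coe_ne_top e.2.2)]
  refine mul_le_mul_right (γ.mono ?_) _
  filter_upwards [hFG] with ω hω
  rw [Real.enorm_eq_ofReal (he.1 ω)]
  exact (he.2 ω).trans hω

/-- Riesz decomposition: a function `e` below `F + G` is the sum of `min e F`, which lies below `F`,
and a remainder, which lies below `G`. -/
theorem extendFunctional_add (hpos : ∀ e : γ.space h, (∀ ω, 0 ≤ e.1 ω) → 0 ≤ φ e)
    {F G : Ω → ℝ≥0∞} (hF : Measurable F) :
    extendFunctional φ (fun ω => F ω + G ω) = extendFunctional φ F + extendFunctional φ G := by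
  refine le_antisymm (iSup₂_le fun e he => ?_) ?_
  · have hsub : ∀ ω, 0 ≤ (e - truncate e hF).1 ω := fun ω => by
      simpa using truncate_le e he.1 hF ω
    have heq : φ e = φ (truncate e hF) + φ (e - truncate e hF) := by
      rw [← map_add, add_sub_cancel]
    rw [heq]
    refine ENNReal.ofReal_add_le.trans (add_le_add ?_ ?_)
    · exact le_extendFunctional _ (truncate_nonneg e hF) fun ω => by
        rw [ofReal_truncate]; exact min_le_right _ _
    · refine le_extendFunctional _ hsub fun ω => ?_
      change ENNReal.ofReal (e.1 ω - (truncate e hF).1 ω) ≤ _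
      rw [ENNReal.ofReal_sub _ (truncate_nonneg e hF ω), ofReal_truncate]
      rcases le_total (ENNReal.ofReal (e.1 ω)) (F ω) with h1 | h1
      · simp [h1]
      · rw [min_eq_right h1, tsub_le_iff_left]
        exact he.2 ω
  · refine ENNReal.biSup_add_biSup_le' ⟨0, by simp⟩ ⟨0, by simp⟩ fun e he e' he' => ?_
    rw [← ENNReal.ofReal_add (hpos e he.1) (hpos e' he'.1), ← map_add]
    refine le_extendFunctional _ (fun ω => add_nonneg (he.1 ω) (he'.1 ω)) fun ω => ?_
    exact ENNReal.ofReal_add_le.trans (add_le_add (he.2 ω) (he'.2 ω))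

theorem extendFunctional_sum (hpos : ∀ e : γ.space h, (∀ ω, 0 ≤ e.1 ω) → 0 ≤ φ e)
    {ι : Type*} (s : Finset ι) {F : ι → Ω → ℝ≥0∞} (hF : ∀ i, Measurable (F i)) :
    extendFunctional φ (fun ω => ∑ i ∈ s, F i ω) = ∑ i ∈ s, extendFunctional φ (F i) := by
  classical
  induction s using Finset.induction_on with
  | empty => simpa using extendFunctional_zero
  | insert i s hi ih =>
    simp_rw [Finset.sum_insert hi]
    rw [extendFunctional_add hpos (hF i), ih]

theorem extendFunctional_const_mul (c : ℝ≥0) (F : Ω → ℝ≥0∞) :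
    extendFunctional φ (fun ω => c * F ω) = c * extendFunctional φ F := by
  have key : ∀ (c : ℝ≥0) (F : Ω → ℝ≥0∞),
      c * extendFunctional φ F ≤ extendFunctional φ (fun ω => c * F ω) := by
    intro c F
    unfold extendFunctional
    simp_rw [ENNReal.mul_iSup]
    refine iSup₂_le fun e he => ?_
    have h1 : (c : ℝ≥0∞) * ENNReal.ofReal (φ e) = ENNReal.ofReal (φ ((c : ℝ) • e)) := by
      rw [map_smul, smul_eq_mul, ENNReal.ofReal_mul c.coe_nonneg, ENNReal.ofReal_coe_nnreal]
    rw [h1]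
    refine le_extendFunctional _ (fun ω => mul_nonneg c.2 (he.1 ω)) fun ω => ?_
    change ENNReal.ofReal ((c : ℝ) * e.1 ω) ≤ _
    rw [ENNReal.ofReal_mul c.coe_nonneg, ENNReal.ofReal_coe_nnreal]
    exact mul_le_mul_right (he.2 ω) _
  refine le_antisymm ?_ (key c F)
  rcases eq_or_ne c 0 with rfl | hc
  · simp [extendFunctional_zero]
  have hc' : (c : ℝ≥0∞) ≠ 0 := by simpa using hc
  have h2 := key c⁻¹ (fun ω => c * F ω)
  rw [ENNReal.coe_inv hc] at h2
  simp_rw [← mul_assoc, ENNReal.inv_mul_cancel hc' ENNReal.coe_ne_top, one_mul] at h2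
  calc extendFunctional φ (fun ω => c * F ω)
      = c * ((c : ℝ≥0∞)⁻¹ * extendFunctional φ (fun ω => c * F ω)) := by
        rw [← mul_assoc, ENNReal.mul_inv_cancel hc' ENNReal.coe_ne_top, one_mul]
    _ ≤ _ := by gcongr

/-- Order continuity becomes monotone convergence: for `e` below the supremum, the remainders `e -
min e (F n)` decrease to zero, so their gauges, which control `φ`, have infimum zero. -/
theorem extendFunctional_iSup (hoc : γ.IsOrderContinuous) {C : ℝ≥0}
    (hC : ∀ e, φ e ≤ (C * γ (fun ω => ‖e.1 ω‖ₑ)).toReal)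
    {F : ℕ → Ω → ℝ≥0∞} (hF : ∀ n, Measurable (F n)) (hmono : Monotone F) :
    extendFunctional φ (fun ω => ⨆ n, F n ω) = ⨆ n, extendFunctional φ (F n) := by
  refine le_antisymm (iSup₂_le fun e he => ?_)
    (iSup_le fun n => extendFunctional_mono fun ω => le_iSup (fun n => F n ω) n)
  let f : ℕ → Ω → ℝ≥0∞ := fun n ω => ‖(e - truncate e (hF n)).1 ω‖ₑ
  have hf : ∀ n ω, f n ω = ENNReal.ofReal (e.1 ω) - min (ENNReal.ofReal (e.1 ω)) (F n ω) := by
    intro n ω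
    have h0 : 0 ≤ e.1 ω - (truncate e (hF n)).1 ω := by simpa using truncate_le e he.1 (hF n) ω
    change ‖e.1 ω - (truncate e (hF n)).1 ω‖ₑ = _
    rw [Real.enorm_eq_ofReal h0, ENNReal.ofReal_sub _ (truncate_nonneg e (hF n) ω),
      ofReal_truncate]
  have h1 : ⨅ n, γ (f n) = 0 := by
    refine hoc f (fun n => (e - truncate e (hF n)).2.1.enorm) ?_ ?_ (e - truncate e (hF 0)).2.2
    · intro m n hmn ω
      rw [hf, hf]
      exact tsub_le_tsub_left (min_le_min le_rfl (hmono hmn ω)) _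
    · refine Eventually.of_forall fun ω => ?_
      simp_rw [hf]
      rw [← ENNReal.sub_iSup ENNReal.ofReal_ne_top, ← inf_iSup_eq]
      rw [inf_eq_left.2 (he.2 ω), tsub_self]
  have h2 : ∀ n, ENNReal.ofReal (φ e) ≤ (⨆ n, extendFunctional φ (F n)) + C * γ (f n) := by
    intro n
    have heq : φ e = φ (truncate e (hF n)) + φ (e - truncate e (hF n)) := by
      rw [← map_add, add_sub_cancel]
    rw [heq]
    refine ENNReal.ofReal_add_le.trans (add_le_add ?_ ?_)
    · refine le_trans ?_ (le_iSup (fun n => extendFunctional φ (F n)) n)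
      exact le_extendFunctional _ (truncate_nonneg e (hF n)) fun ω => by
        rw [ofReal_truncate]; exact min_le_right _ _
    · refine (ENNReal.ofReal_le_ofReal (hC _)).trans ?_
      rw [ENNReal.ofReal_toReal
        (ENNReal.mul_ne_top ENNReal.coe_ne_top (e - truncate e (hF n)).2.2)]
  have h3 := le_iInf h2
  rwa [← ENNReal.add_iInf, ← ENNReal.mul_iInf (by simp), h1, mul_zero, add_zero] at h3

/-- Additivity and monotone convergence turn the values of the extended functional on indicators
into a measure whose integral is that functional. Domination by `γ` makes this measure absolutely
continuous with respect to `μ` and finite on an exhausting sequence, so `w` is its Radon–Nikodym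
derivative. -/
theorem exists_density [SigmaFinite μ] (hoc : γ.IsOrderContinuous) (hex : γ.Exhausts) {C : ℝ≥0}
    (hpos : ∀ e : γ.space h, (∀ ω, 0 ≤ e.1 ω) → 0 ≤ φ e)
    (hC : ∀ e, φ e ≤ (C * γ (fun ω => ‖e.1 ω‖ₑ)).toReal) :
    ∃ w : Ω → ℝ≥0∞, Measurable w ∧ (∀ᵐ ω ∂μ, w ω < ∞) ∧
      (∀ F, Measurable F → ∫⁻ ω, F ω * w ω ∂μ ≤ C * γ F) ∧
      ∀ e : γ.space h, (∀ ω, 0 ≤ e.1 ω) →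
        ENNReal.ofReal (φ e) ≤ ∫⁻ ω, ENNReal.ofReal (e.1 ω) * w ω ∂μ := by
  let lam : Measure Ω := Measure.ofMeasurable
    (fun A _ => extendFunctional φ (A.indicator 1))
    (by simpa using extendFunctional_zero)
    (fun A hA hd => by
      have h1 : (⋃ i, A i).indicator (1 : Ω → ℝ≥0∞) =
          fun ω => ⨆ n, ∑ i ∈ Finset.range n, (A i).indicator 1 ω := by
        funext ω
        rw [← ENNReal.tsum_eq_iSup_nat (f := fun i => (A i).indicator (1 : Ω → ℝ≥0∞) ω)]
        by_cases hω : ω ∈ ⋃ i, A i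
        · obtain ⟨i, hi⟩ := Set.mem_iUnion.1 hω
          rw [tsum_eq_single i fun j hj => Set.indicator_of_notMem
            (fun hj' => Set.disjoint_left.1 (hd hj) hj' hi) _]
          simp [hi, hω]
        · rw [Set.indicator_of_notMem hω]
          simp only [Set.mem_iUnion, not_exists] at hω
          simp [hω]
      have hm : ∀ i, Measurable ((A i).indicator (1 : Ω → ℝ≥0∞)) := fun i =>
        measurable_one.indicator (hA i)
      rw [h1, extendFunctional_iSup hoc hC
        (fun n => Finset.measurable_fun_sum _ fun i _ => hm i)
        (fun m n hmn ω => Finset.sum_le_sum_of_subset (Finset.range_mono hmn)),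
        ENNReal.tsum_eq_iSup_nat]
      exact iSup_congr fun n => extendFunctional_sum hpos _ hm)
  have hlam : ∀ A, MeasurableSet A → lam A = extendFunctional φ (A.indicator 1) := fun A hA =>
    Measure.ofMeasurable_apply A hA
  have hint : ∀ F, Measurable F → ∫⁻ ω, F ω ∂lam = extendFunctional φ F := by
    intro F hF
    refine Measurable.ennreal_induction
      (motive := fun F => ∫⁻ ω, F ω ∂lam = extendFunctional φ F) ?_ ?_ ?_ hF
    · intro c A hA
      rw [lintegral_indicator_const hA, hlam A hA]
      rcases eq_or_ne c ∞ with rfl | hc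
      · have h1 : A.indicator (fun _ => (∞ : ℝ≥0∞)) =
            fun ω => ⨆ n : ℕ, ((n : ℝ≥0) : ℝ≥0∞) * A.indicator 1 ω := by
          funext ω
          by_cases hω : ω ∈ A <;> simp [hω, ENNReal.iSup_natCast]
        rw [h1, extendFunctional_iSup hoc hC
          (fun n => (measurable_one.indicator hA).const_mul _) (fun m n hmn ω => by
            gcongr)]
        simp_rw [extendFunctional_const_mul]
        rw [← ENNReal.iSup_mul]
        simp [ENNReal.iSup_natCast]
      · lift c to ℝ≥0 using hc
        rw [← extendFunctional_const_mul]
        congr 1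
        funext ω
        by_cases hω : ω ∈ A <;> simp [hω]
    · intro f g _ hf hg ihf ihg
      have h1 := extendFunctional_add hpos (φ := φ) (G := g) hf
      rw [← ihf, ← ihg, ← lintegral_add_left hf] at h1
      exact h1.symm
    · intro f hf hmono ih
      rw [lintegral_iSup hf hmono, extendFunctional_iSup hoc hC hf hmono]
      exact iSup_congr ih
  have hac : lam ≪ μ := by
    refine Measure.AbsolutelyContinuous.mk fun A hA h0 => ?_
    rw [hlam A hA]
    refine le_antisymm ((extendFunctional_le hC (G := fun _ => 0) ?_).trans ?_) zero_le
    · filter_upwards [measure_eq_zero_iff_ae_notMem.1 h0] with ω hω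
      simp [hω]
    · simp [γ.zero]
  have hsf : SigmaFinite lam := by
    obtain ⟨B, hBm, -, hBae, hBfin⟩ := hex
    have hN : lam (⋃ n, B n)ᶜ = 0 := by
      apply hac
      rw [measure_eq_zero_iff_ae_notMem]
      filter_upwards [hBae] with ω hω
      simpa using hω
    -- The sets `B n` cover the space only up to a null set; adjoining that set to each of them
    -- gives an honest cover.
    refine ⟨⟨⟨fun n => B n ∪ (⋃ n, B n)ᶜ, fun _ => trivial, fun n => ?_, ?_⟩⟩⟩
    · refine (measure_union_le _ _).trans_lt ?_
      rw [hN, add_zero, hlam _ (hBm n)]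
      exact (extendFunctional_le hC (EventuallyLE.refl _ _)).trans_lt
        (ENNReal.mul_lt_top ENNReal.coe_lt_top (hBfin n).lt_top)
    · rw [← Set.iUnion_union, Set.union_compl_self]
  have hw : ∀ F, Measurable F → ∫⁻ ω, F ω * lam.rnDeriv μ ω ∂μ = extendFunctional φ F := by
    intro F hF
    rw [← hint F hF]
    nth_rewrite 2 [← Measure.withDensity_rnDeriv_eq lam μ hac]
    rw [lintegral_withDensity_eq_lintegral_mul _ (Measure.measurable_rnDeriv _ _) hF]
    exact lintegral_congr fun ω => mul_comm _ _
  refine ⟨lam.rnDeriv μ, Measure.measurable_rnDeriv _ _, Measure.rnDeriv_lt_top _ _,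
    fun F hF => ?_, fun e he => ?_⟩
  · rw [hw F hF]
    exact extendFunctional_le hC (EventuallyLE.refl _ _)
  · rw [hw _ e.2.1.ennreal_ofReal]
    exact le_extendFunctional e he fun ω => le_rfl

end Representation

end FunctionGauge

end RegularOperators

/-! ### Weights from Hahn–Banach, and powers of gauges. -/

namespace RegularOperators

variable {Ω : Type*} [MeasurableSpace Ω] {μ : Measure Ω}

namespace FunctionGauge

variable {γ : FunctionGauge μ} {M : ℝ≥0}

theorem toReal_mem_space (h : γ.IsSubadditive M) {F : Ω → ℝ≥0∞} (hF : Measurable F)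
    (hfin : γ F ≠ ∞) : (fun ω => (F ω).toReal) ∈ γ.space h := by
  refine ⟨hF.ennreal_toReal, ne_top_of_le_ne_top hfin (γ.mono_of_le fun ω => ?_)⟩
  rw [Real.enorm_eq_ofReal ENNReal.toReal_nonneg]
  exact ENNReal.ofReal_toReal_le

/-- If a scaling invariant family of pairs `(u, t)` satisfies `∑ t_i ≤ γ (∑ u_i)`, then there is a
weight `w` with `t ≤ ∫ u w` on the family, whereas `∫ F w ≤ M γ F` for all `F`. -/
theorem exists_weight [SigmaFinite μ] (h : γ.IsSubadditive M) (hoc : γ.IsOrderContinuous)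
    (hex : γ.Exhausts) (U : Set ((Ω → ℝ≥0∞) × ℝ≥0∞)) (hUm : ∀ x ∈ U, Measurable x.1)
    (hUfin : ∀ x ∈ U, γ x.1 ≠ ∞)
    (hUscale : ∀ c : ℝ≥0, c ≠ 0 → ∀ x ∈ U, ((fun ω => c * x.1 ω), c * x.2) ∈ U)
    (hUsum : ∀ (n : ℕ) (x : Fin n → (Ω → ℝ≥0∞) × ℝ≥0∞), (∀ i, x i ∈ U) →
      ∑ i, (x i).2 ≤ γ (fun ω => ∑ i, (x i).1 ω)) :
    ∃ w : Ω → ℝ≥0∞, Measurable w ∧ (∀ᵐ ω ∂μ, w ω < ∞) ∧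
      (∀ F, Measurable F → ∫⁻ ω, F ω * w ω ∂μ ≤ M * γ F) ∧
      ∀ x ∈ U, x.2 ≤ ∫⁻ ω, x.1 ω * w ω ∂μ := by
  have hUt : ∀ x ∈ U, x.2 ≠ ∞ := by
    intro x hx
    have := hUsum 1 (fun _ => x) fun _ => hx
    simp only [Fin.sum_univ_one] at this
    exact ne_top_of_le_ne_top (hUfin x hx) this
  -- The cone encodes three demands on `φ`. A single `V` gives `φ V ≤ M γ V`, a single member `(u,
  -- t)` of `U` gives `t ≤ φ u`, and the inequality between functions, with both families empty,
  -- gives positivity. They are compatible: over `e = 0` one has `∑ t_k ≤ γ (∑ u_k) ≤ γ (∑ V_i) ≤ M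
  -- ∑ γ V_i`. Arbitrary finite index types make sums of constraints into disjoint unions of
  -- families.
  let A : Set (γ.space h × ℝ) := {a | ∃ (ι : Type) (_ : Fintype ι) (V : ι → Ω → ℝ≥0∞)
    (κ : Type) (_ : Fintype κ) (x : κ → (Ω → ℝ≥0∞) × ℝ≥0∞),
    (∀ i, Measurable (V i)) ∧ (∀ i, γ (V i) ≠ ∞) ∧ (∀ k, x k ∈ U) ∧
    (∀ᵐ ω ∂μ, a.1.1 ω + ∑ k, ((x k).1 ω).toReal ≤ ∑ i, (V i ω).toReal) ∧
    M * ∑ i, (γ (V i)).toReal - ∑ k, (x k).2.toReal ≤ a.2}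
  obtain ⟨φ, hφ⟩ := exists_linearMap_le_of_cone A (by
    rintro ⟨e, s⟩ ⟨ι, _, V, κ, _, x, h1, h2, h3, h4, h5⟩ ⟨e', s'⟩
      ⟨ι', _, V', κ', _, x', h1', h2', h3', h4', h5'⟩
    refine ⟨ι ⊕ ι', inferInstance, Sum.elim V V', κ ⊕ κ', inferInstance, Sum.elim x x',
      ?_, ?_, ?_, ?_, ?_⟩
    · rintro (i | i)
      exacts [h1 i, h1' i]
    · rintro (i | i)
      exacts [h2 i, h2' i]
    · rintro (i | i)
      exacts [h3 i, h3' i]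
    · filter_upwards [h4, h4'] with ω hω hω'
      simp only [Fintype.sum_sum_type, Sum.elim_inl, Sum.elim_inr]
      change (e.1 ω + e'.1 ω) + _ ≤ _
      linarith
    · simp only [Fintype.sum_sum_type, Sum.elim_inl, Sum.elim_inr, Prod.mk_add_mk]
      simp only at h5 h5'
      linarith) (by
    rintro c hc ⟨e, s⟩ ⟨ι, _, V, κ, _, x, h1, h2, h3, h4, h5⟩
    lift c to ℝ≥0 using hc.le
    have hc0 : c ≠ 0 := by rintro rfl; simp at hc
    refine ⟨ι, inferInstance, fun i ω => c * V i ω, κ, inferInstance,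
      fun k => ((fun ω => c * (x k).1 ω), c * (x k).2),
      fun i => (h1 i).const_mul _, fun i => γ.const_mul_ne_top ENNReal.coe_ne_top (h2 i),
      fun k => hUscale c hc0 _ (h3 k), ?_, ?_⟩
    · filter_upwards [h4] with ω hω
      simp only [ENNReal.toReal_mul, ENNReal.coe_toReal, ← Finset.mul_sum]
      change (c : ℝ) * e.1 ω + _ ≤ _
      rw [← mul_add]
      exact mul_le_mul_of_nonneg_left hω c.2
    · simp only [ENNReal.toReal_mul, ENNReal.coe_toReal, ← Finset.mul_sum, Prod.smul_mk,
        smul_eq_mul]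
      have hle : ∑ i, (γ (fun ω => c * V i ω)).toReal ≤ c * ∑ i, (γ (V i)).toReal := by
        rw [Finset.mul_sum]
        refine Finset.sum_le_sum fun i _ => ?_
        have := ENNReal.toReal_mono (ENNReal.mul_ne_top ENNReal.coe_ne_top (h2 i))
          (γ.smul_le c (V i))
        simpa using this
      calc _ ≤ (M : ℝ) * (c * ∑ i, (γ (V i)).toReal) - c * ∑ k, (x k).2.toReal := by gcongr
        _ = c * (M * ∑ i, (γ (V i)).toReal - ∑ k, (x k).2.toReal) := by ring
        _ ≤ c * s := mul_le_mul_of_nonneg_left h5 c.2) (by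
    intro e
    refine ⟨M * (γ (fun ω => ‖e.1 ω‖ₑ)).toReal, Unit, inferInstance, fun _ ω => ‖e.1 ω‖ₑ,
      Empty, inferInstance, Empty.elim, fun _ => e.2.1.enorm, fun _ => e.2.2,
      fun k => k.elim, ?_, by simp⟩
    refine Eventually.of_forall fun ω => ?_
    simpa using le_abs_self (e.1 ω)) (by
    rintro s ⟨ι, _, V, κ, _, x, h1, h2, h3, h4, h5⟩
    have hfinV : ∀ᵐ ω ∂μ, ∀ i, V i ω < ∞ := ae_all_iff.2 fun i => γ.ae_lt_top (h1 i) (h2 i)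
    have hfinx : ∀ᵐ ω ∂μ, ∀ k, (x k).1 ω < ∞ :=
      ae_all_iff.2 fun k => γ.ae_lt_top (hUm _ (h3 k)) (hUfin _ (h3 k))
    have hle : ∑ k, (x k).2 ≤ M * ∑ i, γ (V i) := by
      let eκ := Fintype.equivFin κ
      let eι := Fintype.equivFin ι
      have ha := hUsum _ (fun j => x (eκ.symm j)) fun j => h3 _
      have hb := h _ (fun j => V (eι.symm j)) fun j => h1 _
      rw [eκ.symm.sum_comp (fun k => (x k).2)] at ha
      rw [eι.symm.sum_comp (fun i => γ (V i))] at hb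
      simp only [fun ω => eκ.symm.sum_comp (fun k => (x k).1 ω)] at ha
      simp only [fun ω => eι.symm.sum_comp (fun i => V i ω)] at hb
      refine ha.trans ((γ.mono ?_).trans hb)
      filter_upwards [h4, hfinV, hfinx] with ω hω hV hx
      rw [← ENNReal.toReal_le_toReal (ENNReal.sum_ne_top.2 fun k _ => (hx k).ne)
        (ENNReal.sum_ne_top.2 fun i _ => (hV i).ne),
        ENNReal.toReal_sum fun k _ => (hx k).ne, ENNReal.toReal_sum fun i _ => (hV i).ne]
      simpa using hω
    have hVs : ∑ i, γ (V i) ≠ ∞ := ENNReal.sum_ne_top.2 fun i _ => h2 i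
    have := ENNReal.toReal_mono (ENNReal.mul_ne_top ENNReal.coe_ne_top hVs) hle
    rw [ENNReal.toReal_mul, ENNReal.coe_toReal, ENNReal.toReal_sum fun k _ => hUt _ (h3 k),
      ENNReal.toReal_sum fun i _ => h2 i] at this
    simp only at h5
    linarith)
  obtain ⟨w, hwm, hwfin, hw1, hw2⟩ := exists_density (φ := φ) hoc hex (C := M)
    (fun e he => by
      have : (-e, (0 : ℝ)) ∈ A := by
        refine ⟨Empty, inferInstance, Empty.elim, Empty, inferInstance, Empty.elim,
          fun k => k.elim, fun k => k.elim, fun k => k.elim, ?_, by simp⟩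
        exact Eventually.of_forall fun ω => by simpa using he ω
      have := hφ _ this
      simpa using this)
    (fun e => by
      refine hφ (e, (M * γ (fun ω => ‖e.1 ω‖ₑ)).toReal) ⟨Unit, inferInstance, fun _ ω => ‖e.1 ω‖ₑ,
        Empty, inferInstance, Empty.elim, fun _ => e.2.1.enorm, fun _ => e.2.2,
        fun k => k.elim, ?_, by rw [ENNReal.toReal_mul]; simp⟩
      refine Eventually.of_forall fun ω => ?_
      simpa using le_abs_self (e.1 ω))
  refine ⟨w, hwm, hwfin, hw1, fun x hx => ?_⟩
  let e : γ.space h := ⟨_, toReal_mem_space h (hUm x hx) (hUfin x hx)⟩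
  have hmem : (-e, -x.2.toReal) ∈ A := by
    refine ⟨Empty, inferInstance, Empty.elim, Unit, inferInstance, fun _ => x,
      fun k => k.elim, fun k => k.elim, fun _ => hx, ?_, by simp⟩
    exact Eventually.of_forall fun ω => by simp [e]
  have h1 : x.2.toReal ≤ φ e := by
    have := hφ _ hmem
    simpa using this
  calc x.2 = ENNReal.ofReal x.2.toReal := (ENNReal.ofReal_toReal (hUt x hx)).symm
    _ ≤ ENNReal.ofReal (φ e) := ENNReal.ofReal_le_ofReal h1
    _ ≤ ∫⁻ ω, ENNReal.ofReal (e.1 ω) * w ω ∂μ := hw2 e fun ω => ENNReal.toReal_nonneg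
    _ ≤ ∫⁻ ω, x.1 ω * w ω ∂μ := lintegral_mono fun ω => by
      gcongr
      exact ENNReal.ofReal_toReal_le

/-- The `r`-concavification of a gauge. -/
noncomputable def pow (γ : FunctionGauge μ) (t : ℝ) (ht : 0 < t) : FunctionGauge μ where
  toFun F := γ (fun ω => F ω ^ t⁻¹) ^ t
  mono {f g} hfg := by
    refine ENNReal.rpow_le_rpow (γ.mono ?_) ht.le
    filter_upwards [hfg] with ω hω
    exact ENNReal.rpow_le_rpow hω (inv_pos.2 ht).le
  smul_le c f := by
    simp_rw [ENNReal.mul_rpow_of_nonneg _ _ (inv_pos.2 ht).le]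
    have h1 : (c : ℝ≥0∞) ^ t⁻¹ ≠ ∞ :=
      ENNReal.rpow_ne_top_of_nonneg (inv_pos.2 ht).le ENNReal.coe_ne_top
    refine (ENNReal.rpow_le_rpow (γ.const_mul_le _ h1 _) ht.le).trans ?_
    rw [ENNReal.mul_rpow_of_nonneg _ _ ht.le, ENNReal.rpow_inv_rpow ht.ne']
  ae_lt_top {f} hf hfin := by
    have h1 : γ (fun ω => f ω ^ t⁻¹) ≠ ∞ := by
      intro h2
      rw [h2, ENNReal.top_rpow_of_pos ht] at hfin
      exact hfin rfl
    filter_upwards [γ.ae_lt_top (hf.pow_const _) h1] with ω hω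
    by_contra h3
    rw [not_lt, top_le_iff] at h3
    rw [h3, ENNReal.top_rpow_of_pos (inv_pos.2 ht)] at hω
    exact lt_irrefl _ hω

variable {t : ℝ} (ht : 0 < t)

theorem pow_apply (γ : FunctionGauge μ) (F : Ω → ℝ≥0∞) :
    γ.pow t ht F = γ (fun ω => F ω ^ t⁻¹) ^ t := rfl

theorem pow_rpow (γ : FunctionGauge μ) (F : Ω → ℝ≥0∞) :
    γ.pow t ht (fun ω => F ω ^ t) = γ F ^ t := by
  simp only [pow_apply, ENNReal.rpow_rpow_inv ht.ne']

theorem IsOrderContinuous.pow (hoc : γ.IsOrderContinuous) : (γ.pow t ht).IsOrderContinuous := by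
  intro f hf hanti hinf h0
  have h1 : ⨅ n, γ (fun ω => f n ω ^ t⁻¹) = 0 := by
    refine hoc _ (fun n => (hf n).pow_const _)
      (fun m n hmn ω => ENNReal.rpow_le_rpow (hanti hmn ω) (inv_pos.2 ht).le) ?_ ?_
    · filter_upwards [hinf] with ω hω
      have := (ENNReal.orderIsoRpow t⁻¹ (inv_pos.2 ht)).map_iInf fun n => f n ω
      simp only [ENNReal.orderIsoRpow_apply] at this
      rw [← this, hω, ENNReal.zero_rpow_of_pos (inv_pos.2 ht)]
    · intro h2
      rw [pow_apply, h2, ENNReal.top_rpow_of_pos ht] at h0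
      exact h0 rfl
  have := (ENNReal.orderIsoRpow t ht).map_iInf fun n => γ (fun ω => f n ω ^ t⁻¹)
  simp only [ENNReal.orderIsoRpow_apply] at this
  simp only [pow_apply]
  rw [← this, h1, ENNReal.zero_rpow_of_pos ht]

theorem Exhausts.pow (hex : γ.Exhausts) : (γ.pow t ht).Exhausts := by
  obtain ⟨B, h1, h2, h3, h4⟩ := hex
  refine ⟨B, h1, h2, h3, fun n => ?_⟩
  have : (B n).indicator (1 : Ω → ℝ≥0∞) = fun ω => (B n).indicator 1 ω ^ t := by
    funext ω
    by_cases hω : ω ∈ B n <;> simp [hω, ht]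
  rw [this, pow_rpow]
  exact ENNReal.rpow_ne_top_of_nonneg ht.le (h4 n)

end FunctionGauge

end RegularOperators

/-! ### Consequences of convexity and concavity. -/

namespace RegularOperators

variable {Ω : Type*} [MeasurableSpace Ω] {μ : Measure Ω}

theorem enorm_lpSum {p : ℝ≥0∞} (hp : 0 < p) {n : ℕ} (x : Fin n → Ω →ₘ[μ] ℝ) :
    (fun ω => ‖lpSum p x ω‖ₑ) =ᵐ[μ] fun ω => ellENorm p (fun i => ‖x i ω‖ₑ) := by
  filter_upwards [AEEqFun.coeFn_mk _ (aestronglyMeasurable_ellNorm p x)] with ω h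
  rw [lpSum, h, enorm_ellNorm hp]

theorem enorm_mixedSum {r q : ℝ≥0∞} (hr : 0 < r) (hq : 0 < q) {n m : ℕ}
    (x : Fin n → Fin m → Ω →ₘ[μ] ℝ) : (fun ω => ‖mixedSum r q x ω‖ₑ) =ᵐ[μ]
      fun ω => ellENorm r (fun i => ellENorm q (fun j => ‖x i j ω‖ₑ)) := by
  filter_upwards [enorm_lpSum hr fun i => lpSum q (x i),
    ae_all_iff.2 fun i => enorm_lpSum hq (x i)] with ω h1 h2
  rw [mixedSum, h1]
  simp_rw [h2]

namespace FunctionGauge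

/-- `r`-convexity of a gauge. -/
def IsConvex (γ : FunctionGauge μ) (r : ℝ≥0∞) (M : ℝ≥0) : Prop :=
  ∀ (n : ℕ) (F : Fin n → Ω → ℝ≥0∞), (∀ i, Measurable (F i)) → (∀ i, γ (F i) ≠ ∞) →
    γ (fun ω => ellENorm r fun i => F i ω) ≤ M * ellENorm r fun i => γ (F i)

/-- `r`-concavity of a gauge. -/
def IsConcave (γ : FunctionGauge μ) (r : ℝ≥0∞) (M : ℝ≥0) : Prop :=
  ∀ (n : ℕ) (F : Fin n → Ω → ℝ≥0∞), (∀ i, Measurable (F i)) → (∀ i, γ (F i) ≠ ∞) →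
    ellENorm r (fun i => γ (F i)) ≤ M * γ (fun ω => ellENorm r fun i => F i ω)

variable {γ : FunctionGauge μ} {M : ℝ≥0}

theorem const_mul_eq (γ : FunctionGauge μ) (c : ℝ≥0) (F : Ω → ℝ≥0∞) :
    γ (fun ω => c * F ω) = c * γ F := by
  refine le_antisymm (γ.smul_le c F) ?_
  rcases eq_or_ne c 0 with rfl | hc
  · simp
  have hc' : (c : ℝ≥0∞) ≠ 0 := by simpa using hc
  have h2 := γ.smul_le c⁻¹ (fun ω => c * F ω)
  rw [ENNReal.coe_inv hc] at h2
  simp_rw [← mul_assoc, ENNReal.inv_mul_cancel hc' ENNReal.coe_ne_top, one_mul] at h2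
  calc c * γ F ≤ c * ((c : ℝ≥0∞)⁻¹ * γ (fun ω => c * F ω)) := by gcongr
    _ = _ := by rw [← mul_assoc, ENNReal.mul_inv_cancel hc' ENNReal.coe_ne_top, one_mul]

theorem ellENorm_ne_top {p : ℝ≥0∞} (hp : 0 < p) {n : ℕ} {a : Fin n → ℝ≥0∞}
    (ha : ∀ i, a i ≠ ∞) : ellENorm p a ≠ ∞ := by
  obtain ⟨C, hC⟩ := ellENorm_le_const_mul_sum hp n
  exact ne_top_of_le_ne_top (ENNReal.mul_ne_top ENNReal.coe_ne_top
    (ENNReal.sum_ne_top.2 fun i _ => ha i)) (hC a)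

theorem IsSubadditive.gauge_ellENorm_ne_top (h : γ.IsSubadditive M) {p : ℝ≥0∞} (hp : 0 < p)
    {n : ℕ} {F : Fin n → Ω → ℝ≥0∞} (hF : ∀ i, Measurable (F i)) (hfin : ∀ i, γ (F i) ≠ ∞) :
    γ (fun ω => ellENorm p fun i => F i ω) ≠ ∞ := by
  obtain ⟨C, hC⟩ := ellENorm_le_const_mul_sum hp n
  refine ne_top_of_le_ne_top ?_ (γ.mono_of_le fun ω => hC fun i => F i ω)
  refine γ.const_mul_ne_top ENNReal.coe_ne_top (ne_top_of_le_ne_top ?_ (h n F hF))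
  exact ENNReal.mul_ne_top ENNReal.coe_ne_top (ENNReal.sum_ne_top.2 fun i _ => hfin i)

/-- Increments along a suitable subsequence are as small as desired, if all finite sums of
increments are bounded in an `r`-concave gauge. -/
theorem IsConcave.exists_strictMono {r : ℝ≥0∞} (h : γ.IsConcave r M) (hr : 1 ≤ r) (hr' : r ≠ ∞)
    (D : ℕ → ℕ → Ω → ℝ≥0∞) (hD : ∀ m n, Measurable (D m n)) {C : ℝ≥0∞} (hC : C ≠ ∞)
    (hsum : ∀ N : ℕ → ℕ, StrictMono N → ∀ K,
      γ (fun ω => ∑ k ∈ Finset.range K, D (N k) (N (k + 1)) ω) ≤ C)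
    (δ : ℕ → ℝ≥0∞) (hδ : ∀ k, 0 < δ k) :
    ∃ N : ℕ → ℕ, StrictMono N ∧ ∀ k, γ (D (N k) (N (k + 1))) ≤ δ k := by
  have hr0 : 0 < r := zero_lt_one.trans_le hr
  have hrr : 0 < r.toReal := ENNReal.toReal_pos hr0.ne' hr'
  -- If no such `n` existed, increments of gauge above `δ k` could be chained indefinitely;
  -- `r`-concavity would then bound `K * (δ k)^r` by `(M * C)^r` for every `K`.
  have key : ∀ k n₀, ∃ n ≥ n₀, ∀ m > n, γ (D n m) ≤ δ k := by
    intro k n₀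
    by_contra hcon
    push Not at hcon
    have hcon' : ∀ n, ∃ m > n, n₀ ≤ n → δ k < γ (D n m) := by
      intro n
      by_cases hn : n₀ ≤ n
      · obtain ⟨m, hm, h1⟩ := hcon n hn
        exact ⟨m, hm, fun _ => h1⟩
      · exact ⟨n + 1, Nat.lt_succ_self n, fun h => absurd h hn⟩
    choose next hnext hlt using hcon'
    let N : ℕ → ℕ := fun j => next^[j] n₀
    have hNs : ∀ j, N (j + 1) = next (N j) := fun j => Function.iterate_succ_apply' next j n₀
    have hN : StrictMono N := strictMono_nat_of_lt_succ fun j => by rw [hNs]; exact hnext _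
    have hN0 : ∀ j, n₀ ≤ N j := fun j => hN.monotone (Nat.zero_le j)
    have hlt' : ∀ j, δ k < γ (D (N j) (N (j + 1))) := fun j => by
      rw [hNs]; exact hlt _ (hN0 j)
    have hfin : ∀ j, γ (D (N j) (N (j + 1))) ≠ ∞ := fun j =>
      ne_top_of_le_ne_top hC ((γ.mono_of_le fun ω =>
        Finset.single_le_sum (f := fun k => D (N k) (N (k + 1)) ω) (fun _ _ => zero_le)
          (Finset.self_mem_range_succ j)).trans (hsum N hN (j + 1)))
    have hbound : ∀ K : ℕ, (K : ℝ≥0∞) * δ k ^ r.toReal ≤ (M * C) ^ r.toReal := by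
      intro K
      have h1 := h K (fun j => D (N j) (N (j + 1))) (fun j => hD _ _) (fun j => hfin j)
      have h2 : γ (fun ω => ellENorm r fun j : Fin K => D (N j) (N (j + 1)) ω) ≤ C := by
        refine (γ.mono_of_le fun ω => ?_).trans (hsum N hN K)
        rw [← Fin.sum_univ_eq_sum_range fun k => D (N k) (N (k + 1)) ω]
        exact ellENorm_le_sum hr _
      have h3 := ENNReal.rpow_le_rpow (h1.trans (mul_le_mul_right h2 _)) hrr.le
      rw [ellENorm_rpow hr0 hr'] at h3
      refine le_trans ?_ h3
      calc (K : ℝ≥0∞) * δ k ^ r.toReal = ∑ _j : Fin K, δ k ^ r.toReal := by simp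
        _ ≤ _ := Finset.sum_le_sum fun j _ => ENNReal.rpow_le_rpow (hlt' j).le hrr.le
    have hc : (M * C) ^ r.toReal ≠ ∞ :=
      ENNReal.rpow_ne_top_of_nonneg hrr.le (ENNReal.mul_ne_top ENNReal.coe_ne_top hC)
    have hδ0 : δ k ^ r.toReal ≠ 0 := by simp [hrr, (hδ k).ne', not_lt.2 hrr.le]
    obtain ⟨K, hK⟩ := ENNReal.exists_nat_gt (ENNReal.div_ne_top hc hδ0)
    rw [ENNReal.div_lt_iff (Or.inl hδ0) (Or.inr hc)] at hK
    exact hK.not_ge (hbound K)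
  choose f hf1 hf2 using key
  let N : ℕ → ℕ := fun k => Nat.rec (f 0 0) (fun k n => f (k + 1) (n + 1)) k
  have hN : StrictMono N := strictMono_nat_of_lt_succ fun k => hf1 (k + 1) (N k + 1)
  refine ⟨N, hN, fun k => ?_⟩
  have hk : ∀ m > N k, γ (D (N k) m) ≤ δ k := by
    cases k with
    | zero => exact hf2 0 0
    | succ k => exact hf2 (k + 1) (N k + 1)
  exact hk _ (hN (Nat.lt_succ_self k))

/-- The associate of an `r`-concave gauge is `r'`-convex. -/
theorem IsConcave.dual {r r' : ℝ≥0∞} (h : γ.IsConcave r M) (hγ : γ.Exhausts)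
    (hr : r.HolderConjugate r') : (γ.dual hγ).IsConvex r' M := by
  intro n G hG hfin
  have hr0 : 0 < r := zero_lt_one.trans_le (one_le_of_holderConjugate hr)
  have hr0' : 0 < r' := zero_lt_one.trans_le (one_le_of_holderConjugate hr.symm)
  obtain ⟨b, hbm, hb1, hb2⟩ := exists_measurable_norming hr.symm n
  have hGae : ∀ᵐ ω ∂μ, ∀ i, G i ω < ∞ :=
    ae_all_iff.2 fun i => (γ.dual hγ).ae_lt_top (hG i) (hfin i)
  refine iSup₂_le fun F hF => ?_
  -- Pointwise norming coefficients for the `ℓ_r'` norm of the `G i` split the test function `F`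
  -- into pieces `F * c i` whose `ℓ_r` sum is at most `F`, so that concavity of `γ` applies to the
  -- pieces.
  let c : Fin n → Ω → ℝ≥0∞ := fun i ω => b (fun k => G k ω) i
  have hcm : ∀ i, Measurable (c i) := fun i => (hbm i).comp (measurable_pi_lambda _ hG)
  have hFc : ∀ i, Measurable fun ω => F ω * c i ω := fun i => hF.1.mul (hcm i)
  have hle : ∀ ω, ellENorm r (fun i => F ω * c i ω) ≤ F ω := fun ω => by
    rw [ellENorm_const_mul hr0]
    calc F ω * ellENorm r (fun i => c i ω) ≤ F ω * 1 := by gcongr; exact hb1 _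
      _ = F ω := mul_one _
  have hFfin : ∀ i, γ (fun ω => F ω * c i ω) ≠ ∞ := fun i =>
    ne_top_of_le_ne_top ENNReal.one_ne_top ((γ.mono_of_le fun ω =>
      (le_ellENorm hr0 (fun i => F ω * c i ω) i).trans (hle ω)).trans hF.2)
  calc ∫⁻ ω, F ω * ellENorm r' (fun i => G i ω) ∂μ
      = ∫⁻ ω, ∑ i, F ω * c i ω * G i ω ∂μ := by
        refine lintegral_congr_ae ?_
        filter_upwards [hGae] with ω hω
        rw [← hb2 _ (ellENorm_ne_top hr0' fun i => (hω i).ne), Finset.mul_sum]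
        exact Finset.sum_congr rfl fun i _ => by simp only [c]; ring
    _ = ∑ i, ∫⁻ ω, F ω * c i ω * G i ω ∂μ :=
        lintegral_finsetSum (f := fun i ω => F ω * c i ω * G i ω) _ fun i _ => (hFc i).mul (hG i)
    _ ≤ ∑ i, γ (fun ω => F ω * c i ω) * γ.dual hγ (G i) :=
        Finset.sum_le_sum fun i _ => γ.lintegral_mul_le hγ (hFc i) (hFfin i) (hfin i)
    _ ≤ ellENorm r (fun i => γ (fun ω => F ω * c i ω)) * ellENorm r' (fun i => γ.dual hγ (G i)) :=
        sum_mul_le_ellENorm_mul hr _ _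
    _ ≤ M * ellENorm r' (fun i => γ.dual hγ (G i)) := by
        gcongr
        refine (h n _ hFc hFfin).trans ?_
        calc M * γ (fun ω => ellENorm r fun i => F ω * c i ω) ≤ M * 1 := by
              gcongr
              exact (γ.mono_of_le hle).trans hF.2
          _ = M := mul_one _

/-- With `F_i^(1/r)` in place of `F_i`, `r`-convexity raised to the power `r` is subadditivity of
the concavification with constant `M^r`. The extra `1` excludes a product `0 * ∞` when some term is
infinite. -/
theorem IsConvex.isSubadditive_pow {r : ℝ≥0∞} (h : γ.IsConvex r M) (h0 : 0 < r.toReal) :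
    (γ.pow r.toReal h0).IsSubadditive (M ^ r.toReal + 1) := by
  intro n F hF
  by_cases htop : ∃ i, γ.pow r.toReal h0 (F i) = ∞
  · obtain ⟨i, hi⟩ := htop
    rw [ENNReal.sum_eq_top.2 ⟨i, Finset.mem_univ i, hi⟩, ENNReal.mul_top (by simp)]
    exact le_top
  push Not at htop
  have hr0 : 0 < r := ENNReal.toReal_pos_iff.1 h0 |>.1
  have hrt : r ≠ ∞ := (ENNReal.toReal_pos_iff.1 h0).2.ne
  have hfin : ∀ i, γ (fun ω => F i ω ^ r.toReal⁻¹) ≠ ∞ := fun i hi => htop i (by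
    rw [pow_apply, hi, ENNReal.top_rpow_of_pos h0])
  have h1 := h n (fun i ω => F i ω ^ r.toReal⁻¹) (fun i => (hF i).pow_const _) hfin
  have h2 := ENNReal.rpow_le_rpow h1 h0.le
  rw [ENNReal.mul_rpow_of_nonneg _ _ h0.le, ellENorm_rpow hr0 hrt] at h2
  have h3 : (fun ω => ellENorm r fun i => F i ω ^ r.toReal⁻¹) =
      fun ω => (∑ i, F i ω) ^ r.toReal⁻¹ := by
    funext ω
    rw [ellENorm_of_ne_top hrt, one_div]
    simp_rw [ENNReal.rpow_inv_rpow h0.ne']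
  rw [h3] at h2
  refine h2.trans (mul_le_mul_left ?_ _)
  rw [ENNReal.coe_add, ENNReal.coe_rpow_of_nonneg _ h0.le]
  exact le_self_add

end FunctionGauge

namespace BanachFunctionSpace

variable {X : BanachFunctionSpace μ} {r : ℝ≥0∞}

/-- The element of `X` attached to a nonnegative function with finite gauge. -/
noncomputable def spaceOfENN (X : BanachFunctionSpace μ) (F : Ω → ℝ≥0∞) (hF : Measurable F)
    (h : X.gauge F ≠ ∞) : X.space :=
  ⟨ofENN μ F hF, by
    change X.norm _ < ∞
    rw [X.norm_ofENN hF h]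
    exact h.lt_top⟩

theorem ofReal_ellNorm_norm (hr : 0 < r) {n : ℕ} (x : Fin n → X.space) :
    ENNReal.ofReal (ellNorm r fun i => ‖x i‖) = ellENorm r fun i => X.norm (x i) := by
  have h0 : 0 ≤ ellNorm r fun i => ‖x i‖ := by
    unfold ellNorm
    split_ifs
    · exact Real.iSup_nonneg fun i => abs_nonneg _
    · exact Real.rpow_nonneg (Finset.sum_nonneg fun i _ => Real.rpow_nonneg (abs_nonneg _) _) _
  rw [← Real.enorm_eq_ofReal h0, enorm_ellNorm hr]
  congr 1
  funext i
  rw [Real.enorm_eq_ofReal (norm_nonneg _)]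
  exact ENNReal.ofReal_toReal (x i).2.ne

theorem norm_lpSum_ofENN (hr : 0 < r) {n : ℕ} {F : Fin n → Ω → ℝ≥0∞}
    (hF : ∀ i, Measurable (F i)) (hfin : ∀ i, X.gauge (F i) ≠ ∞) :
    X.norm (lpSum r fun i => ofENN μ (F i) (hF i)) =
      X.gauge (fun ω => ellENorm r fun i => F i ω) := by
  symm
  refine X.gauge_eq_norm ((enorm_lpSum hr _).trans ?_)
  filter_upwards [ae_all_iff.2 fun i => enorm_ofENN (hF i) (X.gauge.ae_lt_top (hF i) (hfin i))]
    with ω h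
  simp_rw [h]

theorem IsConvex.gauge (h : X.IsConvex r) (hr : 0 < r) : ∃ M, X.gauge.IsConvex r M := by
  obtain ⟨M, hM⟩ := h
  refine ⟨M, fun n F hF hfin => ?_⟩
  have := hM n fun i => X.spaceOfENN (F i) (hF i) (hfin i)
  rw [ofReal_ellNorm_norm hr] at this
  simpa only [spaceOfENN, norm_lpSum_ofENN hr hF hfin, X.norm_ofENN (hF _) (hfin _)] using this

theorem IsConcave.gauge (h : X.IsConcave r) (hr : 0 < r) : ∃ M, X.gauge.IsConcave r M := by
  obtain ⟨M, hM⟩ := h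
  refine ⟨M, fun n F hF hfin => ?_⟩
  have := hM n fun i => X.spaceOfENN (F i) (hF i) (hfin i)
  rw [ofReal_ellNorm_norm hr] at this
  simpa only [spaceOfENN, norm_lpSum_ofENN hr hF hfin, X.norm_ofENN (hF _) (hfin _)] using this

variable {M : ℝ≥0} (hr : 1 ≤ r) (hr' : r ≠ ∞)
include hr hr'

/-- Concavity with `r < ∞` provides a subsequence whose successive decrements have summable,
arbitrarily small gauges. As the sequence decreases to zero, its member `f (N 0)` is bounded almost
everywhere by the series of decrements, and completeness bounds the gauge of that series. -/
theorem isOrderContinuous_of_isConcave (h : X.gauge.IsConcave r M) :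
    X.gauge.IsOrderContinuous := by
  intro f hf hanti hinf h0
  refine le_antisymm (ENNReal.le_of_forall_pos_le_add fun ε hε _ => ?_) zero_le
  rw [zero_add]
  obtain ⟨δ, hδ, hδsum⟩ := ENNReal.exists_pos_sum_of_countable
    (ENNReal.coe_ne_zero.2 hε.ne') ℕ
  have htel : ∀ N : ℕ → ℕ, StrictMono N → ∀ K ω,
      ∑ k ∈ Finset.range K, (f (N k) ω - f (N (k + 1)) ω) + f (N K) ω = f (N 0) ω := by
    intro N hN K ω
    induction K with
    | zero => simp
    | succ K ih =>
      rw [Finset.sum_range_succ, add_assoc,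
        tsub_add_cancel_of_le (hanti (hN (Nat.lt_succ_self K)).le ω), ih]
  obtain ⟨N, hN, hNδ⟩ := h.exists_strictMono hr hr' (fun m n ω => f m ω - f n ω)
    (fun m n => (hf m).sub (hf n)) h0 (fun N hN K => X.gauge.mono_of_le fun ω =>
      (le_self_add.trans (htel N hN K ω).le).trans (hanti (Nat.zero_le _) ω))
    (fun k => δ k) (fun k => ENNReal.coe_pos.2 (hδ k))
  refine (iInf_le _ (N 0)).trans ?_
  calc X.gauge (f (N 0)) ≤ X.gauge (fun ω => ∑' k, (f (N k) ω - f (N (k + 1)) ω)) := by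
        refine X.gauge.mono ?_
        filter_upwards [hinf] with ω hω
        have h1 : ∀ n, f (N 0) ω ≤ ∑' k, (f (N k) ω - f (N (k + 1)) ω) + f n ω := by
          intro n
          rw [← htel N hN n ω]
          exact add_le_add (ENNReal.sum_le_tsum _) (hanti (hN.id_le n) ω)
        have h2 := le_iInf h1
        rwa [← ENNReal.add_iInf, hω, add_zero] at h2
    _ ≤ ∑' k, X.gauge (fun ω => f (N k) ω - f (N (k + 1)) ω) :=
        X.gauge_tsum_le _ fun k => (hf _).sub (hf _)
    _ ≤ ∑' k, (δ k : ℝ≥0∞) := ENNReal.tsum_le_tsum hNδ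
    _ ≤ ε := hδsum.le

/-- The Levi property of `r`-concave spaces. -/
theorem gauge_iSup_ne_top (h : X.gauge.IsConcave r M) {F : ℕ → Ω → ℝ≥0∞}
    (hF : ∀ n, Measurable (F n)) (hmono : Monotone F) {C : ℝ≥0∞} (hC : C ≠ ∞)
    (hle : ∀ n, X.gauge (F n) ≤ C) : X.gauge (fun ω => ⨆ n, F n ω) ≠ ∞ := by
  obtain ⟨δ, hδ, hδsum⟩ := ENNReal.exists_pos_sum_of_countable one_ne_zero ℕ
  have htel : ∀ N : ℕ → ℕ, StrictMono N → ∀ K ω,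
      F (N 0) ω + ∑ k ∈ Finset.range K, (F (N (k + 1)) ω - F (N k) ω) = F (N K) ω := by
    intro N hN K ω
    induction K with
    | zero => simp
    | succ K ih =>
      rw [Finset.sum_range_succ, ← add_assoc, ih,
        add_tsub_cancel_of_le (hmono (hN (Nat.lt_succ_self K)).le ω)]
  -- A subsequence with increments of summable gauge dominates the supremum by its first term plus a
  -- convergent series.
  obtain ⟨N, hN, hNδ⟩ := h.exists_strictMono hr hr' (fun m n ω => F n ω - F m ω)
    (fun m n => (hF n).sub (hF m)) hC (fun N hN K => (X.gauge.mono_of_le fun ω =>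
      le_add_self.trans (htel N hN K ω).le).trans (hle (N K)))
    (fun k => δ k) (fun k => ENNReal.coe_pos.2 (hδ k))
  have hsup : ∀ ω, ⨆ n, F n ω ≤ F (N 0) ω + ∑' k, (F (N (k + 1)) ω - F (N k) ω) := by
    refine fun ω => iSup_le fun n => (hmono (hN.id_le n) ω).trans ?_
    change F (N n) ω ≤ _
    rw [← htel N hN n ω]
    exact add_le_add le_rfl (ENNReal.sum_le_tsum _)
  refine ne_top_of_le_ne_top ?_ ((X.gauge.mono_of_le hsup).trans (X.gauge_add_le _ _))
  refine ENNReal.add_ne_top.2 ⟨ne_top_of_le_ne_top hC (hle _), ?_⟩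
  refine ne_top_of_le_ne_top ENNReal.one_ne_top ((X.gauge_tsum_le _ fun k =>
    (hF _).sub (hF _)).trans ?_)
  exact (ENNReal.tsum_le_tsum hNδ).trans hδsum.le

omit hr hr' in
/-- The norm of an order continuous space is determined by its Köthe dual. -/
theorem exists_dual_norming [SigmaFinite μ] (hoc : X.gauge.IsOrderContinuous) {F : Ω → ℝ≥0∞}
    (hF : Measurable F) (hfin : X.gauge F ≠ ∞) :
    ∃ G : Ω → ℝ≥0∞, Measurable G ∧ (∀ᵐ ω ∂μ, G ω < ∞) ∧
      X.gauge.dual X.exhausts_gauge G ≤ 1 ∧ X.gauge F ≤ ∫⁻ ω, F ω * G ω ∂μ := by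
  -- The constraints form the ray through `F` with its own gauge as the lower bound. The gauge is
  -- subadditive with constant `1`, so the weight lies in the unit ball of the Köthe dual.
  obtain ⟨w, hw, hwfin, hw1, hw2⟩ := FunctionGauge.exists_weight X.isSubadditive_gauge hoc
    X.exhausts_gauge {x | ∃ c : ℝ≥0, x = ((fun ω => c * F ω), c * X.gauge F)}
    (by rintro _ ⟨c, rfl⟩; exact hF.const_mul _)
    (by rintro _ ⟨c, rfl⟩; exact X.gauge.const_mul_ne_top ENNReal.coe_ne_top hfin)
    (by
      rintro c - _ ⟨d, rfl⟩
      exact ⟨c * d, by simp only [ENNReal.coe_mul, mul_assoc]⟩)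
    (by
      intro n x hx
      choose c hc using hx
      simp only [hc, ← Finset.sum_mul, ← ENNReal.ofNNReal_finsetSum]
      rw [X.gauge.const_mul_eq])
  refine ⟨w, hw, hwfin, iSup₂_le fun F' hF' => ?_, ?_⟩
  · refine (hw1 F' hF'.1).trans ?_
    simpa using hF'.2
  · simpa using hw2 (_, _) ⟨1, rfl⟩

-- The dual is saturated because a function `G` norming the indicator of `B` cannot vanish almost
-- everywhere on `B`: some set `{1 ≤ k G}` meets `B` in positive measure, and there the indicator is
-- dominated by `k G`.
omit hr hr' in
theorem exhausts_dual [SigmaFinite μ] (hoc : X.gauge.IsOrderContinuous) :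
    (X.gauge.dual X.exhausts_gauge).Exhausts := by
  set γ' := X.gauge.dual X.exhausts_gauge
  -- Measurability is built into the exhausted property because subadditivity of the dual gauge,
  -- needed for unions, is only available for measurable functions.
  suffices h : ∃ B : ℕ → Set Ω, (∀ n, MeasurableSet (B n)) ∧ Monotone B ∧
      (∀ᵐ ω ∂μ, ∃ n, ω ∈ B n) ∧ ∀ n, MeasurableSet (B n) ∧ γ' ((B n).indicator 1) ≠ ∞ by
    obtain ⟨B, h1, h2, h3, h4⟩ := h
    exact ⟨B, h1, h2, h3, fun n => (h4 n).2⟩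
  refine exists_exhaustion (fun B => MeasurableSet B ∧ γ' (B.indicator 1) ≠ ∞) ?_ ?_ ?_
  · refine ⟨MeasurableSet.empty, ?_⟩
    rw [Set.indicator_empty, γ'.zero]
    exact ENNReal.zero_ne_top
  · rintro A B ⟨hAm, hA⟩ ⟨hBm, hB⟩
    have hadd := (X.gauge.isSubadditive_dual X.exhausts_gauge).add_le
      (measurable_one.indicator hAm : Measurable (A.indicator (1 : Ω → ℝ≥0∞)))
      (measurable_one.indicator hBm : Measurable (B.indicator (1 : Ω → ℝ≥0∞)))
    refine ⟨hAm.union hBm, ne_top_of_le_ne_top ?_ ((γ'.mono_of_le fun ω => ?_).trans hadd)⟩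
    · exact ENNReal.mul_ne_top ENNReal.coe_ne_top (ENNReal.add_ne_top.2 ⟨hA, hB⟩)
    · by_cases h1 : ω ∈ A <;> by_cases h2 : ω ∈ B <;> simp [h1, h2]
  · intro A hA hμA
    obtain ⟨B, hB, hBA, hμB, hBfin⟩ := X.saturated A hA hμA
    rw [← X.gauge_indicator hB] at hBfin
    have hBm : Measurable (B.indicator (1 : Ω → ℝ≥0∞)) := measurable_one.indicator hB
    obtain ⟨G, hG, -, hG1, hG2⟩ := exists_dual_norming hoc hBm hBfin.ne
    have hne : X.gauge (B.indicator 1) ≠ 0 := by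
      intro h0
      apply hμB
      rw [measure_eq_zero_iff_ae_notMem]
      filter_upwards [X.ae_eq_zero_of_gauge hBm h0] with ω hω hωB
      simp [hωB] at hω
    by_contra hcon
    push Not at hcon
    let C : ℕ → Set Ω := fun k => B ∩ {ω | 1 ≤ ((k : ℝ≥0) : ℝ≥0∞) * G ω}
    have hC : ∀ k, MeasurableSet (C k) := fun k =>
      hB.inter (measurableSet_le measurable_const (hG.const_mul _))
    have hCfin : ∀ k, γ' ((C k).indicator 1) ≠ ∞ := by
      intro k
      refine ne_top_of_le_ne_top (γ'.const_mul_ne_top (ENNReal.coe_ne_top (r := (k : ℝ≥0)))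
        (ne_top_of_le_ne_top ENNReal.one_ne_top hG1)) (γ'.mono_of_le fun ω => ?_)
      by_cases hω : ω ∈ C k
      · simpa [hω] using hω.2
      · simp [hω]
    have hC0 : ∀ k, μ (C k) = 0 := by
      intro k
      by_contra h0
      exact hCfin k (hcon (C k) (Set.inter_subset_left.trans hBA) (hC k) h0 (hC k))
    apply hne
    refine le_antisymm (hG2.trans (le_of_eq ?_)) zero_le
    refine (lintegral_eq_zero_iff (hBm.mul hG)).2 ?_
    filter_upwards [ae_all_iff.2 fun k => measure_eq_zero_iff_ae_notMem.1 (hC0 k)] with ω hω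
    by_cases hωB : ω ∈ B
    · by_contra h0
      simp only [Pi.zero_apply] at h0
      obtain ⟨k, hk⟩ := ENNReal.exists_nat_mul_gt h0 ENNReal.one_ne_top
      exact hω k ⟨hωB, by simpa [hωB] using hk.le⟩
    · simp [hωB]

end BanachFunctionSpace

end RegularOperators

/-! ### Direct sums of gauges, and the factorization weights for `r = 1`. -/

namespace RegularOperators

variable {Ω Ω' : Type*} [MeasurableSpace Ω] [MeasurableSpace Ω'] {μ : Measure Ω} {ν : Measure Ω'}

theorem measurableEmbedding_inl : MeasurableEmbedding (Sum.inl : Ω → Ω ⊕ Ω') :=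
  ⟨Sum.inl_injective, measurable_inl, @fun _ hs => measurableSet_inl_image.2 hs⟩

theorem measurableEmbedding_inr : MeasurableEmbedding (Sum.inr : Ω' → Ω ⊕ Ω') :=
  ⟨Sum.inr_injective, measurable_inr, @fun _ hs => measurableSet_inr_image.2 hs⟩

variable (μ ν) in
/-- The disjoint sum of two measures. -/
noncomputable def sumMeasure : Measure (Ω ⊕ Ω') := μ.map Sum.inl + ν.map Sum.inr

theorem ae_sumMeasure_iff {p : Ω ⊕ Ω' → Prop} : (∀ᵐ z ∂sumMeasure μ ν, p z) ↔
    (∀ᵐ ω ∂μ, p (Sum.inl ω)) ∧ ∀ᵐ ω ∂ν, p (Sum.inr ω) := by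
  rw [sumMeasure, ae_add_measure_iff, measurableEmbedding_inl.ae_map_iff,
    measurableEmbedding_inr.ae_map_iff]

theorem lintegral_sumMeasure (F : Ω ⊕ Ω' → ℝ≥0∞) : ∫⁻ z, F z ∂sumMeasure μ ν =
    ∫⁻ ω, F (Sum.inl ω) ∂μ + ∫⁻ ω, F (Sum.inr ω) ∂ν := by
  rw [sumMeasure, lintegral_add_measure, measurableEmbedding_inl.lintegral_map,
    measurableEmbedding_inr.lintegral_map]

instance [SigmaFinite μ] [SigmaFinite ν] : SigmaFinite (sumMeasure μ ν) := by
  have := measurableEmbedding_inl (Ω' := Ω').sigmaFinite_map (μ := μ)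
  have := measurableEmbedding_inr (Ω := Ω).sigmaFinite_map (μ := ν)
  unfold sumMeasure
  infer_instance

namespace FunctionGauge

/-- The direct sum of two gauges. -/
noncomputable def sum (γ : FunctionGauge μ) (δ : FunctionGauge ν) :
    FunctionGauge (sumMeasure μ ν) where
  toFun F := γ (fun ω => F (Sum.inl ω)) + δ (fun ω => F (Sum.inr ω))
  mono {f g} h := by
    have h' := ae_sumMeasure_iff.1 h
    exact add_le_add (γ.mono h'.1) (δ.mono h'.2)
  smul_le c f := by
    rw [mul_add]
    exact add_le_add (γ.smul_le c _) (δ.smul_le c _)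
  ae_lt_top {f} hf h := by
    rw [ENNReal.add_ne_top] at h
    exact ae_sumMeasure_iff.2 ⟨γ.ae_lt_top (hf.comp measurable_inl) h.1,
      δ.ae_lt_top (hf.comp measurable_inr) h.2⟩

variable {γ : FunctionGauge μ} {δ : FunctionGauge ν}

theorem sum_elim (γ : FunctionGauge μ) (δ : FunctionGauge ν) (F : Ω → ℝ≥0∞) (G : Ω' → ℝ≥0∞) :
    γ.sum δ (Sum.elim F G) = γ F + δ G := rfl

theorem sum_apply (γ : FunctionGauge μ) (δ : FunctionGauge ν) (F : Ω ⊕ Ω' → ℝ≥0∞) :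
    γ.sum δ F = γ (fun ω => F (Sum.inl ω)) + δ (fun ω => F (Sum.inr ω)) := rfl

theorem IsSubadditive.sum {M N : ℝ≥0} (h : γ.IsSubadditive M) (h' : δ.IsSubadditive N) :
    (γ.sum δ).IsSubadditive (M + N) := by
  intro n F hF
  simp_rw [sum_apply]
  rw [Finset.sum_add_distrib, mul_add]
  refine add_le_add ((h n (fun i ω => F i (Sum.inl ω)) fun i => (hF i).comp measurable_inl).trans ?_)
    ((h' n (fun i ω => F i (Sum.inr ω)) fun i => (hF i).comp measurable_inr).trans ?_)
  · gcongr
    simp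
  · gcongr
    simp

theorem IsOrderContinuous.sum (h : γ.IsOrderContinuous) (h' : δ.IsOrderContinuous) :
    (γ.sum δ).IsOrderContinuous := by
  intro f hf hanti hinf h0
  rw [sum_apply, ENNReal.add_ne_top] at h0
  have hinf' := ae_sumMeasure_iff.1 hinf
  have h1 := h (fun n ω => f n (Sum.inl ω)) (fun n => (hf n).comp measurable_inl)
    (fun m n hmn ω => hanti hmn _) hinf'.1 h0.1
  have h2 := h' (fun n ω => f n (Sum.inr ω)) (fun n => (hf n).comp measurable_inr)
    (fun m n hmn ω => hanti hmn _) hinf'.2 h0.2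
  simp_rw [sum_apply]
  rw [← ENNReal.iInf_add_iInf, h1, h2, add_zero]
  intro i j
  refine ⟨max i j, add_le_add (γ.mono_of_le fun ω => hanti (le_max_left i j) _)
    (δ.mono_of_le fun ω => hanti (le_max_right i j) _)⟩

theorem Exhausts.sum (h : γ.Exhausts) (h' : δ.Exhausts) : (γ.sum δ).Exhausts := by
  obtain ⟨B, h1, h2, h3, h4⟩ := h
  obtain ⟨B', h1', h2', h3', h4'⟩ := h'
  refine ⟨fun n => Sum.inl '' B n ∪ Sum.inr '' B' n, fun n =>
    (measurableSet_inl_image.2 (h1 n)).union (measurableSet_inr_image.2 (h1' n)),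
    fun m n hmn => Set.union_subset_union (Set.image_mono (h2 hmn)) (Set.image_mono (h2' hmn)),
    ae_sumMeasure_iff.2 ⟨?_, ?_⟩, fun n => ?_⟩
  · filter_upwards [h3] with ω hω
    simpa using hω
  · filter_upwards [h3'] with ω hω
    simpa using hω
  · rw [sum_apply, ENNReal.add_ne_top]
    constructor
    · convert h4 n using 3 with ω
      by_cases hω : ω ∈ B n <;> simp [hω]
    · convert h4' n using 3 with ω
      by_cases hω : ω ∈ B' n <;> simp [hω]

end FunctionGauge

namespace BanachFunctionSpace

variable {X : BanachFunctionSpace μ} {Y : BanachFunctionSpace ν} {r r' : ℝ≥0∞}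

/-- A form of the Levi property in which only minorants already known to lie in `X` must be bounded:
the truncations of `F` to `B n ∩ {F ≤ n}` have finite gauge and increase to `F` almost everywhere.
-/
theorem gauge_ne_top_of_bounded_truncations [SigmaFinite μ] (hr : 1 ≤ r) (hr' : r ≠ ∞) {M : ℝ≥0}
    (h : X.gauge.IsConcave r M) {F : Ω → ℝ≥0∞} (hF : Measurable F) (hFfin : ∀ᵐ ω ∂μ, F ω < ∞)
    {C : ℝ≥0∞} (hC : C ≠ ∞) (hle : ∀ F', Measurable F' → (∀ ω, F' ω ≤ F ω) →
      X.gauge F' ≠ ∞ → X.gauge F' ≤ C) : X.gauge F ≠ ∞ := by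
  obtain ⟨B, hBm, hBmono, hBae, hBfin⟩ := X.exhausts_gauge
  let A : ℕ → Set Ω := fun n => B n ∩ {ω | F ω ≤ n}
  have hA : ∀ n, MeasurableSet (A n) := fun n => (hBm n).inter (measurableSet_le hF measurable_const)
  have hAmono : Monotone A := fun m n hmn => Set.inter_subset_inter (hBmono hmn)
    fun ω (hω : F ω ≤ m) => hω.trans (by exact_mod_cast hmn)
  have hFn : ∀ n, Measurable ((A n).indicator F) := fun n => hF.indicator (hA n)
  have hfin : ∀ n, X.gauge ((A n).indicator F) ≠ ∞ := by
    intro n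
    refine ne_top_of_le_ne_top (X.gauge.const_mul_ne_top (ENNReal.natCast_ne_top n) (hBfin n))
      (X.gauge.mono_of_le fun ω => ?_)
    by_cases hω : ω ∈ A n
    · simpa [hω, hω.1] using hω.2
    · simp [hω]
  have hsup := gauge_iSup_ne_top hr hr' h hFn
    (fun m n hmn ω => Set.indicator_le_indicator_of_subset (hAmono hmn) (fun _ => zero_le) ω) hC
    fun n => hle _ (hFn n) (fun ω => Set.indicator_le_self _ _ ω) (hfin n)
  refine ne_top_of_le_ne_top hsup (X.gauge.mono ?_)
  filter_upwards [hFfin, hBae] with ω h1 ⟨m, hm⟩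
  obtain ⟨n, hn⟩ := ENNReal.exists_nat_gt h1.ne
  refine le_trans ?_ (le_iSup _ (max m n))
  rw [Set.indicator_of_mem]
  exact ⟨hBmono (le_max_left m n) hm, hn.le.trans (by exact_mod_cast le_max_right m n)⟩

/-- The weights in the factorization theorem: `f` maps `X` into `L_r`, `g` maps `L_r` into `Y`, and
the pairs in the given family satisfy `‖x.2 / g‖_r ≤ C ‖f x.1‖_r`. -/
def HasFactorWeights (X : BanachFunctionSpace μ) (Y : BanachFunctionSpace ν) (t : ℝ)
    (P : Set ((Ω → ℝ≥0∞) × (Ω' → ℝ≥0∞))) : Prop :=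
  ∃ (f : Ω → ℝ≥0∞) (g : Ω' → ℝ≥0∞) (C : ℝ≥0), Measurable f ∧ Measurable g ∧
    (∀ᵐ ω ∂μ, f ω < ∞) ∧ (∀ᵐ ω ∂ν, g ω < ∞) ∧
    (∀ F, Measurable F → X.gauge F ≠ ∞ → ∫⁻ ω, (f ω * F ω) ^ t ∂μ ≠ ∞) ∧
    (∀ H, Measurable H → ∫⁻ ω, H ω ^ t ∂ν ≠ ∞ → Y.gauge (fun ω => g ω * H ω) ≠ ∞) ∧
    ∀ x ∈ P, (∀ᵐ ω ∂ν, g ω = 0 → x.2 ω = 0) ∧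
      ∫⁻ ω, (x.2 ω / g ω) ^ t ∂ν ≤ C * ∫⁻ ω, (f ω * x.1 ω) ^ t ∂μ

/-- For `r = 1`, `1`-concavity makes the norm of `Y` equivalent to `∫ · w`, and `g = 1 / w`. A
second weight `f` on `X` then comes from `∑ ‖v_i‖ ≤ M ‖∑ v_i‖ ≤ M K ‖∑ u_i‖` over the pairs `(u_i,
v_i)` in `P`. -/
theorem hasFactorWeights_one [SigmaFinite μ] [SigmaFinite ν] {M : ℝ≥0}
    (hY : Y.gauge.IsConcave 1 M) (hXc : X.gauge.IsOrderContinuous)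
    {P : Set ((Ω → ℝ≥0∞) × (Ω' → ℝ≥0∞))} (hPm : ∀ x ∈ P, Measurable x.1 ∧ Measurable x.2)
    (hPfin : ∀ x ∈ P, X.gauge x.1 ≠ ∞ ∧ Y.gauge x.2 ≠ ∞)
    (hPscale : ∀ c : ℝ≥0, c ≠ 0 → ∀ x ∈ P, ((fun ω => c * x.1 ω), (fun ω => c * x.2 ω)) ∈ P)
    {K : ℝ≥0} (hK : ∀ (n : ℕ) (x : Fin n → (Ω → ℝ≥0∞) × (Ω' → ℝ≥0∞)), (∀ i, x i ∈ P) →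
      Y.gauge (fun ω => ellENorm 1 fun i => (x i).2 ω) ≤
        K * X.gauge (fun ω => ellENorm 1 fun i => (x i).1 ω)) :
    HasFactorWeights X Y 1 P := by
  have hYc := isOrderContinuous_of_isConcave le_rfl ENNReal.one_ne_top hY
  have hY' : ∀ (n : ℕ) (F : Fin n → Ω' → ℝ≥0∞), (∀ i, Measurable (F i)) →
      (∀ i, Y.gauge (F i) ≠ ∞) → ∑ i, Y.gauge (F i) ≤ M * Y.gauge (fun ω => ∑ i, F i ω) := by
    intro n F hF hfin
    simpa only [ellENorm_one] using hY n F hF hfin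
  simp only [ellENorm_one] at hK
  have hinv : ∀ (N : ℝ≥0) (a b : ℝ≥0∞), a ≤ N * b → ((N + 1)⁻¹ : ℝ≥0) * a ≤ b := by
    intro N a b hab
    have hne : (N + 1 : ℝ≥0) ≠ 0 := by positivity
    calc (((N + 1)⁻¹ : ℝ≥0) : ℝ≥0∞) * a ≤ ((N + 1)⁻¹ : ℝ≥0) * ((N + 1 : ℝ≥0) * b) := by
          gcongr
          refine hab.trans ?_
          gcongr
          exact le_self_add
      _ = b := by
        rw [← mul_assoc, ← ENNReal.coe_mul, inv_mul_cancel₀ hne, ENNReal.coe_one, one_mul]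
  have hinv' : ∀ (N : ℝ≥0) (a b : ℝ≥0∞), ((N + 1)⁻¹ : ℝ≥0) * a ≤ b → a ≤ (N + 1 : ℝ≥0) * b := by
    intro N a b hab
    have hne : (N + 1 : ℝ≥0) ≠ 0 := by positivity
    calc a = (N + 1 : ℝ≥0) * (((N + 1)⁻¹ : ℝ≥0) * a) := by
          rw [← mul_assoc, ← ENNReal.coe_mul, mul_inv_cancel₀ hne, ENNReal.coe_one, one_mul]
      _ ≤ _ := by gcongr
  obtain ⟨w, hw, hwfin, hw1, hw2⟩ := FunctionGauge.exists_weight Y.isSubadditive_gauge hYc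
    Y.exhausts_gauge {x | ∃ F, Measurable F ∧ Y.gauge F ≠ ∞ ∧
      x = (F, ((M + 1)⁻¹ : ℝ≥0) * Y.gauge F)}
    (by rintro _ ⟨F, hF, -, rfl⟩; exact hF) (by rintro _ ⟨F, -, hF, rfl⟩; exact hF)
    (by
      rintro c - _ ⟨F, hF, hfin, rfl⟩
      refine ⟨fun ω => c * F ω, hF.const_mul _,
        Y.gauge.const_mul_ne_top ENNReal.coe_ne_top hfin, ?_⟩
      rw [Y.gauge.const_mul_eq]
      refine Prod.ext rfl ?_
      change (c : ℝ≥0∞) * (((M + 1)⁻¹ : ℝ≥0) * Y.gauge F) = _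
      ring)
    (by
      intro n x hx
      choose F hF hfin hxF using hx
      simp only [hxF, ← Finset.mul_sum]
      exact hinv M _ _ (hY' n F hF hfin))
  have hw2' : ∀ F, Measurable F → Y.gauge F ≠ ∞ →
      Y.gauge F ≤ (M + 1 : ℝ≥0) * ∫⁻ ω, F ω * w ω ∂ν := fun F hF hfin =>
    hinv' M _ _ (hw2 (F, _) ⟨F, hF, hfin, rfl⟩)
  -- The indicator of the part of `B n` where `w` vanishes has zero integral against `w`, hence zero
  -- gauge, hence is null.
  have hw0 : ∀ᵐ ω ∂ν, w ω ≠ 0 := by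
    obtain ⟨B, hBm, -, hBae, hBfin⟩ := Y.exhausts_gauge
    have hz : ∀ n, ∀ᵐ ω ∂ν, ω ∈ B n → w ω ≠ 0 := by
      intro n
      have hA : MeasurableSet (B n ∩ w ⁻¹' {0}) := (hBm n).inter (hw (measurableSet_singleton 0))
      have hm : Measurable ((B n ∩ w ⁻¹' {0}).indicator (1 : Ω' → ℝ≥0∞)) :=
        measurable_one.indicator hA
      have h0 : Y.gauge ((B n ∩ w ⁻¹' {0}).indicator 1) = 0 := by
        refine le_antisymm ((hw2' _ hm ?_).trans ?_) zero_le
        · exact ne_top_of_le_ne_top (hBfin n) (Y.gauge.mono_of_le fun ω =>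
            Set.indicator_le_indicator_of_subset Set.inter_subset_left (fun _ => zero_le) ω)
        · have : ∀ ω, (B n ∩ w ⁻¹' {0}).indicator 1 ω * w ω = 0 := by
            intro ω
            by_cases hω : ω ∈ B n ∩ w ⁻¹' {0}
            · rw [show w ω = 0 from hω.2, mul_zero]
            · simp [hω]
          simp [this]
      filter_upwards [Y.ae_eq_zero_of_gauge hm h0] with ω hω hωB hω0
      have hmem : ω ∈ B n ∩ w ⁻¹' {0} := ⟨hωB, hω0⟩
      rw [Set.indicator_of_mem hmem] at hω
      exact one_ne_zero hω
    filter_upwards [ae_all_iff.2 hz, hBae] with ω h1 ⟨n, hn⟩ using h1 n hn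
  obtain ⟨f, hf, hffin, hf1, hf2⟩ := FunctionGauge.exists_weight X.isSubadditive_gauge hXc
    X.exhausts_gauge {z | ∃ x ∈ P, z = (x.1, ((M * K + 1)⁻¹ : ℝ≥0) * Y.gauge x.2)}
    (by rintro _ ⟨x, hx, rfl⟩; exact (hPm x hx).1) (by rintro _ ⟨x, hx, rfl⟩; exact (hPfin x hx).1)
    (by
      rintro c hc _ ⟨x, hx, rfl⟩
      refine ⟨_, hPscale c hc x hx, ?_⟩
      rw [Y.gauge.const_mul_eq]
      refine Prod.ext rfl ?_
      change (c : ℝ≥0∞) * (((M * K + 1)⁻¹ : ℝ≥0) * Y.gauge x.2) = _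
      ring)
    (by
      intro n z hz
      choose x hx hzx using hz
      simp only [hzx, ← Finset.mul_sum]
      refine hinv (M * K) _ _ ((hY' n (fun i => (x i).2) (fun i => (hPm _ (hx i)).2)
        fun i => (hPfin _ (hx i)).2).trans ?_)
      rw [ENNReal.coe_mul, mul_assoc]
      gcongr
      exact hK n x hx)
  refine ⟨f, fun ω => (w ω)⁻¹, M * K + 1, hf, hw.inv, hffin, ?_, ?_, ?_, ?_⟩
  · filter_upwards [hw0] with ω hω
    exact (ENNReal.inv_ne_top.2 hω).lt_top
  · intro F hF hfin
    simp only [ENNReal.rpow_one]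
    refine ne_top_of_le_ne_top ?_ ((lintegral_congr fun ω => mul_comm _ _).trans_le (hf1 F hF))
    simpa using hfin
  · intro H hH hfin
    simp only [ENNReal.rpow_one] at hfin
    refine gauge_ne_top_of_bounded_truncations le_rfl ENNReal.one_ne_top hY (hw.inv.mul hH) ?_
      (C := (M + 1 : ℝ≥0) * ∫⁻ ω, H ω ∂ν) (ENNReal.mul_ne_top ENNReal.coe_ne_top hfin) ?_
    · filter_upwards [hw0, ae_lt_top hH hfin] with ω h1 h2
      exact ENNReal.mul_lt_top (ENNReal.inv_ne_top.2 h1).lt_top h2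
    · intro F' hF' hle hfin'
      refine (hw2' F' hF' hfin').trans ?_
      gcongr with ω
      calc F' ω * w ω ≤ (w ω)⁻¹ * H ω * w ω := by gcongr; exact hle ω
        _ = (w ω)⁻¹ * w ω * H ω := by ring
        _ ≤ 1 * H ω := by gcongr; exact ENNReal.inv_mul_le_one _
        _ = H ω := one_mul _
  · intro x hx
    constructor
    · filter_upwards [hwfin] with ω h1 h2
      exact absurd (ENNReal.inv_eq_zero.1 h2) h1.ne
    · simp only [ENNReal.rpow_one, div_eq_mul_inv, inv_inv]
      calc ∫⁻ ω, x.2 ω * w ω ∂ν ≤ Y.gauge x.2 := by simpa using hw1 x.2 (hPm x hx).2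
        _ ≤ _ := by
          refine (hinv' (M * K) _ _ (hf2 (x.1, _) ⟨x, hx, rfl⟩)).trans (le_of_eq ?_)
          congr 1
          exact lintegral_congr fun ω => mul_comm _ _

end BanachFunctionSpace

end RegularOperators

/-! ### The factorization weights for `1 < r < ∞`. -/

namespace RegularOperators

variable {Ω Ω' : Type*} [MeasurableSpace Ω] [MeasurableSpace Ω'] {μ : Measure Ω} {ν : Measure Ω'}

/-- If `κ y ≤ I + c^t' ∫ k^t` for every admissible cut-off of `k`, then `∫ k^t ≤ C I`. -/
theorem lintegral_rpow_div_le {δ : FunctionGauge ν} (hδex : δ.Exhausts) {t t' : ℝ}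
    (ht : t.HolderConjugate t') {h g : Ω' → ℝ≥0∞} (hh : Measurable h) (hg : Measurable g)
    (hhfin : ∀ᵐ ω ∂ν, h ω < ∞) (hgfin : ∀ᵐ ω ∂ν, g ω < ∞) {κ : ℝ≥0} (hκ : κ ≠ 0) {I : ℝ≥0∞}
    (hI : I ≠ ∞) (hgδ : ∀ y, Measurable y → δ y ≠ ∞ → ∫⁻ ω, (g ω * y ω) ^ t' ∂ν ≠ ∞)
    (hle : ∀ y, Measurable y → δ y ≠ ∞ →
      κ * ∫⁻ ω, h ω * y ω ∂ν ≤ I + ∫⁻ ω, (g ω * y ω) ^ t' ∂ν) :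
    (∀ᵐ ω ∂ν, g ω = 0 → h ω = 0) ∧
      ∫⁻ ω, (h ω / g ω) ^ t ∂ν ≤ (κ * ((κ / 2) ^ (t' - 1)⁻¹) / 2)⁻¹ * I := by
  obtain ⟨B, hBm, hBmono, hBae, hBfin⟩ := hδex
  have hκ' : (κ : ℝ≥0∞) ≠ 0 := by simpa using hκ
  have hzero : ∀ᵐ ω ∂ν, g ω = 0 → h ω = 0 := by
    have key : ∀ n, ∀ᵐ ω ∂ν, ω ∈ B n → g ω = 0 → h ω = 0 := by
      intro n
      let A := B n ∩ g ⁻¹' {0}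
      have hA : MeasurableSet A := (hBm n).inter (hg (measurableSet_singleton 0))
      have hAm : Measurable (A.indicator (1 : Ω' → ℝ≥0∞)) := measurable_one.indicator hA
      have hAfin : δ (A.indicator 1) ≠ ∞ := ne_top_of_le_ne_top (hBfin n) (δ.mono_of_le fun ω =>
        Set.indicator_le_indicator_of_subset Set.inter_subset_left (fun _ => zero_le) ω)
      have hAg : ∀ (c : ℝ≥0∞) ω, (g ω * (c * A.indicator 1 ω)) ^ t' = 0 := by
        intro c ω
        by_cases hω : ω ∈ A
        · rw [show g ω = 0 from hω.2, zero_mul, ENNReal.zero_rpow_of_pos ht.symm.pos]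
        · simp [hω, ht.symm.pos]
      -- Where `g = 0` the second term on the right vanishes for every multiple of the test
      -- function, so letting `m` grow forces `∫_A h = 0`.
      have h1 : ∀ m : ℕ, (m : ℝ≥0∞) * (κ * ∫⁻ ω, h ω * A.indicator 1 ω ∂ν) ≤ I := by
        intro m
        have := hle _ (hAm.const_mul (m : ℝ≥0∞))
          (δ.const_mul_ne_top (ENNReal.natCast_ne_top m) hAfin)
        simp_rw [hAg] at this
        rw [lintegral_zero, add_zero] at this
        refine le_trans (le_of_eq ?_) this
        rw [mul_left_comm, ← lintegral_const_mul' _ _ (ENNReal.natCast_ne_top m)]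
        congr 1
        exact lintegral_congr fun ω => by ring
      have h2 : ∫⁻ ω, h ω * A.indicator 1 ω ∂ν = 0 := by
        by_contra h0
        obtain ⟨m, hm⟩ := ENNReal.exists_nat_mul_gt (mul_ne_zero hκ' h0) hI
        exact hm.not_ge (h1 m)
      filter_upwards [(lintegral_eq_zero_iff (hh.mul hAm)).1 h2] with ω hω hωB hω0
      have hmem : ω ∈ A := ⟨hωB, hω0⟩
      simpa [hmem] using hω
    filter_upwards [ae_all_iff.2 key, hBae] with ω h1 ⟨n, hn⟩ using h1 n hn
  refine ⟨hzero, ?_⟩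
  set k : Ω' → ℝ≥0∞ := fun ω => h ω / g ω with hk
  have hkm : Measurable k := hh.div hg
  -- On `A n` both `k` and `1 / g` are at most `n`, so the test function supported there has finite
  -- gauge.
  let A : ℕ → Set Ω' := fun n => B n ∩ {ω | k ω ≤ n ∧ 1 ≤ (n : ℝ≥0∞) * g ω}
  have hA : ∀ n, MeasurableSet (A n) := fun n => (hBm n).inter
    ((measurableSet_le hkm measurable_const).inter
      (measurableSet_le measurable_const (hg.const_mul _)))
  have hAmono : Monotone A := by
    intro m n hmn
    have hmn' : (m : ℝ≥0∞) ≤ n := by exact_mod_cast hmn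
    refine Set.inter_subset_inter (hBmono hmn) fun ω hω => ⟨hω.1.trans hmn', hω.2.trans ?_⟩
    gcongr
  -- The solution of `c^t' = κ c / 2`. For `y = c k^(t-1) / g` on `A n` the hypothesis reads `κ c J
  -- ≤ I + (κ c / 2) J`, using `(t-1) t' = t`, and half of the left side absorbs the last term.
  set c : ℝ≥0 := (κ / 2) ^ (t' - 1)⁻¹ with hc
  have ht1 := ht.symm.sub_one_pos
  have hc0 : c ≠ 0 := by
    rw [hc]
    exact (NNReal.rpow_pos (by positivity)).ne'
  have hcpow : (c : ℝ≥0∞) ^ t' = (κ * c / 2 : ℝ≥0) := by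
    rw [← ENNReal.coe_rpow_of_nonneg _ ht.symm.nonneg]
    congr 1
    have h1 : c ^ t' = c ^ (t' - 1) * c := by
      conv_lhs => rw [show t' = (t' - 1) + 1 by ring, NNReal.rpow_add hc0, NNReal.rpow_one]
    rw [h1, hc, ← NNReal.rpow_mul, inv_mul_cancel₀ ht1.ne', NNReal.rpow_one]
    ring
  have hbound : ∀ n, ∫⁻ ω, (A n).indicator (fun ω => k ω ^ t) ω ∂ν ≤
      ((κ * c / 2 : ℝ≥0)⁻¹ : ℝ≥0) * I := by
    intro n
    set J := ∫⁻ ω, (A n).indicator (fun ω => k ω ^ t) ω ∂ν with hJ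
    let y : Ω' → ℝ≥0∞ := (A n).indicator fun ω => c * (k ω ^ (t - 1) / g ω)
    have hy : Measurable y :=
      (((hkm.pow_const _).div hg).const_mul _).indicator (hA n)
    have hyfin : δ y ≠ ∞ := by
      have hfin : (c : ℝ≥0∞) * ((n : ℝ≥0∞) ^ (t - 1) * n) ≠ ∞ :=
        ENNReal.mul_ne_top ENNReal.coe_ne_top (ENNReal.mul_ne_top
          (ENNReal.rpow_ne_top_of_nonneg ht.sub_one_pos.le (ENNReal.natCast_ne_top n))
          (ENNReal.natCast_ne_top n))
      refine ne_top_of_le_ne_top (δ.const_mul_ne_top hfin (hBfin n)) (δ.mono_of_le fun ω => ?_)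
      by_cases hω : ω ∈ A n
      · simp only [y, Set.indicator_of_mem hω, Set.indicator_of_mem hω.1, Pi.one_apply, mul_one]
        gcongr
        rw [div_eq_mul_inv]
        refine mul_le_mul' (ENNReal.rpow_le_rpow hω.2.1 ht.sub_one_pos.le) ?_
        refine (ENNReal.inv_le_iff_le_mul (fun h => absurd h (ENNReal.natCast_ne_top n))
          (fun _ h0 => ?_)).2 (by rw [mul_comm]; exact hω.2.2)
        have := hω.2.2
        simp [h0] at this
      · simp [y, hω]
    have h1 : ∫⁻ ω, h ω * y ω ∂ν = c * J := by
      rw [hJ, ← lintegral_const_mul' _ _ ENNReal.coe_ne_top]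
      refine lintegral_congr fun ω => ?_
      by_cases hω : ω ∈ A n
      · simp only [y, Set.indicator_of_mem hω]
        have : k ω ^ t = k ω * k ω ^ (t - 1) := by
          have := ENNReal.rpow_add_of_nonneg (x := k ω) 1 (t - 1) zero_le_one ht.sub_one_pos.le
          rw [ENNReal.rpow_one] at this
          rw [← this]
          congr 1
          ring
        rw [this, hk]
        simp only [div_eq_mul_inv]
        ring
      · simp [y, hω]
    have h2 : ∫⁻ ω, (g ω * y ω) ^ t' ∂ν ≤ (κ * c / 2 : ℝ≥0) * J := by
      rw [← hcpow, hJ, ← lintegral_const_mul' _ _ (by rw [hcpow]; exact ENNReal.coe_ne_top)]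
      refine lintegral_mono fun ω => ?_
      by_cases hω : ω ∈ A n
      · simp only [y, Set.indicator_of_mem hω]
        calc (g ω * (c * (k ω ^ (t - 1) / g ω))) ^ t'
            = (c * (g ω * (k ω ^ (t - 1) / g ω))) ^ t' := by rw [mul_left_comm]
          _ ≤ (c * k ω ^ (t - 1)) ^ t' := by
            refine ENNReal.rpow_le_rpow ?_ ht.symm.nonneg
            gcongr
            exact ENNReal.mul_div_le
          _ = _ := by
            rw [ENNReal.mul_rpow_of_nonneg _ _ ht.symm.nonneg, ← ENNReal.rpow_mul,
              ht.sub_one_mul_conj]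
      · simp [y, hω, ht.symm.pos]
    have h3 := hle y hy hyfin
    rw [h1] at h3
    -- Absorption needs `J` finite. An infinite `J` would make the left side infinite, while `I` and
    -- `∫ (g y)^t'` are finite.
    have hJfin : J ≠ ∞ := by
      intro hJt
      rw [hJt, ENNReal.mul_top (by simpa using hc0), ENNReal.mul_top hκ', top_le_iff] at h3
      exact ENNReal.add_ne_top.2 ⟨hI, hgδ y hy hyfin⟩ h3
    set e : ℝ≥0 := κ * c / 2 with he
    have he0 : e ≠ 0 := by
      have : 0 < κ := pos_iff_ne_zero.2 hκ
      have : 0 < c := pos_iff_ne_zero.2 hc0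
      positivity
    have hee : (κ : ℝ≥0∞) * (c * J) = e * J + e * J := by
      rw [← add_mul, ← mul_assoc, ← ENNReal.coe_mul, ← ENNReal.coe_add, he, add_halves]
    have h4 : e * J + e * J ≤ I + e * J := hee ▸ h3.trans (add_le_add le_rfl h2)
    rw [ENNReal.add_le_add_iff_right (ENNReal.mul_ne_top ENNReal.coe_ne_top hJfin)] at h4
    calc J = ((e⁻¹ : ℝ≥0) : ℝ≥0∞) * (e * J) := by
          rw [← mul_assoc, ← ENNReal.coe_mul, inv_mul_cancel₀ he0, ENNReal.coe_one, one_mul]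
      _ ≤ _ := by gcongr
  have hsup : ∫⁻ ω, k ω ^ t ∂ν = ⨆ n, ∫⁻ ω, (A n).indicator (fun ω => k ω ^ t) ω ∂ν := by
    rw [← lintegral_iSup (fun n => (hkm.pow_const t).indicator (hA n))
      (fun m n hmn ω => Set.indicator_le_indicator_of_subset (hAmono hmn) (fun _ => zero_le) ω)]
    refine lintegral_congr_ae ?_
    filter_upwards [hzero, hhfin, hgfin, hBae] with ω h0 h1 h2 ⟨m, hm⟩
    refine le_antisymm ?_ (iSup_le fun n => Set.indicator_le_self _ _ ω)
    by_cases hg0 : g ω = 0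
    · simp [hk, h0 hg0, ht.pos]
    have hkfin : k ω ≠ ∞ := ENNReal.div_ne_top h1.ne hg0
    obtain ⟨n₁, hn₁⟩ := ENNReal.exists_nat_gt hkfin
    obtain ⟨n₂, hn₂⟩ := ENNReal.exists_nat_mul_gt hg0 ENNReal.one_ne_top
    refine le_trans ?_ (le_iSup _ (max m (max n₁ n₂)))
    rw [Set.indicator_of_mem]
    refine ⟨hBmono (le_max_left _ _) hm, hn₁.le.trans ?_, hn₂.le.trans ?_⟩
    · exact_mod_cast (le_max_left n₁ n₂).trans (le_max_right _ _)
    · gcongr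
      exact (le_max_right n₁ n₂).trans (le_max_right _ _)
  rw [hsup]
  refine iSup_le fun n => (hbound n).trans (le_of_eq ?_)
  congr 1

namespace BanachFunctionSpace

variable {X : BanachFunctionSpace μ} {Y : BanachFunctionSpace ν} {r r' : ℝ≥0∞}

/-- A single weight on the disjoint union of the two measure spaces, for the sum of the
concavifications of `X` and `Y'`, yields `f` and `g` together. Young's inequality converts the
product bound supplied by `hK` into the additive bound that Hahn–Banach requires. -/
theorem hasFactorWeights_of_one_lt [SigmaFinite μ] [SigmaFinite ν] (hrt : r ≠ ∞) (hrt' : r' ≠ ∞)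
    (hr : r.HolderConjugate r')
    (ht : r.toReal.HolderConjugate r'.toReal) {MX MY : ℝ≥0} (hX : X.gauge.IsConvex r MX)
    (hY : Y.gauge.IsConcave r MY) (hXc : X.gauge.IsOrderContinuous)
    (hYc : (Y.gauge.dual Y.exhausts_gauge).IsOrderContinuous)
    {P : Set ((Ω → ℝ≥0∞) × (Ω' → ℝ≥0∞))} (hPm : ∀ x ∈ P, Measurable x.1 ∧ Measurable x.2)
    (hPfin : ∀ x ∈ P, X.gauge x.1 ≠ ∞ ∧ Y.gauge x.2 ≠ ∞)
    (hPscale : ∀ c : ℝ≥0, c ≠ 0 → ∀ x ∈ P, ((fun ω => c * x.1 ω), (fun ω => c * x.2 ω)) ∈ P)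
    {K : ℝ≥0} (hK : ∀ (n : ℕ) (x : Fin n → (Ω → ℝ≥0∞) × (Ω' → ℝ≥0∞)), (∀ i, x i ∈ P) →
      Y.gauge (fun ω => ellENorm r fun i => (x i).2 ω) ≤
        K * X.gauge (fun ω => ellENorm r fun i => (x i).1 ω)) :
    HasFactorWeights X Y r.toReal P := by
  have hr1 : 1 ≤ r := one_le_of_holderConjugate hr
  have hr0 : 0 < r := zero_lt_one.trans_le hr1
  have hr0' : 0 < r' := zero_lt_one.trans_le (one_le_of_holderConjugate hr.symm)
  set δ := Y.gauge.dual Y.exhausts_gauge with hδdef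
  have hδex : δ.Exhausts := exhausts_dual (isOrderContinuous_of_isConcave hr1 hrt hY)
  have hδconv : δ.IsConvex r' MY := hY.dual Y.exhausts_gauge hr
  have hδsub : δ.IsSubadditive 1 := Y.gauge.isSubadditive_dual _
  set t := r.toReal
  set t' := r'.toReal
  set κ : ℝ≥0 := (K + 1)⁻¹ with hκdef
  have hκ : κ ≠ 0 := by positivity
  have hκK : (κ : ℝ≥0∞) * K ≤ 1 := by
    rw [← ENNReal.coe_mul, ← ENNReal.coe_one, ENNReal.coe_le_coe, hκdef]
    calc (K + 1)⁻¹ * K ≤ (K + 1)⁻¹ * (K + 1) := by gcongr; exact le_self_add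
      _ = 1 := inv_mul_cancel₀ (by positivity)
  let U : Set ((Ω ⊕ Ω' → ℝ≥0∞) × ℝ≥0∞) := {z | ∃ x ∈ P, ∃ y : Ω' → ℝ≥0∞, Measurable y ∧ δ y ≠ ∞ ∧
    z = (Sum.elim (fun ω => x.1 ω ^ t) (fun ω => y ω ^ t'), κ * ∫⁻ ω, x.2 ω * y ω ∂ν)}
  obtain ⟨w, hw, hwfin, hw1, hw2⟩ := FunctionGauge.exists_weight
    (γ := (X.gauge.pow t ht.pos).sum (δ.pow t' ht.symm.pos))
    ((hX.isSubadditive_pow ht.pos).sum (hδconv.isSubadditive_pow ht.symm.pos))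
    ((hXc.pow ht.pos).sum (hYc.pow ht.symm.pos))
    ((X.exhausts_gauge.pow ht.pos).sum (hδex.pow ht.symm.pos)) U
    (by
      rintro _ ⟨x, hx, y, hy, -, rfl⟩
      exact ((hPm x hx).1.pow_const _).sumElim (hy.pow_const _))
    (by
      rintro _ ⟨x, hx, y, hy, hyfin, rfl⟩
      rw [FunctionGauge.sum_elim, FunctionGauge.pow_rpow, FunctionGauge.pow_rpow]
      exact ENNReal.add_ne_top.2 ⟨ENNReal.rpow_ne_top_of_nonneg ht.nonneg (hPfin x hx).1,
        ENNReal.rpow_ne_top_of_nonneg ht.symm.nonneg hyfin⟩)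
    (by
      rintro c hc _ ⟨x, hx, y, hy, hyfin, rfl⟩
      -- Scaling a triple by `c` means scaling `x` by `c^(1/t)` and `y` by `c^(1/t')`; the pairing
      -- scales by `c` because `1/t + 1/t' = 1`.
      have hct : c ^ t⁻¹ ≠ 0 := (NNReal.rpow_pos (pos_iff_ne_zero.2 hc)).ne'
      have hpow : ∀ s : ℝ, 0 < s → (((c ^ s⁻¹ : ℝ≥0) : ℝ≥0∞)) ^ s = c := fun s hs => by
        rw [ENNReal.coe_rpow_of_nonneg _ (inv_pos.2 hs).le, ENNReal.rpow_inv_rpow hs.ne']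
      have hmul : ((c ^ t⁻¹ : ℝ≥0) : ℝ≥0∞) * (c ^ t'⁻¹ : ℝ≥0) = c := by
        rw [← ENNReal.coe_mul, ← NNReal.rpow_add hc, ht.inv_add_inv_eq_one, NNReal.rpow_one]
      refine ⟨_, hPscale _ hct x hx, fun ω => (c ^ t'⁻¹ : ℝ≥0) * y ω, hy.const_mul _,
        δ.const_mul_ne_top ENNReal.coe_ne_top hyfin, Prod.ext ?_ ?_⟩
      · funext z
        rcases z with ω | ω
        · simp [ENNReal.mul_rpow_of_nonneg _ _ ht.nonneg, hpow t ht.pos]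
        · simp [ENNReal.mul_rpow_of_nonneg _ _ ht.symm.nonneg, hpow t' ht.symm.pos]
      · change (c : ℝ≥0∞) * (κ * _) = κ * _
        rw [mul_left_comm, ← lintegral_const_mul' _ _ ENNReal.coe_ne_top]
        congr 1
        refine lintegral_congr fun ω => ?_
        calc (c : ℝ≥0∞) * (x.2 ω * y ω)
            = (((c ^ t⁻¹ : ℝ≥0) : ℝ≥0∞) * (c ^ t'⁻¹ : ℝ≥0)) * (x.2 ω * y ω) := by rw [hmul]
          _ = _ := by ring)
    (by
      intro n z hz
      choose x hx y hy hyfin hzx using hz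
      simp only [hzx, ← Finset.mul_sum]
      have hsum : (fun p => ∑ i, Sum.elim (fun ω => (x i).1 ω ^ t) (fun ω => y i ω ^ t') p) =
          Sum.elim (fun ω => (ellENorm r fun i => (x i).1 ω) ^ t)
            (fun ω => (ellENorm r' fun i => y i ω) ^ t') := by
        funext p
        rcases p with ω | ω
        · simp only [Sum.elim_inl]
          exact (ellENorm_rpow hr0 hrt _).symm
        · simp only [Sum.elim_inr]
          exact (ellENorm_rpow hr0' hrt' _).symm
      rw [hsum, FunctionGauge.sum_elim, FunctionGauge.pow_rpow, FunctionGauge.pow_rpow]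
      have hh : ∀ i, Measurable (x i).2 := fun i => (hPm _ (hx i)).2
      have hhE := measurable_ellENorm (p := r) hh
      set a := X.gauge fun ω => ellENorm r fun i => (x i).1 ω
      set b := δ fun ω => ellENorm r' fun i => y i ω
      have hbfin : b ≠ ∞ := hδsub.gauge_ellENorm_ne_top hr0' hy hyfin
      have hhfin := Y.isSubadditive_gauge.gauge_ellENorm_ne_top hr0 hh fun i => (hPfin _ (hx i)).2
      calc (κ : ℝ≥0∞) * ∑ i, ∫⁻ ω, (x i).2 ω * y i ω ∂ν
          = κ * ∫⁻ ω, ∑ i, (x i).2 ω * y i ω ∂ν := by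
            rw [lintegral_finsetSum (f := fun i ω => (x i).2 ω * y i ω) _
              fun i _ => (hh i).mul (hy i)]
        _ ≤ κ * ∫⁻ ω, (ellENorm r fun i => (x i).2 ω) * (ellENorm r' fun i => y i ω) ∂ν := by
            gcongr with ω
            exact sum_mul_le_ellENorm_mul hr _ _
        _ ≤ κ * (Y.gauge (fun ω => ellENorm r fun i => (x i).2 ω) * b) := by
            gcongr
            exact Y.gauge.lintegral_mul_le _ hhE hhfin hbfin
        _ ≤ κ * (K * a * b) := by
            gcongr
            exact hK n x hx
        _ = κ * K * (a * b) := by ring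
        _ ≤ 1 * (a * b) := by gcongr
        _ ≤ a ^ t / ENNReal.ofReal t + b ^ t' / ENNReal.ofReal t' := by
            rw [one_mul]
            exact ENNReal.young_inequality _ _ ht
        -- The factors `1/t` and `1/t'` from Young's inequality are at most `1` and are dropped.
        _ ≤ a ^ t + b ^ t' := by
            refine add_le_add ?_ ?_
            · refine ENNReal.div_le_of_le_mul (le_mul_of_one_le_right zero_le ?_)
              rw [← ENNReal.ofReal_one]
              exact ENNReal.ofReal_le_ofReal ht.lt.le
            · refine ENNReal.div_le_of_le_mul (le_mul_of_one_le_right zero_le ?_)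
              rw [← ENNReal.ofReal_one]
              exact ENNReal.ofReal_le_ofReal ht.symm.lt.le)
  have hwae := ae_sumMeasure_iff.1 hwfin
  set M := (MX ^ t + 1 + (MY ^ t' + 1)) with hM
  let f : Ω → ℝ≥0∞ := fun ω => w (Sum.inl ω) ^ t⁻¹
  let g : Ω' → ℝ≥0∞ := fun ω => w (Sum.inr ω) ^ t'⁻¹
  have hf : Measurable f := (hw.comp measurable_inl).pow_const _
  have hg : Measurable g := (hw.comp measurable_inr).pow_const _
  have hfpow : ∀ (F : Ω → ℝ≥0∞) ω, (f ω * F ω) ^ t = F ω ^ t * w (Sum.inl ω) := fun F ω => by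
    rw [ENNReal.mul_rpow_of_nonneg _ _ ht.nonneg, ENNReal.rpow_inv_rpow ht.ne_zero, mul_comm]
  have hgpow : ∀ (F : Ω' → ℝ≥0∞) ω, (g ω * F ω) ^ t' = F ω ^ t' * w (Sum.inr ω) := fun F ω => by
    rw [ENNReal.mul_rpow_of_nonneg _ _ ht.symm.nonneg, ENNReal.rpow_inv_rpow ht.symm.ne_zero,
      mul_comm]
  have hffin : ∀ᵐ ω ∂μ, f ω < ∞ := by
    filter_upwards [hwae.1] with ω hω
    exact (ENNReal.rpow_ne_top_of_nonneg ht.inv_nonneg hω.ne).lt_top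
  have hgfin : ∀ᵐ ω ∂ν, g ω < ∞ := by
    filter_upwards [hwae.2] with ω hω
    exact (ENNReal.rpow_ne_top_of_nonneg ht.symm.inv_nonneg hω.ne).lt_top
  have hf1 : ∀ F, Measurable F → ∫⁻ ω, (f ω * F ω) ^ t ∂μ ≤ M * X.gauge F ^ t := by
    intro F hF
    have := hw1 (Sum.elim (fun ω => F ω ^ t) fun _ => 0)
      ((hF.pow_const _).sumElim measurable_const)
    rw [lintegral_sumMeasure, FunctionGauge.sum_elim, FunctionGauge.pow_rpow,
      FunctionGauge.zero, add_zero] at this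
    simpa [hfpow] using this
  have hg1 : ∀ G, Measurable G → ∫⁻ ω, (g ω * G ω) ^ t' ∂ν ≤ M * δ G ^ t' := by
    intro G hG
    have := hw1 (Sum.elim (fun _ => 0) fun ω => G ω ^ t')
      (measurable_const.sumElim (hG.pow_const _))
    rw [lintegral_sumMeasure, FunctionGauge.sum_elim, FunctionGauge.pow_rpow,
      FunctionGauge.zero, zero_add] at this
    simpa [hgpow] using this
  have hf1' : ∀ F, Measurable F → X.gauge F ≠ ∞ → ∫⁻ ω, (f ω * F ω) ^ t ∂μ ≠ ∞ :=
    fun F hF hfin => ne_top_of_le_ne_top (ENNReal.mul_ne_top ENNReal.coe_ne_top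
      (ENNReal.rpow_ne_top_of_nonneg ht.nonneg hfin)) (hf1 F hF)
  have hg1' : ∀ G, Measurable G → δ G ≠ ∞ → ∫⁻ ω, (g ω * G ω) ^ t' ∂ν ≠ ∞ :=
    fun G hG hfin => ne_top_of_le_ne_top (ENNReal.mul_ne_top ENNReal.coe_ne_top
      (ENNReal.rpow_ne_top_of_nonneg ht.symm.nonneg hfin)) (hg1 G hG)
  refine ⟨f, g, (κ * ((κ / 2) ^ (t' - 1)⁻¹) / 2)⁻¹, hf, hg, hffin, hgfin, hf1', ?_, ?_⟩
  · intro H hH hfin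
    have hHae : ∀ᵐ ω ∂ν, H ω < ∞ := by
      filter_upwards [ae_lt_top (hH.pow_const t) hfin] with ω hω
      exact (ENNReal.rpow_lt_top_iff_of_pos ht.pos).1 hω
    refine gauge_ne_top_of_bounded_truncations hr1 hrt hY (hg.mul hH) ?_
      (C := (∫⁻ ω, H ω ^ t ∂ν) ^ (1 / t) * (M : ℝ≥0∞) ^ (1 / t'))
      (ENNReal.mul_ne_top (ENNReal.rpow_ne_top_of_nonneg ht.one_div_nonneg hfin)
        (ENNReal.rpow_ne_top_of_nonneg ht.symm.one_div_nonneg ENNReal.coe_ne_top)) ?_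
    · filter_upwards [hgfin, hHae] with ω h1 h2 using ENNReal.mul_lt_top h1 h2
    · intro F' hF' hle hfin'
      -- That `g H` lies in `Y` is seen by duality: each truncation is normed by some `G` in the
      -- unit ball of `Y'`, and Hölder applies because `g` maps `Y'` into `L_r'`.
      obtain ⟨G, hG, -, hG1, hG2⟩ := exists_dual_norming
        (isOrderContinuous_of_isConcave hr1 hrt hY) hF' hfin'
      calc Y.gauge F' ≤ ∫⁻ ω, F' ω * G ω ∂ν := hG2
        _ ≤ ∫⁻ ω, (H * fun ω => g ω * G ω) ω ∂ν := by
            refine lintegral_mono fun ω => ?_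
            calc F' ω * G ω ≤ g ω * H ω * G ω := by gcongr; exact hle ω
              _ = H ω * (g ω * G ω) := by ring
        _ ≤ (∫⁻ ω, H ω ^ t ∂ν) ^ (1 / t) * (∫⁻ ω, (g ω * G ω) ^ t' ∂ν) ^ (1 / t') :=
            ENNReal.lintegral_mul_le_Lp_mul_Lq ν ht hH.aemeasurable (hg.mul hG).aemeasurable
        _ ≤ _ := by
            refine mul_le_mul_right (ENNReal.rpow_le_rpow ((hg1 G hG).trans ?_)
              ht.symm.one_div_nonneg) _
            calc (M : ℝ≥0∞) * δ G ^ t' ≤ M * 1 := by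
                  gcongr
                  exact ENNReal.rpow_le_one hG1 ht.symm.nonneg
              _ = M := mul_one _
  · intro x hx
    have hxfin := hPfin x hx
    have hxm := hPm x hx
    have key := lintegral_rpow_div_le hδex ht hxm.2 hg (Y.gauge.ae_lt_top hxm.2 hxfin.2) hgfin
      hκ (hf1' _ hxm.1 hxfin.1) hg1' (fun y hy hyfin => by
        have := hw2 _ ⟨x, hx, y, hy, hyfin, rfl⟩
        rw [lintegral_sumMeasure] at this
        simpa [hfpow, hgpow] using this)
    refine ⟨key.1, key.2.trans (le_of_eq ?_)⟩
    congr 1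

end BanachFunctionSpace

end RegularOperators

/-! ### Duality of mixed norms: the equivalence of (i) and (ii). -/

namespace RegularOperators

variable {Ω Ω' : Type*} [MeasurableSpace Ω] [MeasurableSpace Ω'] {μ : Measure Ω} {ν : Measure Ω'}
  {p p' q r r' : ℝ≥0∞} {n m : ℕ}

/-- Hölder's inequality for mixed norms. -/
theorem sum_sum_mul_le_ellENorm_mul (hp : p.HolderConjugate p') (hr : r.HolderConjugate r')
    (a b : Fin n → Fin m → ℝ≥0∞) :
    ∑ i, ∑ j, a i j * b i j ≤
      ellENorm r (fun i => ellENorm p (a i)) * ellENorm r' (fun i => ellENorm p' (b i)) :=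
  (Finset.sum_le_sum fun i _ => sum_mul_le_ellENorm_mul hp (a i) (b i)).trans
    (sum_mul_le_ellENorm_mul hr _ _)

theorem measurable_ellENorm_ellENorm {F : Fin n → Fin m → Ω → ℝ≥0∞}
    (hF : ∀ i j, Measurable (F i j)) :
    Measurable (fun ω => ellENorm r (fun i => ellENorm q (fun j => F i j ω))) :=
  measurable_ellENorm fun i => measurable_ellENorm (hF i)

theorem lintegral_sum_sum {F : Fin n → Fin m → Ω → ℝ≥0∞} (hF : ∀ i j, Measurable (F i j)) :
    ∫⁻ ω, ∑ i, ∑ j, F i j ω ∂μ = ∑ i, ∑ j, ∫⁻ ω, F i j ω ∂μ := by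
  rw [lintegral_finsetSum _ fun i _ => Finset.measurable_fun_sum _ fun j _ => hF i j]
  exact Finset.sum_congr rfl fun i _ => lintegral_finsetSum _ fun j _ => hF i j

/-- Norming coefficients for `ℓ_r(ℓ_p)` are products: an outer coefficient for the vector of row
norms times an inner coefficient for each row. -/
theorem exists_measurable_norming_mixed (hp : p.HolderConjugate p') (hr : r.HolderConjugate r')
    (n m : ℕ) :
    ∃ b : (Fin n → Fin m → ℝ≥0∞) → Fin n → Fin m → ℝ≥0∞,
      (∀ i j, Measurable fun a => b a i j) ∧
      (∀ a, ellENorm r' (fun i => ellENorm p' (b a i)) ≤ 1) ∧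
      ∀ a, (∀ i j, a i j ≠ ∞) →
        ∑ i, ∑ j, a i j * b a i j = ellENorm r (fun i => ellENorm p (a i)) := by
  have hp0 : 0 < p := zero_lt_one.trans_le (one_le_of_holderConjugate hp)
  have hp0' : 0 < p' := zero_lt_one.trans_le (one_le_of_holderConjugate hp.symm)
  have hr0 : 0 < r := zero_lt_one.trans_le (one_le_of_holderConjugate hr)
  obtain ⟨c, hcm, hc1, hc2⟩ := exists_measurable_norming hp m
  obtain ⟨d, hdm, hd1, hd2⟩ := exists_measurable_norming hr n
  refine ⟨fun a i j => d (fun i => ellENorm p (a i)) i * c (a i) j, fun i j => ?_, fun a => ?_,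
    fun a ha => ?_⟩
  · refine Measurable.mul ((hdm i).comp (measurable_pi_lambda _ fun k => ?_))
      ((hcm j).comp (measurable_pi_apply i))
    exact measurable_ellENorm fun l => (measurable_pi_apply l).comp (measurable_pi_apply k)
  · simp_rw [ellENorm_const_mul hp0']
    refine (ellENorm_mono fun i => ?_).trans (hd1 fun i => ellENorm p (a i))
    exact (mul_le_mul_right (hc1 (a i)) _).trans_eq (mul_one _)
  · have h1 : ∀ i, ellENorm p (a i) ≠ ∞ := fun i => FunctionGauge.ellENorm_ne_top hp0 (ha i)
    rw [← hd2 _ (FunctionGauge.ellENorm_ne_top hr0 h1)]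
    refine Finset.sum_congr rfl fun i _ => ?_
    rw [← hc2 (a i) (h1 i), Finset.sum_mul]
    refine Finset.sum_congr rfl fun j _ => ?_
    rw [mul_assoc, mul_comm (c _ _)]

namespace BanachFunctionSpace

variable {X : BanachFunctionSpace μ} {Y : BanachFunctionSpace ν}

theorem gauge_space_ne_top (x : X.space) : X.gauge (fun ω => ‖(x : Ω →ₘ[μ] ℝ) ω‖ₑ) ≠ ∞ := by
  rw [X.gauge_enorm]
  exact x.2.ne

theorem norm_mixedSum (X : BanachFunctionSpace μ) (hr : 0 < r) (hq : 0 < q)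
    (x : Fin n → Fin m → Ω →ₘ[μ] ℝ) : X.norm (mixedSum r q x) =
      X.gauge fun ω => ellENorm r fun i => ellENorm q fun j => ‖x i j ω‖ₑ :=
  (X.gauge_eq_norm (enorm_mixedSum hr hq x)).symm

theorem dualNorm_mixedSum (X : BanachFunctionSpace μ) (hX : X.gauge.Exhausts) (hr : 0 < r)
    (hq : 0 < q) (x : Fin n → Fin m → Ω →ₘ[μ] ℝ) : X.dualNorm (mixedSum r q x) =
      X.gauge.dual hX fun ω => ellENorm r fun i => ellENorm q fun j => ‖x i j ω‖ₑ := by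
  rw [← X.dual_gauge_enorm hX, (X.gauge.dual hX).congr_ae (enorm_mixedSum hr hq x)]

variable [SigmaFinite ν] (hp : p.HolderConjugate p') (hq : 0 < q) (hr : r.HolderConjugate r')
include hp hr

/-- Hölder is used twice: pointwise for the mixed sequence norms, and then between `Y` and its Köthe
dual. -/
theorem sum_abs_integral_le (y : Fin n → Fin m → Y.space) (z : Fin n → Fin m → Ω' →ₘ[ν] ℝ)
    (hz : ∀ i j, Y.dualNorm (z i j) < ∞) :
    ENNReal.ofReal (∑ i, ∑ j, |∫ ω, (y i j : Ω' →ₘ[ν] ℝ) ω * z i j ω ∂ν|) ≤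
      Y.norm (mixedSum r p fun i j => (y i j : Ω' →ₘ[ν] ℝ)) * Y.dualNorm (mixedSum r' p' z) := by
  have hp0 : 0 < p := zero_lt_one.trans_le (one_le_of_holderConjugate hp)
  have hp0' : 0 < p' := zero_lt_one.trans_le (one_le_of_holderConjugate hp.symm)
  have hr0 : 0 < r := zero_lt_one.trans_le (one_le_of_holderConjugate hr)
  have hr0' : 0 < r' := zero_lt_one.trans_le (one_le_of_holderConjugate hr.symm)
  have hym : ∀ i j, Measurable fun ω => ‖(y i j : Ω' →ₘ[ν] ℝ) ω‖ₑ := fun i j =>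
    measurable_enorm_coeFn _
  have hzm : ∀ i j, Measurable fun ω => ‖z i j ω‖ₑ := fun i j => measurable_enorm_coeFn _
  have hsub := Y.gauge.isSubadditive_dual Y.exhausts_gauge
  rw [norm_mixedSum Y hr0 hp0, dualNorm_mixedSum Y Y.exhausts_gauge hr0' hp0']
  refine le_trans ?_ (Y.gauge.lintegral_mul_le Y.exhausts_gauge
    (measurable_ellENorm_ellENorm hym)
    (Y.isSubadditive_gauge.gauge_ellENorm_ne_top hr0 (fun i => measurable_ellENorm (hym i))
      fun i => Y.isSubadditive_gauge.gauge_ellENorm_ne_top hp0 (hym i) fun j =>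
        gauge_space_ne_top (y i j))
    (hsub.gauge_ellENorm_ne_top hr0' (fun i => measurable_ellENorm (hzm i))
      fun i => hsub.gauge_ellENorm_ne_top hp0' (hzm i) fun j => by
        rw [Y.dual_gauge_enorm]; exact (hz i j).ne))
  rw [ENNReal.ofReal_sum_of_nonneg fun i _ => Finset.sum_nonneg fun j _ => abs_nonneg _]
  calc ∑ i, ENNReal.ofReal (∑ j, |∫ ω, (y i j : Ω' →ₘ[ν] ℝ) ω * z i j ω ∂ν|)
      ≤ ∑ i, ∑ j, ∫⁻ ω, ‖(y i j : Ω' →ₘ[ν] ℝ) ω‖ₑ * ‖z i j ω‖ₑ ∂ν := by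
        refine Finset.sum_le_sum fun i _ => ?_
        rw [ENNReal.ofReal_sum_of_nonneg fun j _ => abs_nonneg _]
        refine Finset.sum_le_sum fun j _ => ?_
        rw [← Real.enorm_eq_ofReal_abs]
        simpa only [enorm_mul] using enorm_integral_le_lintegral_enorm (μ := ν)
          fun ω => (y i j : Ω' →ₘ[ν] ℝ) ω * z i j ω
    _ = ∫⁻ ω, ∑ i, ∑ j, ‖(y i j : Ω' →ₘ[ν] ℝ) ω‖ₑ * ‖z i j ω‖ₑ ∂ν := by
        exact (lintegral_sum_sum fun i j => (hym i j).mul (hzm i j)).symm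
    _ ≤ _ := lintegral_mono fun ω => sum_sum_mul_le_ellENorm_mul hp hr _ _

/-- One function `G` norms the mixed sum in `Y`; multiplied by the pointwise norming coefficients
and by the signs of the `y i j` it gives the entries of `z`. The signs make all integrands
nonnegative, so the absolute values lose nothing. -/
theorem exists_dual_norming_mixed (hoc : Y.gauge.IsOrderContinuous) (y : Fin n → Fin m → Y.space) :
    ∃ z : Fin n → Fin m → Ω' →ₘ[ν] ℝ, (∀ i j, Y.dualNorm (z i j) < ∞) ∧
      Y.dualNorm (mixedSum r' p' z) ≤ 1 ∧
      Y.norm (mixedSum r p fun i j => (y i j : Ω' →ₘ[ν] ℝ)) ≤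
        ENNReal.ofReal (∑ i, ∑ j, |∫ ω, (y i j : Ω' →ₘ[ν] ℝ) ω * z i j ω ∂ν|) := by
  have hp0 : 0 < p := zero_lt_one.trans_le (one_le_of_holderConjugate hp)
  have hp0' : 0 < p' := zero_lt_one.trans_le (one_le_of_holderConjugate hp.symm)
  have hr0 : 0 < r := zero_lt_one.trans_le (one_le_of_holderConjugate hr)
  have hr0' : 0 < r' := zero_lt_one.trans_le (one_le_of_holderConjugate hr.symm)
  have hyr : ∀ i j, Measurable fun ω => (y i j : Ω' →ₘ[ν] ℝ) ω := fun i j =>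
    (AEEqFun.stronglyMeasurable _).measurable
  have hym : ∀ i j, Measurable fun ω => ‖(y i j : Ω' →ₘ[ν] ℝ) ω‖ₑ := fun i j =>
    measurable_enorm_coeFn _
  obtain ⟨G, hG, hGfin, hG1, hG2⟩ := exists_dual_norming hoc
    (measurable_ellENorm_ellENorm (r := r) (q := p) hym)
    (Y.isSubadditive_gauge.gauge_ellENorm_ne_top hr0 (fun i => measurable_ellENorm (hym i))
      fun i => Y.isSubadditive_gauge.gauge_ellENorm_ne_top hp0 (hym i) fun j =>
        gauge_space_ne_top (y i j))
  obtain ⟨b, hbm, hb1, hb2⟩ := exists_measurable_norming_mixed hp hr n m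
  let a : Ω' → Fin n → Fin m → ℝ≥0∞ := fun ω i j => ‖(y i j : Ω' →ₘ[ν] ℝ) ω‖ₑ
  have ham : Measurable a := measurable_pi_lambda _ fun i => measurable_pi_lambda _ fun j => hym i j
  let H : Fin n → Fin m → Ω' → ℝ≥0∞ := fun i j ω => b (a ω) i j * G ω
  have hH : ∀ i j, Measurable (H i j) := fun i j => ((hbm i j).comp ham).mul hG
  have hble : ∀ e i j, b e i j ≤ 1 := fun e i j =>
    ((le_ellENorm hp0' (b e i) j).trans (le_ellENorm hr0' _ i)).trans (hb1 e)
  have hHG : ∀ i j ω, H i j ω ≤ G ω := fun i j ω =>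
    (mul_le_mul_left (hble (a ω) i j) _).trans_eq (one_mul _)
  have hzm : ∀ i j, Measurable fun ω =>
      (if 0 ≤ (y i j : Ω' →ₘ[ν] ℝ) ω then 1 else -1) * (H i j ω).toReal := fun i j => by
    exact (Measurable.ite (measurableSet_le measurable_const (hyr i j)) measurable_const
      measurable_const).mul (hH i j).ennreal_toReal
  let z : Fin n → Fin m → Ω' →ₘ[ν] ℝ := fun i j => AEEqFun.mk _ (hzm i j).aestronglyMeasurable
  have hz : ∀ i j, ∀ᵐ ω ∂ν, z i j ω =
      (if 0 ≤ (y i j : Ω' →ₘ[ν] ℝ) ω then 1 else -1) * (H i j ω).toReal := fun i j =>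
    AEEqFun.coeFn_mk _ (hzm i j).aestronglyMeasurable
  have hzH : ∀ i j, ∀ᵐ ω ∂ν, ‖z i j ω‖ₑ ≤ H i j ω := fun i j => by
    filter_upwards [hz i j, hGfin] with ω h1 h2
    have hs : ‖(if 0 ≤ (y i j : Ω' →ₘ[ν] ℝ) ω then 1 else -1 : ℝ)‖ₑ ≤ 1 := by
      split_ifs <;> simp
    rw [h1, enorm_mul]
    calc _ ≤ 1 * H i j ω := mul_le_mul' hs (by
          rw [Real.enorm_eq_ofReal ENNReal.toReal_nonneg]; exact ENNReal.ofReal_toReal_le)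
      _ = _ := one_mul _
  have hzfin : ∀ i j, Y.dualNorm (z i j) ≤ 1 := fun i j => by
    rw [← Y.dual_gauge_enorm Y.exhausts_gauge]
    refine le_trans (FunctionGauge.mono _ ?_) hG1
    filter_upwards [hzH i j] with ω h using h.trans (hHG i j ω)
  refine ⟨z, fun i j => (hzfin i j).trans_lt ENNReal.one_lt_top, ?_, ?_⟩
  · rw [dualNorm_mixedSum Y Y.exhausts_gauge hr0' hp0']
    refine le_trans (FunctionGauge.mono _ ?_) hG1
    filter_upwards [ae_all_iff.2 fun i => ae_all_iff.2 (hzH i)] with ω h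
    calc _ ≤ ellENorm r' (fun i => ellENorm p' fun j => G ω * b (a ω) i j) :=
          ellENorm_mono fun i => ellENorm_mono fun j => (h i j).trans_eq (mul_comm _ _)
      _ = G ω * ellENorm r' (fun i => ellENorm p' (b (a ω) i)) := by
          simp_rw [ellENorm_const_mul hp0', ellENorm_const_mul hr0']
      _ ≤ G ω := (mul_le_mul_right (hb1 _) _).trans_eq (mul_one _)
  · rw [norm_mixedSum Y hr0 hp0]
    refine hG2.trans (le_of_eq ?_)
    have hint : ∀ i j, ∫⁻ ω, a ω i j * H i j ω ∂ν =
        ENNReal.ofReal |∫ ω, (y i j : Ω' →ₘ[ν] ℝ) ω * z i j ω ∂ν| := by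
      intro i j
      have heq : ∀ᵐ ω ∂ν, 0 ≤ (y i j : Ω' →ₘ[ν] ℝ) ω * z i j ω ∧
          a ω i j * H i j ω = ENNReal.ofReal ((y i j : Ω' →ₘ[ν] ℝ) ω * z i j ω) := by
        filter_upwards [hz i j, hGfin] with ω h1 h2
        have hs : (y i j : Ω' →ₘ[ν] ℝ) ω * (if 0 ≤ (y i j : Ω' →ₘ[ν] ℝ) ω then 1 else -1) =
            |(y i j : Ω' →ₘ[ν] ℝ) ω| := by
          split_ifs with h
          · rw [mul_one, abs_of_nonneg h]
          · rw [mul_neg_one, abs_of_neg (not_le.1 h)]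
        rw [h1, ← mul_assoc, hs]
        refine ⟨by positivity, ?_⟩
        rw [ENNReal.ofReal_mul (abs_nonneg _), ENNReal.ofReal_toReal ((hHG i j ω).trans_lt h2).ne,
          ← Real.enorm_eq_ofReal_abs]
      have hfin : ∫⁻ ω, a ω i j * H i j ω ∂ν ≠ ∞ := by
        refine ne_top_of_le_ne_top (ENNReal.mul_ne_top (gauge_space_ne_top (y i j))
          (ne_top_of_le_ne_top ENNReal.one_ne_top hG1)) ((lintegral_mono fun ω =>
          mul_le_mul_right (hHG i j ω) _).trans (Y.gauge.lintegral_mul_le Y.exhausts_gauge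
            (hym i j) (gauge_space_ne_top (y i j)) (ne_top_of_le_ne_top ENNReal.one_ne_top hG1)))
      rw [abs_of_nonneg (integral_nonneg_of_ae (heq.mono fun ω h => h.1)),
        integral_eq_lintegral_of_nonneg_ae (heq.mono fun ω h => h.1)
          ((hyr i j).mul (AEEqFun.stronglyMeasurable _).measurable).aestronglyMeasurable,
        ← lintegral_congr_ae (heq.mono fun ω h => h.2), ENNReal.ofReal_toReal hfin]
    rw [ENNReal.ofReal_sum_of_nonneg fun i _ => Finset.sum_nonneg fun j _ => abs_nonneg _]
    calc _ = ∫⁻ ω, ∑ i, ∑ j, a ω i j * H i j ω ∂ν := by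
          refine lintegral_congr fun ω => ?_
          have := hb2 (a ω) fun i j => enorm_ne_top
          simp only [H, ← mul_assoc, ← Finset.sum_mul]
          rw [this]
      _ = ∑ i, ∑ j, ∫⁻ ω, a ω i j * H i j ω ∂ν :=
          lintegral_sum_sum fun i j => (hym i j).mul (hH i j)
      _ = _ := by
          refine Finset.sum_congr rfl fun i _ => ?_
          rw [ENNReal.ofReal_sum_of_nonneg fun j _ => abs_nonneg _]
          exact Finset.sum_congr rfl fun j _ => hint i j

end BanachFunctionSpace

end RegularOperators

/-! ### From a factorization to the mixed inequality: (iii) implies (ii). -/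

namespace RegularOperators

variable {Ω Ω' : Type*} [MeasurableSpace Ω] [MeasurableSpace Ω'] {μ : Measure Ω} {ν : Measure Ω'}
  {p q r : ℝ≥0∞} {n m : ℕ}

theorem enorm_coeFn_mul (f x : Ω →ₘ[μ] ℝ) :
    (fun ω => ‖(f * x) ω‖ₑ) =ᵐ[μ] fun ω => ‖f ω‖ₑ * ‖x ω‖ₑ := by
  filter_upwards [AEEqFun.coeFn_mul f x] with ω h
  rw [h, Pi.mul_apply, enorm_mul]

namespace BanachFunctionSpace

variable {X Z : BanachFunctionSpace μ}

theorem norm_lpSum (X : BanachFunctionSpace μ) (hq : 0 < q) (x : Fin n → Ω →ₘ[μ] ℝ) :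
    X.norm (lpSum q x) = X.gauge fun ω => ellENorm q fun j => ‖x j ω‖ₑ :=
  (X.gauge_eq_norm (enorm_lpSum hq x)).symm

/-- Multiplication operators between Banach function spaces are bounded. -/
theorem exists_gauge_mul_le {f : Ω →ₘ[μ] ℝ} (hf : ∀ x ∈ X.space, f * x ∈ Z.space) :
    ∃ C : ℝ≥0, ∀ F, Measurable F → X.gauge F ≠ ∞ →
      Z.gauge (fun ω => ‖f ω‖ₑ * F ω) ≤ C * X.gauge F := by
  have hfin : ∀ F, Measurable F → X.gauge F ≠ ∞ → Z.gauge (fun ω => ‖f ω‖ₑ * F ω) ≠ ∞ := by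
    intro F hF h
    have hmem : Z.norm (f * ofENN μ F hF) < ∞ := hf _ (X.spaceOfENN F hF h).2
    rw [Z.gauge_eq_norm (x := f * ofENN μ F hF)]
    · exact hmem.ne
    · filter_upwards [enorm_coeFn_mul f (ofENN μ F hF),
        enorm_ofENN hF (X.gauge.ae_lt_top hF h)] with ω h1 h2
      rw [h1, h2]
  by_contra! hcon
  -- If the bound fails for each constant `4^k`, normalise `F k` to gauge `2^(-k)`. The sum of these
  -- functions has finite gauge by completeness, while its image dominates functions of gauge at
  -- least `2^k` for every `k`.
  choose F hF hFfin hFlt using fun k : ℕ => hcon (4 ^ k)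
  have hne : ∀ k, X.gauge (F k) ≠ 0 := by
    intro k h0
    have h1 : Z.gauge (fun ω => ‖f ω‖ₑ * F k ω) = 0 := by
      rw [Z.gauge.congr_ae (g := fun _ => 0), Z.gauge.zero]
      filter_upwards [X.ae_eq_zero_of_gauge (hF k) h0] with ω hω
      rw [hω]
      simp
    exact absurd (hFlt k) (by simp [h1])
  let a : ℕ → ℝ≥0 := fun k => (X.gauge (F k)).toNNReal
  have ha : ∀ k, (a k : ℝ≥0∞) = X.gauge (F k) := fun k => ENNReal.coe_toNNReal (hFfin k)
  have ha0 : ∀ k, a k ≠ 0 := fun k h => hne k (by rw [← ha, h, ENNReal.coe_zero])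
  let c : ℕ → ℝ≥0 := fun k => (1 / 2) ^ k * (a k)⁻¹
  let G : ℕ → Ω → ℝ≥0∞ := fun k ω => c k * F k ω
  have hG : ∀ k, Measurable (G k) := fun k => (hF k).const_mul _
  have hGX : ∀ k, X.gauge (G k) = ((1 / 2 : ℝ≥0) ^ k : ℝ≥0) := by
    intro k
    change X.gauge (fun ω => c k * F k ω) = _
    rw [X.gauge.const_mul_eq, ← ha, ← ENNReal.coe_mul, mul_assoc, inv_mul_cancel₀ (ha0 k), mul_one]
  have hGZ : ∀ k, ((2 ^ k : ℝ≥0) : ℝ≥0∞) ≤ Z.gauge (fun ω => ‖f ω‖ₑ * G k ω) := by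
    intro k
    have h1 : Z.gauge (fun ω => ‖f ω‖ₑ * G k ω) = c k * Z.gauge (fun ω => ‖f ω‖ₑ * F k ω) := by
      rw [← Z.gauge.const_mul_eq]
      congr 1
      funext ω
      simp only [G]
      ring
    rw [h1]
    refine le_trans ?_ (mul_le_mul_right (hFlt k).le _)
    rw [← ha, ← ENNReal.coe_mul, ← ENNReal.coe_mul, ENNReal.coe_le_coe]
    refine le_of_eq ?_
    have h2 : (2 : ℝ≥0) ^ k = (1 / 2) ^ k * 4 ^ k := by
      rw [← mul_pow]
      norm_num
    rw [h2]
    simp only [c]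
    rw [mul_assoc, mul_comm (a k)⁻¹, mul_assoc, mul_inv_cancel₀ (ha0 k), mul_one]
  have hsum : X.gauge (fun ω => ∑' k, G k ω) ≠ ∞ := by
    refine ne_top_of_le_ne_top ?_ (X.gauge_tsum_le G hG)
    simp_rw [hGX]
    rw [ENNReal.tsum_coe_ne_top_iff_summable]
    exact NNReal.summable_geometric (by
      rw [div_lt_one (by norm_num)]
      norm_num)
  refine hfin _ (Measurable.tsum hG) hsum (ENNReal.eq_top_of_forall_nnreal_le fun b => ?_)
  obtain ⟨k, hk⟩ := pow_unbounded_of_one_lt b (one_lt_two : (1 : ℝ≥0) < 2)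
  refine (ENNReal.coe_le_coe.2 hk.le).trans ((hGZ k).trans (Z.gauge.mono_of_le fun ω => ?_))
  exact mul_le_mul_right (ENNReal.le_tsum k) _

variable [SigmaFinite μ] [SigmaFinite ν]

theorem gauge_lebesgue (hr : 1 ≤ r) (hr' : r ≠ ∞) {F : Ω → ℝ≥0∞} (hF : Measurable F) :
    (lebesgue μ r hr).gauge F = (∫⁻ ω, F ω ^ r.toReal ∂μ) ^ (1 / r.toReal) := by
  have hr0 : 0 < r := zero_lt_one.trans_le hr
  have ht : 0 < r.toReal := ENNReal.toReal_pos hr0.ne' hr'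
  by_cases h : ∀ᵐ ω ∂μ, F ω < ∞
  · rw [(lebesgue μ r hr).gauge_eq_norm (enorm_ofENN hF h)]
    change eLpNorm _ r μ = _
    rw [eLpNorm_eq_lintegral_rpow_enorm_toReal hr0.ne' hr']
    congr 1
    refine lintegral_congr_ae ?_
    filter_upwards [enorm_ofENN hF h] with ω h1
    rw [h1]
  · have h1 : (lebesgue μ r hr).gauge F = ∞ := by
      by_contra hne
      exact h ((lebesgue μ r hr).gauge.ae_lt_top hF hne)
    have h2 : ∫⁻ ω, F ω ^ r.toReal ∂μ = ∞ := by
      by_contra hne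
      apply h
      filter_upwards [ae_lt_top (hF.pow_const _) hne] with ω hω
      exact (ENNReal.rpow_lt_top_iff_of_pos ht).1 hω
    rw [h1, h2, ENNReal.top_rpow_of_pos (one_div_pos.2 ht)]

theorem gauge_lebesgue_rpow (hr : 1 ≤ r) (hr' : r ≠ ∞) {F : Ω → ℝ≥0∞} (hF : Measurable F) :
    (lebesgue μ r hr).gauge F ^ r.toReal = ∫⁻ ω, F ω ^ r.toReal ∂μ := by
  have ht : 0 < r.toReal := ENNReal.toReal_pos (zero_lt_one.trans_le hr).ne' hr'
  rw [gauge_lebesgue hr hr' hF, ← ENNReal.rpow_mul, one_div_mul_cancel ht.ne', ENNReal.rpow_one]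

/-- The identity `L_r(ℓ_r) = ℓ_r(L_r)` is what allows regularity on `L_r`, a statement about single
rows, to control matrices. -/
theorem gauge_lebesgue_ellENorm (hr : 1 ≤ r) (hr' : r ≠ ∞) {F : Fin n → Ω → ℝ≥0∞}
    (hF : ∀ i, Measurable (F i)) : (lebesgue μ r hr).gauge (fun ω => ellENorm r fun i => F i ω) =
      ellENorm r fun i => (lebesgue μ r hr).gauge (F i) := by
  rw [gauge_lebesgue hr hr' (measurable_ellENorm hF), ellENorm_of_ne_top hr']
  simp_rw [ellENorm_rpow (zero_lt_one.trans_le hr) hr', gauge_lebesgue_rpow hr hr' (hF _)]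
  rw [lintegral_finsetSum _ fun i _ => (hF i).pow_const _]

theorem norm_mixedSum_le_of_factorization (hr : 1 ≤ r) (hr' : r ≠ ∞) (hp : 0 < p) (hq : 0 < q)
    {Y : BanachFunctionSpace ν} {T : X.space → Y.space} {f : Ω →ₘ[μ] ℝ} {g : Ω' →ₘ[ν] ℝ}
    (hf : ∀ x ∈ X.space, f * x ∈ (lebesgue μ r hr).space)
    (hg : ∀ h ∈ (lebesgue ν r hr).space, g * h ∈ Y.space)
    {S : (lebesgue μ r hr).space →ₗ[ℝ] (lebesgue ν r hr).space} (hS : IsRegular p q S)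
    (hT : ∀ x, T x = mulOp g hg (S (mulOp f hf x))) :
    ∃ K : ℝ≥0, 0 < K ∧ ∀ (n m : ℕ) (x : Fin n → Fin m → X.space),
      Y.norm (mixedSum r p fun i j => (T (x i j) : Ω' →ₘ[ν] ℝ)) ≤
        K * X.norm (mixedSum r q fun i j => (x i j : Ω →ₘ[μ] ℝ)) := by
  have hr0 : 0 < r := zero_lt_one.trans_le hr
  obtain ⟨C, hC⟩ := exists_gauge_mul_le hf
  obtain ⟨D, hD⟩ := exists_gauge_mul_le hg
  obtain ⟨K, -, hK⟩ := hS
  refine ⟨D * K * C + 1, by positivity, fun n m x => ?_⟩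
  let u : Fin n → Fin m → (lebesgue μ r hr).space := fun i j => mulOp f hf (x i j)
  have hxm : ∀ i j, Measurable fun ω => ‖(x i j : Ω →ₘ[μ] ℝ) ω‖ₑ := fun i j =>
    measurable_enorm_coeFn _
  have hum : ∀ i j, Measurable fun ω => ‖(u i j : Ω →ₘ[μ] ℝ) ω‖ₑ := fun i j =>
    measurable_enorm_coeFn _
  have hSm : ∀ i j, Measurable fun ω => ‖(S (u i j) : Ω' →ₘ[ν] ℝ) ω‖ₑ := fun i j =>
    measurable_enorm_coeFn _
  have hu : ∀ i j, ∀ᵐ ω ∂μ, ‖(u i j : Ω →ₘ[μ] ℝ) ω‖ₑ = ‖f ω‖ₑ * ‖(x i j : Ω →ₘ[μ] ℝ) ω‖ₑ :=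
    fun i j => enorm_coeFn_mul f _
  have hTx : ∀ i j, ∀ᵐ ω ∂ν, ‖(T (x i j) : Ω' →ₘ[ν] ℝ) ω‖ₑ =
      ‖g ω‖ₑ * ‖(S (u i j) : Ω' →ₘ[ν] ℝ) ω‖ₑ := fun i j => by
    rw [hT]
    exact enorm_coeFn_mul g _
  have hSfin : (lebesgue ν r hr).gauge (fun ω => ellENorm r fun i => ellENorm p fun j =>
      ‖(S (u i j) : Ω' →ₘ[ν] ℝ) ω‖ₑ) ≠ ∞ :=
    (isSubadditive_gauge _).gauge_ellENorm_ne_top hr0 (fun i => measurable_ellENorm (hSm i))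
      fun i => (isSubadditive_gauge _).gauge_ellENorm_ne_top hp (hSm i) fun j =>
        gauge_space_ne_top (S (u i j))
  have hxfin : X.gauge (fun ω => ellENorm r fun i => ellENorm q fun j =>
      ‖(x i j : Ω →ₘ[μ] ℝ) ω‖ₑ) ≠ ∞ :=
    (isSubadditive_gauge _).gauge_ellENorm_ne_top hr0 (fun i => measurable_ellENorm (hxm i))
      fun i => (isSubadditive_gauge _).gauge_ellENorm_ne_top hq (hxm i) fun j =>
        gauge_space_ne_top (x i j)
  rw [norm_mixedSum Y hr0 hp, norm_mixedSum X hr0 hq]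
  calc Y.gauge (fun ω => ellENorm r fun i => ellENorm p fun j => ‖(T (x i j) : Ω' →ₘ[ν] ℝ) ω‖ₑ)
      = Y.gauge (fun ω => ‖g ω‖ₑ * ellENorm r fun i => ellENorm p fun j =>
          ‖(S (u i j) : Ω' →ₘ[ν] ℝ) ω‖ₑ) := by
        refine Y.gauge.congr_ae ?_
        filter_upwards [ae_all_iff.2 fun i => ae_all_iff.2 (hTx i)] with ω h
        simp_rw [h, ellENorm_const_mul hp, ellENorm_const_mul hr0]
    _ ≤ D * (lebesgue ν r hr).gauge (fun ω => ellENorm r fun i => ellENorm p fun j =>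
          ‖(S (u i j) : Ω' →ₘ[ν] ℝ) ω‖ₑ) := hD _ (measurable_ellENorm_ellENorm hSm) hSfin
    _ = D * ellENorm r fun i => (lebesgue ν r hr).gauge (fun ω => ellENorm p fun j =>
          ‖(S (u i j) : Ω' →ₘ[ν] ℝ) ω‖ₑ) := by
        rw [gauge_lebesgue_ellENorm hr hr' fun i => measurable_ellENorm (hSm i)]
    _ ≤ D * ellENorm r fun i => K * (lebesgue μ r hr).gauge (fun ω => ellENorm q fun j =>
          ‖(u i j : Ω →ₘ[μ] ℝ) ω‖ₑ) := by
        refine mul_le_mul_right (ellENorm_mono fun i => ?_) _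
        rw [← norm_lpSum _ hp, ← norm_lpSum _ hq]
        exact hK m (u i)
    _ = D * (K * (lebesgue μ r hr).gauge (fun ω => ellENorm r fun i => ellENorm q fun j =>
          ‖(u i j : Ω →ₘ[μ] ℝ) ω‖ₑ)) := by
        rw [ellENorm_const_mul hr0,
          gauge_lebesgue_ellENorm hr hr' fun i => measurable_ellENorm (hum i)]
    _ = D * (K * (lebesgue μ r hr).gauge (fun ω => ‖f ω‖ₑ * ellENorm r fun i => ellENorm q fun j =>
          ‖(x i j : Ω →ₘ[μ] ℝ) ω‖ₑ)) := by
        congr 2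
        refine FunctionGauge.congr_ae _ ?_
        filter_upwards [ae_all_iff.2 fun i => ae_all_iff.2 (hu i)] with ω h
        simp_rw [h, ellENorm_const_mul hq, ellENorm_const_mul hr0]
    _ ≤ D * (K * (C * X.gauge (fun ω => ellENorm r fun i => ellENorm q fun j =>
          ‖(x i j : Ω →ₘ[μ] ℝ) ω‖ₑ))) := by
        gcongr
        exact hC _ (measurable_ellENorm_ellENorm hxm) hxfin
    _ ≤ _ := by
        rw [← mul_assoc, ← mul_assoc, ← ENNReal.coe_mul, ← ENNReal.coe_mul]
        gcongr
        exact le_self_add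

end BanachFunctionSpace

end RegularOperators

/-! ### Extending regular operators by density. -/

namespace RegularOperators

variable {Ω Ω' : Type*} [MeasurableSpace Ω] [MeasurableSpace Ω'] {μ : Measure Ω} {ν : Measure Ω'}
  {p q r : ℝ≥0∞} {n m : ℕ}

namespace BanachFunctionSpace

theorem norm_eq_ofReal {X : BanachFunctionSpace μ} (x : X.space) : X.norm x = ENNReal.ofReal ‖x‖ :=
  (ENNReal.ofReal_toReal x.2.ne).symm

instance (X : BanachFunctionSpace μ) : CompleteSpace X.space := by
  refine Metric.complete_of_cauchySeq_tendsto fun u hu => ?_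
  obtain ⟨g, hg, hlim⟩ := X.complete (fun n => u n) (fun n => (u n).2) fun ε hε => by
    rcases eq_or_ne ε ∞ with rfl | hε'
    · exact ⟨0, fun _ _ _ _ => le_top⟩
    obtain ⟨N, hN⟩ := Metric.cauchySeq_iff.1 hu ε.toReal (ENNReal.toReal_pos hε.ne' hε')
    refine ⟨N, fun m hm n hn => ?_⟩
    have h1 := (hN m hm n hn).le
    rw [dist_eq_norm] at h1
    have h2 : X.norm ((u m : Ω →ₘ[μ] ℝ) - u n) = ENNReal.ofReal ‖u m - u n‖ :=
      norm_eq_ofReal (u m - u n)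
    rw [h2]
    exact ENNReal.ofReal_le_of_le_toReal h1
  refine ⟨⟨g, hg⟩, ?_⟩
  rw [tendsto_iff_norm_sub_tendsto_zero]
  exact (ENNReal.tendsto_toReal ENNReal.zero_ne_top).comp hlim

/-- A regular operator on a subspace that is dense in the order sense extends to a regular
operator. -/
theorem exists_isRegular_extension (hp : 1 ≤ p) (hq : 0 < q) {Z : BanachFunctionSpace μ}
    {W : BanachFunctionSpace ν} {E : Type*} [AddCommGroup E] [Module ℝ E] (e : E →ₗ[ℝ] Z.space)
    (F : E →ₗ[ℝ] W.space) {C : ℝ≥0}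
    (hC : ∀ (n : ℕ) (x : Fin n → E), W.norm (lpSum p fun i => (F (x i) : Ω' →ₘ[ν] ℝ)) ≤
      C * Z.norm (lpSum q fun i => (e (x i) : Ω →ₘ[μ] ℝ)))
    (hdense : ∀ (v : Z.space) (ε : ℝ≥0), 0 < ε → ∃ x : E,
      (∀ᵐ ω ∂μ, ‖(e x : Ω →ₘ[μ] ℝ) ω‖ₑ ≤ ‖(v : Ω →ₘ[μ] ℝ) ω‖ₑ) ∧
        Z.norm ((v : Ω →ₘ[μ] ℝ) - e x) ≤ ε) :
    ∃ S : Z.space →L[ℝ] W.space, IsRegular p q S.toLinearMap ∧ ∀ x, S (e x) = F x := by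
  have hp0 : 0 < p := zero_lt_one.trans_le hp
  have hbound : ∀ x, ‖F x‖ ≤ C * ‖e x‖ := by
    intro x
    have h := hC 1 fun _ => x
    rw [norm_lpSum _ hp0, norm_lpSum _ hq] at h
    simp only [ellENorm_fin_one hp0, ellENorm_fin_one hq, gauge_enorm] at h
    have h1 := ENNReal.toReal_mono (ENNReal.mul_ne_top ENNReal.coe_ne_top (e x).2.ne) h
    rwa [ENNReal.toReal_mul, ENNReal.coe_toReal] at h1
  have hrange : DenseRange e := by
    refine Metric.denseRange_iff.2 fun v ε hε => ?_
    obtain ⟨x, -, hx⟩ := hdense v (ε / 2).toNNReal (Real.toNNReal_pos.2 (half_pos hε))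
    refine ⟨x, ?_⟩
    rw [dist_eq_norm]
    have h1 : Z.norm ((v : Ω →ₘ[μ] ℝ) - e x) = ENNReal.ofReal ‖v - e x‖ := norm_eq_ofReal (v - e x)
    rw [h1, ← ENNReal.ofReal, ENNReal.ofReal_le_ofReal_iff (half_pos hε).le] at hx
    linarith
  -- The map `e` need not be injective: the bound makes `F` vanish on its kernel.
  let S : Z.space →L[ℝ] W.space := F.extendOfNorm e
  have hS : ∀ x, S (e x) = F x := fun x => LinearMap.extendOfNorm_eq hrange ⟨C, hbound⟩ x
  have hSle : ∀ v : Z.space, W.norm (S v) ≤ C * Z.norm v := fun v => by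
    have := LinearMap.norm_extendOfNorm_apply_le hrange C hbound v
    rw [norm_eq_ofReal, norm_eq_ofReal, ← ENNReal.ofReal_coe_nnreal,
      ← ENNReal.ofReal_mul C.coe_nonneg]
    exact ENNReal.ofReal_le_ofReal this
  refine ⟨S, ⟨C + 1, by positivity, fun n v => ?_⟩, hS⟩
  refine le_trans ?_ (mul_le_mul_left (ENNReal.coe_le_coe.2 (le_self_add : C ≤ C + 1)) _)
  refine ENNReal.le_of_forall_pos_le_add fun δ hδ _ => ?_
  -- The `n` error terms `S (v i - e (x i))` contribute at most `n * C * ε ≤ δ`.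
  set ε : ℝ≥0 := δ / (n * C + 1) with hε
  have hε0 : 0 < ε := by positivity
  choose x hx1 hx2 using fun i => hdense (v i) ε hε0
  have hm1 : ∀ i, Measurable fun ω => ‖(F (x i) : Ω' →ₘ[ν] ℝ) ω‖ₑ := fun i =>
    measurable_enorm_coeFn _
  have hsplit : ∀ i, ∀ᵐ ω ∂ν, ‖(S (v i) : Ω' →ₘ[ν] ℝ) ω‖ₑ ≤
      ‖(F (x i) : Ω' →ₘ[ν] ℝ) ω‖ₑ + ‖(S (v i - e (x i)) : Ω' →ₘ[ν] ℝ) ω‖ₑ := fun i => by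
    have h1 : (S (v i) : Ω' →ₘ[ν] ℝ) = F (x i) + S (v i - e (x i)) := by
      rw [← hS, ← Submodule.coe_add, ← map_add]
      congr 2
      abel
    filter_upwards [AEEqFun.coeFn_add (F (x i) : Ω' →ₘ[ν] ℝ) (S (v i - e (x i)) : Ω' →ₘ[ν] ℝ)]
      with ω h2
    rw [h1, h2]
    exact enorm_add_le _ _
  change W.norm (lpSum p fun i => (S (v i) : Ω' →ₘ[ν] ℝ)) ≤ _
  rw [norm_lpSum _ hp0, norm_lpSum _ hq]
  calc W.gauge (fun ω => ellENorm p fun i => ‖(S (v i) : Ω' →ₘ[ν] ℝ) ω‖ₑ)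
      ≤ W.gauge (fun ω => (ellENorm p fun i => ‖(F (x i) : Ω' →ₘ[ν] ℝ) ω‖ₑ) +
          ∑ i, ‖(S (v i - e (x i)) : Ω' →ₘ[ν] ℝ) ω‖ₑ) := by
        refine W.gauge.mono ?_
        filter_upwards [ae_all_iff.2 hsplit] with ω h
        exact (ellENorm_mono h).trans ((ellENorm_add_le hp _ _).trans
          (add_le_add le_rfl (ellENorm_le_sum hp _)))
    _ ≤ C * Z.gauge (fun ω => ellENorm q fun i => ‖(v i : Ω →ₘ[μ] ℝ) ω‖ₑ) +
          ∑ i, W.gauge (fun ω => ‖(S (v i - e (x i)) : Ω' →ₘ[ν] ℝ) ω‖ₑ) := by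
        refine (W.gauge_add_le _ _).trans (add_le_add ?_ (W.gauge_sum_le _ _))
        rw [← norm_lpSum _ hp0]
        refine (hC n x).trans (mul_le_mul_right ?_ _)
        rw [norm_lpSum _ hq]
        refine Z.gauge.mono ?_
        -- The pointwise bound `|e (x i)| ≤ |v i|` compares the `ℓ_q` sums directly; no triangle
        -- inequality is needed, which matters for `q < 1`.
        filter_upwards [ae_all_iff.2 hx1] with ω h using ellENorm_mono h
    _ ≤ _ := by
        refine add_le_add le_rfl ?_
        calc ∑ i, W.gauge (fun ω => ‖(S (v i - e (x i)) : Ω' →ₘ[ν] ℝ) ω‖ₑ)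
            ≤ ∑ _i : Fin n, ((C * ε : ℝ≥0) : ℝ≥0∞) := by
              refine Finset.sum_le_sum fun i _ => ?_
              rw [W.gauge_enorm, ENNReal.coe_mul]
              exact (hSle _).trans (mul_le_mul_right (hx2 i) _)
          _ ≤ δ := by
              rw [Finset.sum_const, Finset.card_univ, Fintype.card_fin, nsmul_eq_mul,
                ← ENNReal.coe_natCast, ← ENNReal.coe_mul, ENNReal.coe_le_coe, hε, ← mul_assoc,
                mul_div_assoc', div_le_iff₀ (by positivity), mul_comm]
              exact mul_le_mul_right le_self_add _

end BanachFunctionSpace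

end RegularOperators

/-! ### The cone of regularity pairs and its weights. -/

namespace RegularOperators

theorem ellENorm_of_injective {p : ℝ≥0∞} (hp : 0 < p) {n m : ℕ} {e : Fin n → Fin m}
    (he : e.Injective) {a : Fin n → ℝ≥0∞} {b : Fin m → ℝ≥0∞} (hb : ∀ i, b (e i) = a i)
    (hb0 : ∀ j, j ∉ Set.range e → b j = 0) : ellENorm p b = ellENorm p a := by
  unfold ellENorm
  split_ifs with h
  · refine le_antisymm (iSup_le fun j => ?_) (iSup_le fun i => ?_)
    · by_cases hj : j ∈ Set.range e
      · obtain ⟨i, rfl⟩ := hj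
        rw [hb]
        exact le_iSup a i
      · simp [hb0 j hj]
    · rw [← hb]
      exact le_iSup b (e i)
  · congr 1
    symm
    refine Fintype.sum_of_injective e he _ _ (fun j hj => ?_) fun i => by rw [hb]
    rw [hb0 j hj, ENNReal.zero_rpow_of_pos (ENNReal.toReal_pos hp.ne' h)]

variable {Ω Ω' : Type*} [MeasurableSpace Ω] [MeasurableSpace Ω'] {μ : Measure Ω} {ν : Measure Ω'}
  {p q r r' : ℝ≥0∞}

namespace BanachFunctionSpace

variable {X : BanachFunctionSpace μ} {Y : BanachFunctionSpace ν}

theorem ellENorm_map_extend {E : Type*} [AddCommGroup E] [Module ℝ E] (hp : 0 < p)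
    (L : E →ₗ[ℝ] Y.space) {n m : ℕ} {e : Fin n → Fin m} (he : e.Injective) (c : ℝ≥0)
    (x : Fin n → E) : ∀ᵐ ω ∂ν,
      (ellENorm p fun j =>
        ‖(L (Function.extend e (fun i => (c : ℝ) • x i) 0 j) : Ω' →ₘ[ν] ℝ) ω‖ₑ) =
        c * ellENorm p fun j => ‖(L (x j) : Ω' →ₘ[ν] ℝ) ω‖ₑ := by
  filter_upwards [ae_all_iff.2 fun j => AEEqFun.coeFn_smul (c : ℝ) (L (x j) : Ω' →ₘ[ν] ℝ),
    (AEEqFun.coeFn_zero : ((0 : Ω' →ₘ[ν] ℝ) : Ω' → ℝ) =ᵐ[ν] 0)] with ω h1 h2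
  rw [← ellENorm_const_mul hp]
  refine ellENorm_of_injective hp he (fun j => ?_) fun j hj => ?_
  · rw [he.extend_apply, map_smul, Submodule.coe_smul, h1, Pi.smul_apply, enorm_smul]
    simp
  · rw [Function.extend_apply' _ _ j hj, Pi.zero_apply, map_zero, Submodule.coe_zero, h2]
    simp

/-- The pairs `(c (∑ |x_j|^q)^(1/q), c (∑ |T x_j|^p)^(1/p))`. -/
def regularityPairs (p q : ℝ≥0∞) (T : X.space →ₗ[ℝ] Y.space) :
    Set ((Ω → ℝ≥0∞) × (Ω' → ℝ≥0∞)) :=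
  {z | ∃ (c : ℝ≥0) (m : ℕ) (x : Fin m → X.space),
    z = (fun ω => c * ellENorm q fun j => ‖(x j : Ω →ₘ[μ] ℝ) ω‖ₑ,
      fun ω => c * ellENorm p fun j => ‖(T (x j) : Ω' →ₘ[ν] ℝ) ω‖ₑ)}

variable {T : X.space →ₗ[ℝ] Y.space}

theorem measurable_of_mem_regularityPairs {z : (Ω → ℝ≥0∞) × (Ω' → ℝ≥0∞)}
    (hz : z ∈ regularityPairs p q T) : Measurable z.1 ∧ Measurable z.2 := by
  obtain ⟨c, m, x, rfl⟩ := hz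
  exact ⟨(measurable_ellENorm fun j => measurable_enorm_coeFn _).const_mul _,
    (measurable_ellENorm fun j => measurable_enorm_coeFn _).const_mul _⟩

theorem gauge_ne_top_of_mem_regularityPairs (hp : 0 < p) (hq : 0 < q)
    {z : (Ω → ℝ≥0∞) × (Ω' → ℝ≥0∞)} (hz : z ∈ regularityPairs p q T) :
    X.gauge z.1 ≠ ∞ ∧ Y.gauge z.2 ≠ ∞ := by
  obtain ⟨c, m, x, rfl⟩ := hz
  exact ⟨X.gauge.const_mul_ne_top ENNReal.coe_ne_top (X.isSubadditive_gauge.gauge_ellENorm_ne_top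
      hq (fun j => measurable_enorm_coeFn _) fun j => gauge_space_ne_top (x j)),
    Y.gauge.const_mul_ne_top ENNReal.coe_ne_top (Y.isSubadditive_gauge.gauge_ellENorm_ne_top
      hp (fun j => measurable_enorm_coeFn _) fun j => gauge_space_ne_top (T (x j)))⟩

theorem const_mul_mem_regularityPairs (c : ℝ≥0) {z : (Ω → ℝ≥0∞) × (Ω' → ℝ≥0∞)}
    (hz : z ∈ regularityPairs p q T) :
    ((fun ω => c * z.1 ω), (fun ω => c * z.2 ω)) ∈ regularityPairs p q T := by
  obtain ⟨d, m, x, rfl⟩ := hz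
  exact ⟨c * d, m, x, by simp only [ENNReal.coe_mul, mul_assoc]⟩

/-- The pairs come from families of different lengths with different scalars. Absorbing the scalars
into the vectors and padding with zeros to the common length `∑ k, m k` produces a matrix to which
the mixed inequality applies. -/
theorem gauge_ellENorm_le_of_mem_regularityPairs (hr : 0 < r) (hp : 0 < p) (hq : 0 < q) {K : ℝ≥0}
    (hK : ∀ (n m : ℕ) (x : Fin n → Fin m → X.space),
      Y.norm (mixedSum r p fun i j => (T (x i j) : Ω' →ₘ[ν] ℝ)) ≤
        K * X.norm (mixedSum r q fun i j => (x i j : Ω →ₘ[μ] ℝ)))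
    {n : ℕ} (z : Fin n → (Ω → ℝ≥0∞) × (Ω' → ℝ≥0∞)) (hz : ∀ i, z i ∈ regularityPairs p q T) :
    Y.gauge (fun ω => ellENorm r fun i => (z i).2 ω) ≤
      K * X.gauge (fun ω => ellENorm r fun i => (z i).1 ω) := by
  choose c m x hx using hz
  have hm : ∀ i, m i ≤ ∑ k, m k := fun i =>
    Finset.single_le_sum (f := m) (fun _ _ => Nat.zero_le _) (Finset.mem_univ i)
  let e : ∀ i, Fin (m i) → Fin (∑ k, m k) := fun i => Fin.castLE (hm i)
  have he : ∀ i, (e i).Injective := fun i => Fin.castLE_injective (hm i)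
  let u : Fin n → Fin (∑ k, m k) → X.space := fun i =>
    Function.extend (e i) (fun j => (c i : ℝ) • x i j) 0
  have h1 := hK n _ u
  rw [norm_mixedSum Y hr hp, norm_mixedSum X hr hq] at h1
  refine (Y.gauge.mono ?_).trans (h1.trans (mul_le_mul_right (X.gauge.mono ?_) _))
  · filter_upwards [ae_all_iff.2 fun i => ellENorm_map_extend hp T (he i) (c i) (x i)] with ω h2
    refine ellENorm_mono fun i => ?_
    rw [h2, hx]
  · filter_upwards [ae_all_iff.2 fun i =>
      ellENorm_map_extend hq (LinearMap.id : X.space →ₗ[ℝ] X.space) (he i) (c i) (x i)] with ω h2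
    refine ellENorm_mono fun i => ?_
    rw [hx]
    exact (h2 i).le

variable [SigmaFinite μ] [SigmaFinite ν]

theorem isOrderContinuous_gauge_lebesgue (hr : 1 ≤ r) (hr' : r ≠ ∞) :
    (lebesgue μ r hr).gauge.IsOrderContinuous :=
  isOrderContinuous_of_isConcave hr hr' (M := 1) fun n F hF _ => by
    rw [gauge_lebesgue_ellENorm hr hr' hF, ENNReal.coe_one, one_mul]

theorem hasFactorWeights_regularityPairs (hp : 1 ≤ p) (hq : 0 < q) (hr : r.HolderConjugate r')
    (hr_top : r ≠ ∞) (hX : X.IsConvex r) (hY : Y.IsConcave r) (hXc : OrderContinuous X.norm)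
    (hYc : OrderContinuous Y.dualNorm) {K : ℝ≥0}
    (hK : ∀ (n m : ℕ) (x : Fin n → Fin m → X.space),
      Y.norm (mixedSum r p fun i j => (T (x i j) : Ω' →ₘ[ν] ℝ)) ≤
        K * X.norm (mixedSum r q fun i j => (x i j : Ω →ₘ[μ] ℝ))) :
    HasFactorWeights X Y r.toReal (regularityPairs p q T) := by
  have hp0 : 0 < p := zero_lt_one.trans_le hp
  have hr0 : 0 < r := zero_lt_one.trans_le (one_le_of_holderConjugate hr)
  obtain ⟨MX, hMX⟩ := hX.gauge hr0
  obtain ⟨MY, hMY⟩ := hY.gauge hr0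
  have hXc' := isOrderContinuous_of_orderContinuous hXc X.gauge X.gauge_enorm
  have hYc' := isOrderContinuous_of_orderContinuous hYc (Y.gauge.dual Y.exhausts_gauge)
    (Y.dual_gauge_enorm Y.exhausts_gauge)
  have hK' := fun (n : ℕ) (z : Fin n → (Ω → ℝ≥0∞) × (Ω' → ℝ≥0∞)) =>
    gauge_ellENorm_le_of_mem_regularityPairs hr0 hp0 hq hK z
  rcases holderConjugate_cases hr with ⟨rfl, rfl⟩ | ⟨rfl, rfl⟩ | ⟨-, hr_top', ht⟩
  · rw [ENNReal.toReal_one]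
    exact hasFactorWeights_one hMY hXc' (fun z => measurable_of_mem_regularityPairs)
      (fun z => gauge_ne_top_of_mem_regularityPairs hp0 hq)
      (fun c _ z => const_mul_mem_regularityPairs c) hK'
  · exact absurd rfl hr_top
  · exact hasFactorWeights_of_one_lt hr_top hr_top' hr ht hMX hMY hXc' hYc'
      (fun z => measurable_of_mem_regularityPairs)
      (fun z => gauge_ne_top_of_mem_regularityPairs hp0 hq)
      (fun c _ z => const_mul_mem_regularityPairs c) hK'

end BanachFunctionSpace

end RegularOperators

/-! ### From weights to the factorization. -/

namespace RegularOperators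

variable {Ω Ω' : Type*} [MeasurableSpace Ω] [MeasurableSpace Ω'] {μ : Measure Ω} {ν : Measure Ω'}
  {p q r r' : ℝ≥0∞}

/-- Multiplication by a fixed class of measurable functions. -/
def mulLinearMap (f : Ω →ₘ[μ] ℝ) : (Ω →ₘ[μ] ℝ) →ₗ[ℝ] (Ω →ₘ[μ] ℝ) where
  toFun x := f * x
  map_add' x y := by
    ext1
    filter_upwards [AEEqFun.coeFn_mul f (x + y), AEEqFun.coeFn_mul f x, AEEqFun.coeFn_mul f y,
      AEEqFun.coeFn_add x y, AEEqFun.coeFn_add (f * x) (f * y)] with ω h1 h2 h3 h4 h5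
    simp only [h1, h5, Pi.mul_apply, Pi.add_apply, h2, h3, h4]
    ring
  map_smul' c x := by
    ext1
    filter_upwards [AEEqFun.coeFn_mul f (c • x), AEEqFun.coeFn_mul f x, AEEqFun.coeFn_smul c x,
      AEEqFun.coeFn_smul c (f * x)] with ω h1 h2 h3 h4
    simp only [h1, h4, Pi.mul_apply, Pi.smul_apply, h2, h3, smul_eq_mul, RingHom.id_apply]
    ring

namespace BanachFunctionSpace

variable {X : BanachFunctionSpace μ} {Y : BanachFunctionSpace ν}

theorem mem_space_of_enorm_le {u : Ω →ₘ[μ] ℝ} {F : Ω → ℝ≥0∞} (hF : X.gauge F ≠ ∞)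
    (h : ∀ᵐ ω ∂μ, ‖u ω‖ₑ ≤ F ω) : u ∈ X.space := by
  change X.norm u < ∞
  rw [← X.gauge_enorm]
  exact (X.gauge.mono h).trans_lt hF.lt_top

/-- The function `w` need not lie in `X`, but its restriction to a set where it is bounded by `n`
inside an exhausting set does. With `w = v / f` this approximates `v` by functions `f x`, and order
continuity of `Z` makes the discarded part of `v` small. -/
theorem exists_mem_space_truncation [SigmaFinite μ] {Z : BanachFunctionSpace μ}
    (hZ : Z.gauge.IsOrderContinuous) (X : BanachFunctionSpace μ) (w : Ω →ₘ[μ] ℝ) (v : Z.space)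
    {ε : ℝ≥0} (hε : 0 < ε) : ∃ (A : Set Ω) (x : X.space), MeasurableSet A ∧
      (∀ᵐ ω ∂μ, (x : Ω →ₘ[μ] ℝ) ω = A.indicator (fun ω => w ω) ω) ∧
      Z.gauge (Aᶜ.indicator fun ω => ‖(v : Ω →ₘ[μ] ℝ) ω‖ₑ) ≤ ε := by
  obtain ⟨B, hBm, hBmono, hBae, hBfin⟩ := X.exhausts_gauge
  let A : ℕ → Set Ω := fun n => B n ∩ {ω | ‖w ω‖ₑ ≤ n}
  have hA : ∀ n, MeasurableSet (A n) := fun n =>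
    (hBm n).inter (measurableSet_le (measurable_enorm_coeFn w) measurable_const)
  have hAmono : Monotone A := fun m n hmn => Set.inter_subset_inter (hBmono hmn)
    fun ω (hω : ‖w ω‖ₑ ≤ m) => hω.trans (by exact_mod_cast hmn)
  have hvm := measurable_enorm_coeFn (v : Ω →ₘ[μ] ℝ)
  have h0 := hZ (fun n => (A n)ᶜ.indicator fun ω => ‖(v : Ω →ₘ[μ] ℝ) ω‖ₑ)
    (fun n => hvm.indicator (hA n).compl)
    (fun m n hmn => fun ω => Set.indicator_le_indicator_of_subset
      (Set.compl_subset_compl.2 (hAmono hmn)) (fun _ => zero_le) ω)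
    (by
      filter_upwards [hBae] with ω ⟨m, hm⟩
      obtain ⟨n, hn⟩ := ENNReal.exists_nat_gt (enorm_ne_top (x := w ω))
      refine le_antisymm ((iInf_le _ (max m n)).trans (le_of_eq ?_)) zero_le
      refine Set.indicator_of_notMem (Set.notMem_compl_iff.2 ?_) _
      exact ⟨hBmono (le_max_left m n) hm, hn.le.trans (by exact_mod_cast le_max_right m n)⟩)
    (ne_top_of_le_ne_top (gauge_space_ne_top v)
      (Z.gauge.mono_of_le fun ω => Set.indicator_le_self _ _ ω))
  obtain ⟨n, hn⟩ := iInf_lt_iff.1 (h0.trans_lt (ENNReal.coe_pos.2 hε))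
  have hm : Measurable ((A n).indicator fun ω => w ω) :=
    (AEEqFun.stronglyMeasurable w).measurable.indicator (hA n)
  have hx := AEEqFun.coeFn_mk _ (hm.aestronglyMeasurable (μ := μ))
  refine ⟨A n, ⟨AEEqFun.mk _ hm.aestronglyMeasurable, mem_space_of_enorm_le
    (X.gauge.const_mul_ne_top (ENNReal.natCast_ne_top n) (hBfin n)) ?_⟩, hA n, hx, hn.le⟩
  filter_upwards [hx] with ω h
  rw [h]
  by_cases hω : ω ∈ A n
  · simpa [hω, hω.1] using hω.2
  · simp [hω]

variable [SigmaFinite μ] [SigmaFinite ν]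

theorem HasFactorWeights.exists_factorization (hp : 1 ≤ p) (hq : 0 < q) (hr : 1 ≤ r) (hr' : r ≠ ∞)
    {T : X.space →ₗ[ℝ] Y.space} (h : HasFactorWeights X Y r.toReal (regularityPairs p q T)) :
    ∃ (f : Ω →ₘ[μ] ℝ) (g : Ω' →ₘ[ν] ℝ)
      (hf : ∀ x ∈ X.space, f * x ∈ (lebesgue μ r hr).space)
      (hg : ∀ h ∈ (lebesgue ν r hr).space, g * h ∈ Y.space)
      (S : (lebesgue μ r hr).space →L[ℝ] (lebesgue ν r hr).space),
      IsRegular p q S.toLinearMap ∧ ∀ x, T x = mulOp g hg (S (mulOp f hf x)) := by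
  obtain ⟨f, g, C, hfm, hgm, hffin, hgfin, hfX, hgY, hP⟩ := h
  have hp0 : 0 < p := zero_lt_one.trans_le hp
  have ht : 0 < r.toReal := ENNReal.toReal_pos (zero_lt_one.trans_le hr).ne' hr'
  set Z := lebesgue μ r hr with hZ
  set W := lebesgue ν r hr with hW
  set f₀ := ofENN μ f hfm
  set g₀ := ofENN ν g hgm
  have hf₀ : ∀ᵐ ω ∂μ, f₀ ω = (f ω).toReal := coeFn_ofENN hfm
  have hg₀ : ∀ᵐ ω ∂ν, g₀ ω = (g ω).toReal := coeFn_ofENN hgm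
  -- Real reciprocals of the weights; since `∞.toReal = 0`, they take the value `0` where the weight
  -- vanishes.
  set f₁ := ofENN μ (fun ω => (f ω)⁻¹) hfm.inv
  set g₁ := ofENN ν (fun ω => (g ω)⁻¹) hgm.inv
  have hf₁ : ∀ᵐ ω ∂μ, f₁ ω = ((f ω)⁻¹).toReal := coeFn_ofENN hfm.inv
  have hg₁ : ∀ᵐ ω ∂ν, g₁ ω = ((g ω)⁻¹).toReal := coeFn_ofENN hgm.inv
  have hreg : ∀ (m : ℕ) (x : Fin m → X.space),
      W.gauge (fun ω => (ellENorm p fun j => ‖(T (x j) : Ω' →ₘ[ν] ℝ) ω‖ₑ) / g ω) ≤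
        (C ^ (1 / r.toReal) : ℝ≥0) *
          Z.gauge (fun ω => f ω * ellENorm q fun j => ‖(x j : Ω →ₘ[μ] ℝ) ω‖ₑ) := by
    intro m x
    have h1 := (hP _ ⟨1, m, x, rfl⟩).2
    simp only [ENNReal.coe_one, one_mul] at h1
    rw [gauge_lebesgue hr hr' (F := fun ω => _ / g ω)
        ((measurable_ellENorm fun j => measurable_enorm_coeFn _).div hgm),
      gauge_lebesgue hr hr' (F := fun ω => f ω * _)
        (hfm.mul (measurable_ellENorm fun j => measurable_enorm_coeFn _)),
      ENNReal.coe_rpow_of_nonneg _ (one_div_pos.2 ht).le,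
      ← ENNReal.mul_rpow_of_nonneg _ _ (one_div_pos.2 ht).le]
    exact ENNReal.rpow_le_rpow h1 (one_div_pos.2 ht).le
  have hfmem : ∀ F, Measurable F → X.gauge F ≠ ∞ → Z.gauge (fun ω => f ω * F ω) ≠ ∞ := by
    intro F hF h
    rw [gauge_lebesgue hr hr' (F := fun ω => f ω * F ω) (hfm.mul hF)]
    exact ENNReal.rpow_ne_top_of_nonneg (one_div_pos.2 ht).le (hfX F hF h)
  have hf : ∀ x ∈ X.space, f₀ * x ∈ Z.space := by
    intro x hx
    refine mem_space_of_enorm_le (hfmem _ (measurable_enorm_coeFn x)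
      (gauge_space_ne_top (⟨x, hx⟩ : X.space))) ?_
    filter_upwards [enorm_coeFn_mul f₀ x, enorm_ofENN hfm hffin] with ω h1 h2
    rw [h1, h2]
  have hg : ∀ h ∈ W.space, g₀ * h ∈ Y.space := by
    intro h hh
    refine mem_space_of_enorm_le (hgY _ (measurable_enorm_coeFn h) ?_) ?_
    · rw [← gauge_lebesgue_rpow hr hr' (measurable_enorm_coeFn h)]
      exact ENNReal.rpow_ne_top_of_nonneg ht.le (gauge_space_ne_top (⟨h, hh⟩ : W.space))
    · filter_upwards [enorm_coeFn_mul g₀ h, enorm_ofENN hgm hgfin] with ω h1 h2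
      rw [h1, h2]
  have hg₁le : ∀ y : Ω' →ₘ[ν] ℝ, ∀ᵐ ω ∂ν, ‖(g₁ * y) ω‖ₑ ≤ (g ω)⁻¹ * ‖y ω‖ₑ := by
    intro y
    filter_upwards [enorm_coeFn_mul g₁ y, hg₁] with ω h1 h2
    rw [h1, h2, Real.enorm_eq_ofReal ENNReal.toReal_nonneg]
    exact mul_le_mul_left ENNReal.ofReal_toReal_le _
  have hTmem : ∀ x, g₁ * (T x : Ω' →ₘ[ν] ℝ) ∈ W.space := by
    intro x
    have h1 := hreg 1 fun _ => x
    simp only [ellENorm_fin_one hp0, ellENorm_fin_one hq] at h1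
    refine mem_space_of_enorm_le (ne_top_of_le_ne_top (ENNReal.mul_ne_top ENNReal.coe_ne_top
      (hfmem _ (measurable_enorm_coeFn _) (gauge_space_ne_top x))) h1) ?_
    filter_upwards [hg₁le (T x)] with ω h2
    exact h2.trans_eq (by rw [div_eq_mul_inv, mul_comm])
  have hχm : MeasurableSet {ω | f ω = 0} := hfm (measurableSet_singleton 0)
  set χ := chi μ {ω | f ω = 0} hχm
  have hχ : ∀ᵐ ω ∂μ, χ ω = {ω | f ω = 0}.indicator (fun _ => (1 : ℝ)) ω := AEEqFun.coeFn_mk _ _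
  have hχmem : ∀ u ∈ Z.space, χ * u ∈ Z.space := by
    intro u hu
    refine mem_space_of_enorm_le (gauge_space_ne_top (⟨u, hu⟩ : Z.space)) ?_
    filter_upwards [enorm_coeFn_mul χ u, hχ] with ω h1 h2
    rw [h1, h2]
    by_cases hω : f ω = 0 <;> simp [hω]
  -- Products `f x` cannot approximate functions supported in `{f = 0}`, so these are adjoined as a
  -- second component, on which the operator is declared to be zero.
  let e : X.space × Z.space →ₗ[ℝ] Z.space :=
    (mulOp f₀ hf).comp (LinearMap.fst ℝ X.space Z.space) +
      (mulOp χ hχmem).comp (LinearMap.snd ℝ X.space Z.space)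
  have he : ∀ x u, ∀ᵐ ω ∂μ, (e (x, u) : Ω →ₘ[μ] ℝ) ω =
      (f ω).toReal * (x : Ω →ₘ[μ] ℝ) ω +
        {ω | f ω = 0}.indicator (fun _ => (1 : ℝ)) ω * (u : Ω →ₘ[μ] ℝ) ω := by
    intro x u
    filter_upwards [AEEqFun.coeFn_add (f₀ * (x : Ω →ₘ[μ] ℝ)) (χ * (u : Ω →ₘ[μ] ℝ)),
      AEEqFun.coeFn_mul f₀ (x : Ω →ₘ[μ] ℝ), AEEqFun.coeFn_mul χ (u : Ω →ₘ[μ] ℝ), hf₀, hχ]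
      with ω h1 h2 h3 h4 h5
    change (f₀ * (x : Ω →ₘ[μ] ℝ) + χ * (u : Ω →ₘ[μ] ℝ) : Ω →ₘ[μ] ℝ) ω = _
    rw [h1, Pi.add_apply, h2, h3, Pi.mul_apply, Pi.mul_apply, h4, h5]
  let F : X.space × Z.space →ₗ[ℝ] W.space :=
    (((mulLinearMap g₁).comp (Y.space.subtype.comp T)).codRestrict W.space hTmem).comp
      (LinearMap.fst ℝ X.space Z.space)
  have hF : ∀ z, (F z : Ω' →ₘ[ν] ℝ) = g₁ * (T z.1 : Ω' →ₘ[ν] ℝ) := fun z => rfl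
  refine (exists_isRegular_extension (C := C ^ (1 / r.toReal)) hp hq e F ?_ ?_).elim
    fun S ⟨hSreg, hS⟩ => ?_
  · intro m x
    rw [norm_lpSum _ hp0, norm_lpSum _ hq]
    refine (W.gauge.mono ?_).trans ((hreg m fun j => (x j).1).trans
      (mul_le_mul_right (Z.gauge.mono ?_) _))
    · filter_upwards [ae_all_iff.2 fun j => hg₁le (T (x j).1)] with ω h1
      rw [div_eq_mul_inv, mul_comm, ← ellENorm_const_mul hp0]
      exact ellENorm_mono h1
    · filter_upwards [ae_all_iff.2 fun j => he (x j).1 (x j).2, hffin] with ω h1 h2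
      rw [← ellENorm_const_mul hq]
      refine ellENorm_mono fun j => ?_
      change _ ≤ ‖(e ((x j).1, (x j).2) : Ω →ₘ[μ] ℝ) ω‖ₑ
      rw [h1]
      -- The two components have disjoint supports, so the second one can only enlarge `|e (x, u)|`
      -- beyond `|f x|`.
      by_cases hω : f ω = 0
      · simp [hω]
      · simp [hω, enorm_mul, Real.enorm_eq_ofReal ENNReal.toReal_nonneg,
          ENNReal.ofReal_toReal h2.ne]
  · intro v ε hε
    obtain ⟨A, x, hA, hx, hAε⟩ := exists_mem_space_truncation
      (isOrderContinuous_gauge_lebesgue hr hr') X (f₁ * (v : Ω →ₘ[μ] ℝ)) v hε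
    -- Since `x` is `v / f` cut off to `A`, the element `e (x, v)` is `v` restricted to `A ∪ {f =
    -- 0}`: it is dominated by `v`, and the error lives outside `A`.
    have hev : ∀ᵐ ω ∂μ, (e (x, v) : Ω →ₘ[μ] ℝ) ω =
        (A ∪ {ω | f ω = 0}).indicator (fun ω => (v : Ω →ₘ[μ] ℝ) ω) ω := by
      filter_upwards [he x v, hx, AEEqFun.coeFn_mul f₁ (v : Ω →ₘ[μ] ℝ), hf₁, hffin]
        with ω h1 h2 h3 h4 h5
      rw [h1, h2]
      by_cases hω : f ω = 0
      · simp [hω]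
      · by_cases hωA : ω ∈ A
        · simp only [Set.indicator_of_mem hωA, Set.indicator_of_mem (Set.mem_union_left _ hωA)]
          rw [h3, Pi.mul_apply, h4, ← mul_assoc, ← ENNReal.toReal_mul,
            ENNReal.mul_inv_cancel hω h5.ne]
          simp [hω]
        · simp [hω, hωA]
    refine ⟨(x, v), ?_, ?_⟩
    · filter_upwards [hev] with ω h1
      rw [h1]
      by_cases hω : ω ∈ A ∪ {ω | f ω = 0}
      · rw [Set.indicator_of_mem hω]
      · rw [Set.indicator_of_notMem hω]
        simp
    · rw [← Z.gauge_enorm]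
      refine (Z.gauge.mono ?_).trans hAε
      filter_upwards [hev, AEEqFun.coeFn_sub (v : Ω →ₘ[μ] ℝ) (e (x, v) : Ω →ₘ[μ] ℝ)] with ω h1 h2
      rw [h2, Pi.sub_apply, h1]
      by_cases hωA : ω ∈ A
      · simp [hωA]
      · by_cases hω : f ω = 0 <;> simp [hωA, hω]
  · refine ⟨f₀, g₀, hf, hg, S, hSreg, fun x => ?_⟩
    have h1 : mulOp f₀ hf x = e (x, 0) := by simp [e]
    rw [h1, hS]
    apply Subtype.ext
    change (T x : Ω' →ₘ[ν] ℝ) = g₀ * (F (x, 0) : Ω' →ₘ[ν] ℝ)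
    have h2 := (hP _ ⟨1, 1, fun _ => x, rfl⟩).1
    simp only [ENNReal.coe_one, one_mul, ellENorm_fin_one hp0] at h2
    rw [hF]
    ext1
    filter_upwards [AEEqFun.coeFn_mul g₀ (g₁ * (T x : Ω' →ₘ[ν] ℝ)),
      AEEqFun.coeFn_mul g₁ (T x : Ω' →ₘ[ν] ℝ), hg₀, hg₁, hgfin, h2] with ω h3 h4 h5 h6 h7 h8
    rw [h3, Pi.mul_apply, h4, Pi.mul_apply, h5, h6, ← mul_assoc, ← ENNReal.toReal_mul]
    -- Where `g` vanishes so does `T x`, by the first half of the weight condition; elsewhere `g`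
    -- and its reciprocal cancel.
    by_cases hω : g ω = 0
    · have : (T x : Ω' →ₘ[ν] ℝ) ω = 0 := by simpa using h8 hω
      rw [this, mul_zero]
    · rw [ENNReal.mul_inv_cancel hω h7.ne, ENNReal.toReal_one, one_mul]

end BanachFunctionSpace

end RegularOperators

/-! ### The equivalence of the three conditions. -/

open RegularOperators in
theorem mainTheorem3 {Ω Ω' : Type*} [MeasurableSpace Ω] [MeasurableSpace Ω']
    {μ : Measure Ω} {ν : Measure Ω'} [SigmaFinite μ] [SigmaFinite ν]
    (p p' q r r' : ℝ≥0∞) (hp : p.HolderConjugate p') (hq : 0 < q)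
    (hr : r.HolderConjugate r') (hr_one : 1 ≤ r) (hr_top : r ≠ ∞)
    (X : BanachFunctionSpace μ) (Y : BanachFunctionSpace ν)
    (hX : X.IsConvex r) (hY : Y.IsConcave r)
    (hXc : OrderContinuous X.norm) (hYc : OrderContinuous Y.dualNorm)
    (T : X.space →L[ℝ] Y.space) :
    List.TFAE [
      ∃ K : ℝ≥0, 0 < K ∧ ∀ (n m : ℕ) (x : Fin n → Fin m → X.space)
        (y : Fin n → Fin m → (Ω' →ₘ[ν] ℝ)), (∀ i j, Y.dualNorm (y i j) < ∞) →
        ENNReal.ofReal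
          (∑ i, ∑ j, |∫ ω, (T (x i j) : Ω' →ₘ[ν] ℝ) ω * y i j ω ∂ν|) ≤
          K * X.norm (mixedSum r q (fun i j => (x i j : Ω →ₘ[μ] ℝ))) *
            Y.dualNorm (mixedSum r' p' y),
      ∃ K : ℝ≥0, 0 < K ∧ ∀ (n m : ℕ) (x : Fin n → Fin m → X.space),
        Y.norm (mixedSum r p (fun i j => (T (x i j) : Ω' →ₘ[ν] ℝ))) ≤
          K * X.norm (mixedSum r q (fun i j => (x i j : Ω →ₘ[μ] ℝ))),
      ∃ (f : Ω →ₘ[μ] ℝ) (g : Ω' →ₘ[ν] ℝ)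
        (hf : ∀ x ∈ X.space, f * x ∈ (lebesgue μ r hr_one).space)
        (hg : ∀ h ∈ (lebesgue ν r hr_one).space, g * h ∈ Y.space)
        (S : (lebesgue μ r hr_one).space →L[ℝ] (lebesgue ν r hr_one).space),
        IsRegular p q S.toLinearMap ∧ ∀ x, T x = mulOp g hg (S (mulOp f hf x))] := by
  have hp_one : 1 ≤ p := one_le_of_holderConjugate hp
  have hp_pos : 0 < p := zero_lt_one.trans_le hp_one
  tfae_have 1 → 2 := by
    rintro ⟨K, hK, h⟩
    refine ⟨K, hK, fun n m x => ?_⟩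
    obtain ⟨M, hM⟩ := hY.gauge (zero_lt_one.trans_le hr_one)
    -- Order continuity of `Y` itself, as opposed to that of its Köthe dual, comes from
    -- `r`-concavity.
    have hYc' := BanachFunctionSpace.isOrderContinuous_of_isConcave hr_one hr_top hM
    obtain ⟨y, hy, hy1, hy2⟩ := BanachFunctionSpace.exists_dual_norming_mixed hp hr hYc'
      fun i j => T (x i j)
    exact (hy2.trans (h n m x y hy)).trans ((mul_le_mul_right hy1 _).trans_eq (mul_one _))
  tfae_have 2 → 1 := by
    rintro ⟨K, hK, h⟩
    exact ⟨K, hK, fun n m x y hy =>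
      (BanachFunctionSpace.sum_abs_integral_le hp hr (fun i j => T (x i j)) y hy).trans
        (mul_le_mul_left (h n m x) _)⟩
  tfae_have 2 → 3 := by
    rintro ⟨K, -, h⟩
    exact (BanachFunctionSpace.hasFactorWeights_regularityPairs (T := T.toLinearMap) hp_one hq hr
      hr_top hX hY hXc hYc h).exists_factorization hp_one hq hr_one hr_top
  tfae_have 3 → 2 := by
    rintro ⟨f, g, hf, hg, S, hS, hT⟩
    exact BanachFunctionSpace.norm_mixedSum_le_of_factorization hr_one hr_top hp_pos hq hf hg hS hT
  tfae_finish
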